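/- Let $V=V_{\bar 0}\oplus V_{\bar 1}$ be a finite-dimensional complex super vector space with an odd non-degenerate supersymmetric bilinear form $J\colon V\otimes V\to\mathbb{C}$, i.e. $J(V_{\bar i},V_{\bar i})=0$ and $J(v,w)=(-1)^{|v||w|}J(w,v)$ for homogeneous $v,w$. Let $GL(V)$ be the functor sending a mixed supermanifold $S$ to the group of automorphisms over $S$ of the trivial vector bundle $S\times V\to S$ (equivalently, of even automorphisms of the $\mathcal O(S)$-module $\mathcal{O}(S)\otimes V$), and let $P(V,J)\leqslant GL(V)$ be the subgroup of those automorphisms that preserve the odd $\mathcal O(S)$-bilinear extension of $J$. (A mixed supermanifold is a superspace with second countable Hausdorff base that is locally modelled on $\mathbb{R}^n\times\mathbb{C}^m$ with the sheaf of complex-valued smooth functions that are holomorphic along $\mathbb{C}^m$, tensored with an exterior algebra $\bigwedge(\mathbb{C}^q)^*$.) (a) Let $M$ be a supermanifold (a $cs$ manifold, i.e. $m=0$) locally modelled on $V$, so of dimension $\dim V_{\bar0}\,|\,\dim V_{\bar 1}$, and let $L(M)$ be its frame bundle, the principal $GL(V)$-bundle whose $T$-points are the pairs $(f,\varphi)$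 of a morphism $f\colon T\to M$ and an isomorphism $\varphi\colon T\times V\to f^*TM$ of vector bundles over $T$. Then there is a one-to-one correspondence between the $P(V,J)$-structures on $L(M)$, i.e. the reductions $P\subseteq L(M)$ of the structure group to $P(V,J)$, and the odd non-degenerate supersymmetric maps of vector bundles $B\colon TM\otimes TM\to\underline{\mathbb{C}^{1|0}}_M$. Under it, a frame $s$ of $TM$ over an open $U\subseteq M$ is a section of the structure $P$ if and only if it is orthonormal for the corresponding $B$, i.e. $B(s(v),s(w))=J(v,w)$ for all $v,w\in V$. (b) Let $\mathfrak{p}(V,J)\subseteq\mathfrak{gl}(V)$ be the Lie superalgebra of $P(V,J)$. For a graded subspace $\mathfrak g\subseteq\mathfrak{gl}(V)$ put $\mathfrak g^{(-1)}=V$, $\mathfrak g^{(0)}=\mathfrak g$ and, for $k\ge 1$, $\mathfrak g^{(k)}=\{X\in\mathrm{Hom}(V,\mathfrak g^{(k-1)})\mid X(v)(w)=(-1)^{|v||w|}X(w)(v)\text{ for all homogeneous }v,w\in V\}$. Then $\mathfrak p(V,J)^{(1)}=0$. In particular $P(V,J)\leqslant GL(V)$ is of finite type: there is $k\ge1$ such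 that $\mathfrak p(V,J)^{(k+l)}=0$ for all $l\ge 0$. -/

import Mathlib

open TopologicalSpace
open scoped TensorProduct ContDiff

noncomputable section

/-! ### Super vector spaces and supercommutative superalgebras -/

/-- The Koszul sign `(-1)^i`. -/
def sgn (i : ZMod 2) : ℂ := if i = 0 then 1 else -1

theorem parity_cases (i : ZMod 2) : i = 0 ∨ i = 1 := by
  revert i
  decide

theorem sgn_mul_sgn (i j : ZMod 2) : sgn i * sgn j = sgn (i + j) := by
  obtain rfl | rfl := parity_cases i
  all_goals obtain rfl | rfl := parity_cases j
  all_goals simp [sgn, CharTwo.add_self_eq_zero]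

/-- A complex super vector space: a `ℤ/2`-grading `V = V₀ ⊕ V₁` of a complex vector space. -/
class SuperModule (V : Type) [AddCommGroup V] [Module ℂ V] where
  gr : ZMod 2 → Submodule ℂ V
  isCompl : IsCompl (gr 0) (gr 1)

/-- The homogeneous component of parity `i`. -/
abbrev gr (V : Type) [AddCommGroup V] [Module ℂ V] [SuperModule V] (i : ZMod 2) :
    Submodule ℂ V := SuperModule.gr i

/-- The projection of a super vector space onto its component of parity `i`. -/
def homProj (V : Type) [AddCommGroup V] [Module ℂ V] [SuperModule V] (i : ZMod 2) :
    V →ₗ[ℂ] V :=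
  if i = 0 then (gr V 0).projection (gr V 1) SuperModule.isCompl
  else (gr V 1).projection (gr V 0) SuperModule.isCompl.symm

/-- A supercommutative complex superalgebra. -/
class SuperAlgebra (A : Type) [Ring A] [Algebra ℂ A] extends SuperModule A where
  one_mem : (1 : A) ∈ gr 0
  mul_mem : ∀ {i j : ZMod 2} {a b : A}, a ∈ gr i → b ∈ gr j → a * b ∈ gr (i + j)
  supercomm : ∀ {i j : ZMod 2} {a b : A}, a ∈ gr i → b ∈ gr j → a * b = sgn (i * j) • (b * a)

/-! ### Superspaces and their morphisms -/

/-- A topological space with a sheaf of supercommutative complex superalgebras. -/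
structure SuperSpace where
  carrier : Type
  [top : TopologicalSpace carrier]
  O : Opens carrier → Type
  [ring : ∀ U, Ring (O U)]
  [algebra : ∀ U, Algebra ℂ (O U)]
  [super : ∀ U, SuperAlgebra (O U)]
  res : ∀ {U V : Opens carrier}, U ≤ V → O V →ₐ[ℂ] O U
  res_gr : ∀ {U V : Opens carrier} (h : U ≤ V) {i : ZMod 2} {a : O V},
    a ∈ gr (O V) i → res h a ∈ gr (O U) i
  res_refl : ∀ {U : Opens carrier} (a : O U), res le_rfl a = a
  res_res : ∀ {U V W : Opens carrier} (h : U ≤ V) (h' : V ≤ W) (a : O W),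
    res h (res h' a) = res (h.trans h') a
  glue : ∀ {ι : Type} (U : ι → Opens carrier) (s : ∀ k, O (U k)),
    (∀ k l, res (inf_le_left : U k ⊓ U l ≤ U k) (s k) = res inf_le_right (s l)) →
    ∃! t : O (⨆ k, U k), ∀ k, res (le_iSup U k) t = s k

attribute [instance] SuperSpace.top SuperSpace.ring SuperSpace.algebra SuperSpace.super

namespace SuperSpace

/-- Global functions. -/
abbrev Γ (X : SuperSpace) : Type := X.O ⊤

/-- The germ of `a` at `x` is invertible in the stalk of the structure sheaf at `x`. -/
def IsUnitAt (X : SuperSpace) {U : Opens X.carrier} (a : X.O U) (x : X.carrier) : Prop :=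
  ∃ (W : Opens X.carrier) (h : W ≤ U), x ∈ W ∧ IsUnit (X.res h a)

/-- The preimage of an open set under a continuous map. -/
abbrev preim {X Y : Type} [TopologicalSpace X] [TopologicalSpace Y] (f : X → Y)
    (hf : Continuous f) (V : Opens Y) : Opens X := ⟨f ⁻¹' V, V.isOpen.preimage hf⟩

theorem preim_mono {X Y : Type} [TopologicalSpace X] [TopologicalSpace Y] (f : X → Y)
    (hf : Continuous f) {V W : Opens Y} (h : V ≤ W) : preim f hf V ≤ preim f hf W :=
  fun _ hx => h hx

/-- A morphism of (locally) ringed superspaces over `ℂ`: a continuous map together with a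
parity preserving morphism of sheaves of algebras which is local on stalks. -/
structure Hom (X Y : SuperSpace) where
  base : X.carrier → Y.carrier
  cont : Continuous base
  comap : ∀ V : Opens Y.carrier, Y.O V →ₐ[ℂ] X.O (preim base cont V)
  comap_gr : ∀ (V : Opens Y.carrier) {i : ZMod 2} {a : Y.O V},
    a ∈ gr (Y.O V) i → comap V a ∈ gr (X.O (preim base cont V)) i
  comap_res : ∀ {V W : Opens Y.carrier} (h : V ≤ W) (a : Y.O W),
    comap V (Y.res h a) = X.res (preim_mono base cont h) (comap W a)
  isLocal : ∀ (V : Opens Y.carrier) (a : Y.O V) (x : X.carrier), base x ∈ V →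
    X.IsUnitAt (comap V a) x → Y.IsUnitAt a (base x)

/-- The preimage of an open set under a morphism. -/
abbrev Hom.pre {X Y : SuperSpace} (f : Hom X Y) (V : Opens Y.carrier) : Opens X.carrier :=
  preim f.base f.cont V

/-- Pullback of global functions. -/
def Hom.onΓ {X Y : SuperSpace} (f : Hom X Y) : Y.Γ →ₐ[ℂ] X.Γ :=
  (X.res (fun _ _ => trivial : ⊤ ≤ f.pre ⊤)).comp (f.comap ⊤)

/-- Composition of morphisms. -/
abbrev Hom.comp {X Y Z : SuperSpace} (f : Hom Y Z) (g : Hom X Y) : Hom X Z where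
  base x := f.base (g.base x)
  cont := f.cont.comp g.cont
  comap V := (g.comap (f.pre V)).comp (f.comap V)
  comap_gr V _ _ ha := g.comap_gr _ (f.comap_gr V ha)
  comap_res {V W} h a := by
    rw [AlgHom.comp_apply, f.comap_res h a, g.comap_res]
    rfl
  isLocal V a x hx hu := f.isLocal V a (g.base x) hx (g.isLocal _ (f.comap V a) x hx hu)

/-- `i : X ⟶ Y` identifies `X` with an open subspace of `Y`. -/
structure Hom.IsOpenImmersion {X Y : SuperSpace} (i : Hom X Y) : Prop where
  isOpenEmbedding : Topology.IsOpenEmbedding i.base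
  bijective : ∀ V : Opens Y.carrier, (V : Set Y.carrier) ⊆ Set.range i.base →
    Function.Bijective (i.comap V)

end SuperSpace

/-! ### The model spaces `𝔸(V_ℝ)` -/

/-- The body `ℝⁿ × ℂᵐ` of the model space. -/
abbrev ModelBody (n m : ℕ) : Type := (Fin n → ℝ) × (Fin m → ℂ)

/-- The exterior algebra on `q` odd generators. -/
abbrev OddCoord (q : ℕ) : Type := ExteriorAlgebra ℂ (Fin q → ℂ)

/-- The component of parity `i` of the exterior algebra. -/
abbrev oddGr (q : ℕ) (i : ZMod 2) : Submodule ℂ (OddCoord q) :=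
  CliffordAlgebra.evenOdd (0 : QuadraticForm ℂ (Fin q → ℂ)) i

/-- `F(x, z)` is smooth near the given point and its differential there is complex linear in
the direction of `ℂᵐ`. -/
def PartHolAt {n m : ℕ} (F : ModelBody n m → ℂ) (x : ModelBody n m) : Prop :=
  ContDiffAt ℝ ∞ F x ∧
    ∀ w : Fin m → ℂ, fderiv ℝ F x (0, Complex.I • w) = Complex.I * fderiv ℝ F x (0, w)

/-- Extension by zero of a function on an open set. -/
def extZero {n m : ℕ} {U : Opens (ModelBody n m)} (F : U → ℂ) : ModelBody n m → ℂ :=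
  open Classical in fun y => if hy : y ∈ U then F ⟨y, hy⟩ else 0

theorem PartHolAt.congr {n m : ℕ} {F G : ModelBody n m → ℂ} {x : ModelBody n m}
    (hF : PartHolAt F x) (h : G =ᶠ[nhds x] F) : PartHolAt G x :=
  ⟨hF.1.congr_of_eventuallyEq h, fun w => by rw [h.fderiv_eq]; exact hF.2 w⟩

theorem PartHolAt.const {n m : ℕ} (c : ℂ) (x : ModelBody n m) :
    PartHolAt (fun _ => c) x :=
  ⟨contDiffAt_const, fun w => by simp⟩

theorem PartHolAt.add {n m : ℕ} {F G : ModelBody n m → ℂ} {x : ModelBody n m}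
    (hF : PartHolAt F x) (hG : PartHolAt G x) : PartHolAt (fun y => F y + G y) x := by
  refine ⟨hF.1.add hG.1, fun w => ?_⟩
  have h : fderiv ℝ (fun y => F y + G y) x = _ :=
    fderiv_fun_add (hF.1.differentiableAt (by simp)) (hG.1.differentiableAt (by simp))
  rw [h]
  simp only [add_apply, hF.2 w, hG.2 w]
  ring

theorem PartHolAt.mul {n m : ℕ} {F G : ModelBody n m → ℂ} {x : ModelBody n m}
    (hF : PartHolAt F x) (hG : PartHolAt G x) : PartHolAt (fun y => F y * G y) x := by
  refine ⟨hF.1.mul hG.1, fun w => ?_⟩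
  have h : fderiv ℝ (fun y => F y * G y) x = _ :=
    fderiv_fun_mul (hF.1.differentiableAt (by simp)) (hG.1.differentiableAt (by simp))
  rw [h]
  simp only [add_apply, smul_apply, smul_eq_mul,
    hF.2 w, hG.2 w]
  ring

theorem PartHolAt.sum {n m : ℕ} {ι : Type} (s : Finset ι) {F : ι → ModelBody n m → ℂ}
    {x : ModelBody n m} (hF : ∀ k ∈ s, PartHolAt (F k) x) :
    PartHolAt (fun y => ∑ k ∈ s, F k y) x := by
  classical
  induction s using Finset.induction_on with
  | empty => simpa using PartHolAt.const 0 x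
  | insert a s ha ih =>
    simp only [Finset.sum_insert ha]
    exact (hF a (by simp)).add (ih fun k hk => hF k (by simp [hk]))

theorem extZero_eventuallyEq {n m : ℕ} {U V : Opens (ModelBody n m)} {F : U → ℂ} {G : V → ℂ}
    {W : Opens (ModelBody n m)} {x : ModelBody n m} (hx : x ∈ W) (hU : W ≤ U) (hV : W ≤ V)
    (h : ∀ y (hy : y ∈ W), F ⟨y, hU hy⟩ = G ⟨y, hV hy⟩) :
    extZero F =ᶠ[nhds x] extZero G := by
  filter_upwards [W.isOpen.mem_nhds hx] with y hy
  simp [extZero, hU hy, hV hy, h y hy]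

theorem extZero_eventuallyEq' {n m : ℕ} {U : Opens (ModelBody n m)} {F : U → ℂ}
    {G : ModelBody n m → ℂ} {x : ModelBody n m} (hx : x ∈ U)
    (h : ∀ y (hy : y ∈ U), F ⟨y, hy⟩ = G y) :
    extZero F =ᶠ[nhds x] G := by
  filter_upwards [U.isOpen.mem_nhds hx] with y hy
  have hy' : y ∈ U := hy
  simp [extZero, hy', h y hy]

/-- A function on `U ⊆ ℝⁿ × ℂᵐ` with values in the exterior algebra is a section of
`𝒪_{ℝⁿ × ℂᵐ} ⊗ ⋀(ℂ^q)*` if its coefficients are smooth and holomorphic along `ℂᵐ`. -/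
def IsModelSection {n m q : ℕ} {U : Opens (ModelBody n m)} (h : U → OddCoord q) : Prop :=
  ∀ (l : OddCoord q →ₗ[ℂ] ℂ), ∀ x ∈ U, PartHolAt (extZero fun y => l (h y)) x

/-- The superalgebra of sections of the model space over `U`. -/
def modelSections (n m q : ℕ) (U : Opens (ModelBody n m)) : Subalgebra ℂ (U → OddCoord q) where
  carrier := {h | IsModelSection h}
  mul_mem' {a b} ha hb l x hx := by
    let B := (Pi.basisFun ℂ (Fin q)).ExteriorAlgebra
    have key : ∀ y : U, l ((a * b) y) =
        ∑ s, ∑ t, (B.coord s (a y) * B.coord t (b y)) * l (B s * B t) := by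
      intro y
      conv_lhs => rw [Pi.mul_apply, ← B.sum_repr (a y), ← B.sum_repr (b y)]
      rw [Finset.sum_mul_sum, map_sum]
      refine Finset.sum_congr rfl fun s _ => ?_
      rw [map_sum]
      refine Finset.sum_congr rfl fun t _ => ?_
      rw [smul_mul_smul_comm, map_smul, smul_eq_mul]
      rfl
    refine PartHolAt.congr (F := fun y => ∑ s, ∑ t,
      (extZero (fun y => B.coord s (a y)) y * extZero (fun y => B.coord t (b y)) y)
        * l (B s * B t)) ?_ (extZero_eventuallyEq' hx fun y hy => ?_)
    · exact PartHolAt.sum _ fun s _ => PartHolAt.sum _ fun t _ =>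
        ((ha _ x hx).mul (hb _ x hx)).mul (PartHolAt.const _ x)
    · rw [key]
      simp [extZero, hy]
  add_mem' {a b} ha hb l x hx := by
    refine ((ha l x hx).add (hb l x hx)).congr (extZero_eventuallyEq' hx fun y hy => ?_)
    simp [extZero, hy]
  algebraMap_mem' c l x hx := by
    refine (PartHolAt.const (l (algebraMap ℂ _ c)) x).congr
      (extZero_eventuallyEq' hx fun y hy => ?_)
    simp

theorem oddGr_supercomm {q : ℕ} {i j : ZMod 2} {a b : OddCoord q} (ha : a ∈ oddGr q i)
    (hb : b ∈ oddGr q j) : a * b = sgn (i * j) • (b * a) := by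
  have h := CliffordAlgebra.map_mul_map_of_isOrtho_of_mem_evenOdd
    (QuadraticMap.Isometry.id (0 : QuadraticForm ℂ (Fin q → ℂ)))
    (QuadraticMap.Isometry.id (0 : QuadraticForm ℂ (Fin q → ℂ)))
    (fun x y => by simp [QuadraticMap.IsOrtho]) a b ha hb
  rw [CliffordAlgebra.map_id] at h
  simp only [AlgHom.id_apply] at h
  rw [h]
  obtain rfl | rfl := parity_cases i
  all_goals obtain rfl | rfl := parity_cases j
  all_goals simp [sgn]

/-- The parity of a section of the model space is taken pointwise. -/
def modelGr (n m q : ℕ) (U : Opens (ModelBody n m)) (i : ZMod 2) :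
    Submodule ℂ (modelSections n m q U) where
  carrier := {h | ∀ x, h.1 x ∈ oddGr q i}
  add_mem' ha hb x := Submodule.add_mem _ (ha x) (hb x)
  zero_mem' _ := Submodule.zero_mem _
  smul_mem' c _ hh x := Submodule.smul_mem _ c (hh x)

theorem IsModelSection.map {n m q : ℕ} {U : Opens (ModelBody n m)} {h : U → OddCoord q}
    (hh : IsModelSection h) (p : OddCoord q →ₗ[ℂ] OddCoord q) :
    IsModelSection (fun x => p (h x)) :=
  fun l => hh (l ∘ₗ p)

instance modelSuper (n m q : ℕ) (U : Opens (ModelBody n m)) :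
    SuperAlgebra (modelSections n m q U) where
  gr := modelGr n m q U
  isCompl := by
    have hc : IsCompl (oddGr q 0) (oddGr q 1) := CliffordAlgebra.evenOdd_isCompl _
    constructor
    · rw [Submodule.disjoint_def]
      intro h h0 h1
      apply Subtype.ext
      funext x
      exact Submodule.disjoint_def.mp hc.disjoint _ (h0 x) (h1 x)
    · rw [codisjoint_iff, eq_top_iff]
      intro h _
      refine Submodule.mem_sup.mpr ⟨⟨_, h.2.map ((oddGr q 0).projection _ hc)⟩, fun x => ?_,
        ⟨_, h.2.map ((oddGr q 1).projection _ hc.symm)⟩, fun x => ?_, ?_⟩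
      · exact SetLike.coe_mem ((oddGr q 0).projectionOnto _ hc (h.1 x))
      · exact SetLike.coe_mem ((oddGr q 1).projectionOnto _ hc.symm (h.1 x))
      · apply Subtype.ext
        funext x
        exact Submodule.projection_add_projection_eq_self hc (h.1 x)
  one_mem _ := CliffordAlgebra.one_le_evenOdd_zero _ (Submodule.one_le.mp le_rfl)
  mul_mem ha hb x := SetLike.mul_mem_graded (ha x) (hb x)
  supercomm ha hb := Subtype.ext (funext fun x => oddGr_supercomm (ha x) (hb x))

/-- The model space `𝔸(V_ℝ)` with body `ℝⁿ × ℂᵐ` and odd dimension `q`; its functions are the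
functions on `ℝⁿ × ℂᵐ` with values in the exterior algebra on `q` generators that are smooth,
and holomorphic along `ℂᵐ`. -/
def modelSpace (n m q : ℕ) : SuperSpace where
  carrier := ModelBody n m
  O U := modelSections n m q U
  res {U V} h :=
    { toFun := fun a => ⟨fun x => a.1 ⟨x, h x.2⟩, fun l x hx =>
        (a.2 l x (h hx)).congr
          (extZero_eventuallyEq hx le_rfl h fun _ _ => rfl)⟩
      map_one' := rfl
      map_mul' := fun _ _ => rfl
      map_zero' := rfl
      map_add' := fun _ _ => rfl
      commutes' := fun _ => rfl }
  res_gr {U V} h i a ha := fun x : U => (show a ∈ modelGr n m q V i from ha) ⟨x, h x.2⟩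
  res_refl _ := rfl
  res_res _ _ _ := rfl
  glue {ι} U s hs := by
    classical
    have hmem : ∀ x : (⨆ k, U k : Opens (ModelBody n m)), ∃ k, (x : ModelBody n m) ∈ U k :=
      fun x => Opens.mem_iSup.mp x.2
    choose c hc using hmem
    have hval : ∀ (k l : ι) (x : ModelBody n m) (hk : x ∈ U k) (hl : x ∈ U l),
        (s k).1 ⟨x, hk⟩ = (s l).1 ⟨x, hl⟩ := fun k l x hk hl =>
      congrFun (congrArg Subtype.val (hs k l)) ⟨x, hk, hl⟩
    refine ⟨⟨fun x => (s (c x)).1 ⟨x, hc x⟩, fun l x hx => ?_⟩, fun k => ?_, fun t ht => ?_⟩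
    · obtain ⟨k, hk⟩ := Opens.mem_iSup.mp hx
      refine ((s k).2 l x hk).congr (extZero_eventuallyEq hk (le_iSup U k) le_rfl
        fun y hy => ?_)
      exact congrArg l (hval _ _ _ _ _)
    · apply Subtype.ext
      funext x
      exact hval _ _ _ _ _
    · apply Subtype.ext
      funext x
      have := congrFun (congrArg Subtype.val (ht (c x))) ⟨x, hc x⟩
      exact this

/-! ### Mixed supermanifolds -/

open SuperSpace in
/-- `X` is near `x` isomorphic to an open subspace of the model space `𝔸(ℝⁿ × ℂᵐ | q)`. -/
def HasChartAt (X : SuperSpace) (x : X.carrier) (n m q : ℕ) : Prop :=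
  ∃ (C : SuperSpace) (i : Hom C X) (j : Hom C (modelSpace n m q)),
    i.IsOpenImmersion ∧ j.IsOpenImmersion ∧ x ∈ Set.range i.base

/-- Mixed supermanifolds. -/
structure MixedSupermanifold extends SuperSpace where
  t2 : T2Space carrier
  secondCountable : SecondCountableTopology carrier
  charts : ∀ x : carrier, ∃ n m q, HasChartAt toSuperSpace x n m q

/-- `M` is a (`cs`) supermanifold which is locally modelled on the super vector space `V`,
that is, on `𝔸(V_ℝ)` with `(V_ℝ)₀` a real form of `V₀` and `(V_ℝ)₁ = V₁`. -/
def MixedSupermanifold.IsModelledOn (M : MixedSupermanifold) (V : Type) [AddCommGroup V]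
    [Module ℂ V] [SuperModule V] : Prop :=
  ∀ x : M.carrier, HasChartAt M.toSuperSpace x
    (Module.finrank ℂ (gr V 0)) 0 (Module.finrank ℂ (gr V 1))

/-! ### Sections of `f^*TM`: vector fields along a morphism -/

open SuperSpace

/-- Families of linear maps `𝒪_M(W) → 𝒪_T(f⁻¹W)`, `W ⊆ M` open. -/
abbrev OpAlong {T M : SuperSpace} (f : Hom T M) : Type :=
  ∀ W : Opens M.carrier, M.O W →ₗ[ℂ] T.O (f.pre W)

/-- Homogeneous derivations `𝒪_M → f_* 𝒪_T` of parity `p` along `f : T ⟶ M`. -/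
def Der {T M : SuperSpace} (f : Hom T M) (p : ZMod 2) : Submodule ℂ (OpAlong f) where
  carrier := {D |
    (∀ (W W' : Opens M.carrier) (h : W ≤ W') (a : M.O W'),
      D W (M.res h a) = T.res (preim_mono f.base f.cont h) (D W' a)) ∧
    (∀ (W : Opens M.carrier) (i : ZMod 2), ∀ a ∈ gr (M.O W) i,
      D W a ∈ gr (T.O (f.pre W)) (p + i)) ∧
    (∀ (W : Opens M.carrier) (i : ZMod 2), ∀ a ∈ gr (M.O W) i, ∀ b : M.O W,
      D W (a * b) = D W a * f.comap W b + sgn (p * i) • (f.comap W a * D W b))}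
  add_mem' {D E} hD hE := by
    refine ⟨fun W W' h a => ?_, fun W i a ha => ?_, fun W i a ha b => ?_⟩
    · simp [hD.1 W W' h a, hE.1 W W' h a]
    · exact Submodule.add_mem _ (hD.2.1 W i a ha) (hE.2.1 W i a ha)
    · simp only [Pi.add_apply, LinearMap.add_apply, hD.2.2 W i a ha b, hE.2.2 W i a ha b,
        add_mul, mul_add, smul_add]
      abel
  zero_mem' := ⟨fun _ _ _ _ => by simp, fun _ _ _ _ => by simp, fun _ _ _ _ _ => by simp⟩
  smul_mem' c D hD := by
    refine ⟨fun W W' h a => ?_, fun W i a ha => ?_, fun W i a ha b => ?_⟩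
    · simp [hD.1 W W' h a]
    · exact Submodule.smul_mem _ c (hD.2.1 W i a ha)
    · simp only [Pi.smul_apply, LinearMap.smul_apply, hD.2.2 W i a ha b, smul_add,
        smul_mul_assoc, mul_smul_comm]
      rw [smul_comm c]

/-- Global sections of `f^*TM`, that is, sums of homogeneous derivations `𝒪_M → f_* 𝒪_T` along
`f` (for supermanifolds `f^*𝒯_M` is the sheaf of derivations along `f`).  For an open
immersion `f` these are the vector fields on the open subspace `T` of `M`. -/
def Vect {T M : SuperSpace} (f : Hom T M) : Submodule ℂ (OpAlong f) := Der f 0 ⊔ Der f 1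

theorem Der_le_Vect {T M : SuperSpace} (f : Hom T M) (p : ZMod 2) : Der f p ≤ Vect f := by
  fin_cases p
  · exact le_sup_left
  · exact le_sup_right

theorem Vect_induction {T M : SuperSpace} {f : Hom T M} {N : Submodule ℂ (OpAlong f)}
    (h : ∀ p, Der f p ≤ N) : Vect f ≤ N := sup_le (h 0) (h 1)

/-- Left multiplication of an operator along `f` by a function on `T`. -/
def opSmul {T M : SuperSpace} (f : Hom T M) : T.Γ →ₗ[ℂ] OpAlong f →ₗ[ℂ] OpAlong f :=
  LinearMap.mk₂ ℂ (fun a D W => LinearMap.mulLeft ℂ (T.res le_top a) ∘ₗ D W)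
    (fun a b D => by ext W h; simp [add_mul])
    (fun c a D => by ext W h; simp)
    (fun a D E => by ext W h; simp [mul_add])
    (fun c a D => by ext W h; simp)

theorem opSmul_mem_Der {T M : SuperSpace} (f : Hom T M) {i p : ZMod 2} {a : T.Γ}
    (ha : a ∈ gr T.Γ i) {D : OpAlong f} (hD : D ∈ Der f p) : opSmul f a D ∈ Der f (i + p) := by
  have hap : ∀ W (b : M.O W), opSmul f a D W b = T.res le_top a * D W b := fun _ _ => rfl
  refine ⟨fun W W' h b => ?_, fun W j b hb => ?_, fun W j b hb c => ?_⟩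
  · rw [hap, hap, hD.1 W W' h b, map_mul, T.res_res]
  · rw [hap, add_assoc]
    exact SuperAlgebra.mul_mem (T.res_gr _ ha) (hD.2.1 W j b hb)
  · have hs : T.res le_top a * f.comap W b = sgn (i * j) • (f.comap W b * T.res le_top a) :=
      SuperAlgebra.supercomm (T.res_gr (le_top : f.pre W ≤ ⊤) ha)
        (f.comap_gr W hb)
    rw [hap, hap, hap, hD.2.2 W j b hb c, mul_add, mul_smul_comm, ← mul_assoc, ← mul_assoc, hs,
      smul_mul_assoc, mul_assoc (f.comap W b), smul_smul]
    congr 2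
    rw [mul_comm, sgn_mul_sgn, add_mul]

theorem opSmul_mem_Vect {T M : SuperSpace} (f : Hom T M) (a : T.Γ) {D : OpAlong f}
    (hD : D ∈ Vect f) : opSmul f a D ∈ Vect f := by
  have ha : a ∈ gr T.Γ 0 ⊔ gr T.Γ 1 := by
    rw [(SuperModule.isCompl (V := T.Γ)).sup_eq_top]; trivial
  obtain ⟨a0, h0, a1, h1, rfl⟩ := Submodule.mem_sup.mp ha
  obtain ⟨D0, k0, D1, k1, rfl⟩ := Submodule.mem_sup.mp hD
  simp only [map_add, LinearMap.add_apply]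
  exact Submodule.add_mem _
    (Submodule.add_mem _ (Der_le_Vect f _ (opSmul_mem_Der f h0 k0))
      (Der_le_Vect f _ (opSmul_mem_Der f h1 k0)))
    (Submodule.add_mem _ (Der_le_Vect f _ (opSmul_mem_Der f h0 k1))
      (Der_le_Vect f _ (opSmul_mem_Der f h1 k1)))

/-- The left `𝒪(T)`-module structure of the sections of `f^*TM`. -/
def vectSmul {T M : SuperSpace} (f : Hom T M) : T.Γ →ₗ[ℂ] Vect f →ₗ[ℂ] Vect f :=
  LinearMap.mk₂ ℂ (fun a X => ⟨opSmul f a X.1, opSmul_mem_Vect f a X.2⟩)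
    (fun a b D => Subtype.ext (by simp))
    (fun c a D => Subtype.ext (by simp))
    (fun a D E => Subtype.ext (by simp))
    (fun c a D => Subtype.ext (by simp))

/-- Composition of an operator along `f` with the pullback of functions along `g : T' ⟶ T`. -/
def opPull {T' T M : SuperSpace} (f : Hom T M) (g : Hom T' T) :
    OpAlong f →ₗ[ℂ] OpAlong (f.comp g) where
  toFun D W := (g.comap (f.pre W)).toLinearMap ∘ₗ D W
  map_add' D E := by ext W h; simp
  map_smul' c D := by ext W h; simp

theorem opPull_mem_Der {T' T M : SuperSpace} (f : Hom T M) (g : Hom T' T) {p : ZMod 2}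
    {D : OpAlong f} (hD : D ∈ Der f p) : opPull f g D ∈ Der (f.comp g) p := by
  have hap : ∀ W (b : M.O W), opPull f g D W b = g.comap (f.pre W) (D W b) :=
    fun _ _ => rfl
  refine ⟨fun W W' h b => ?_, fun W j b hb => ?_, fun W j b hb c => ?_⟩
  · rw [hap, hap, hD.1 W W' h b, g.comap_res]
  · exact g.comap_gr _ (hD.2.1 W j b hb)
  · rw [hap, hap, hap, hD.2.2 W j b hb c, map_add, map_smul, map_mul, map_mul]
    rfl

theorem opPull_mem_Vect {T' T M : SuperSpace} (f : Hom T M) (g : Hom T' T)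
    {D : OpAlong f} (hD : D ∈ Vect f) : opPull f g D ∈ Vect (f.comp g) :=
  (Vect_induction (N := (Vect (f.comp g)).comap (opPull f g))
    fun p _ hE => Der_le_Vect _ p (opPull_mem_Der f g hE)) hD

/-- Pullback of sections `g^* : Γ(f^*TM) → Γ((f ∘ g)^*TM)`; for an open immersion `g` this is
the restriction of sections to an open subspace. -/
def vectPull {T' T M : SuperSpace} (f : Hom T M) (g : Hom T' T) :
    Vect f →ₗ[ℂ] Vect (f.comp g) :=
  (opPull f g).restrict fun _ hD => opPull_mem_Vect f g hD

/-! ### Frames -/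

section Frames

variable {V : Type} [AddCommGroup V] [Module ℂ V]

/-- The `𝒪(T)`-linear extension `𝒪(T) ⊗ V → Γ(f^*TM)`, `a ⊗ v ↦ a φ(v)`, of a linear map
`φ : V → Γ(f^*TM)`, that is, the morphism of vector bundles `T × V → f^*TM` given by `φ`,
on sections. -/
def frameExt {T M : SuperSpace} {f : Hom T M} (φ : V →ₗ[ℂ] Vect f) :
    T.Γ ⊗[ℂ] V →ₗ[ℂ] Vect f :=
  TensorProduct.lift ((LinearMap.lcomp ℂ (Vect f) φ) ∘ₗ vectSmul f)

/-- `(f, φ)` is a `T`-point of the frame bundle `L(M)`: the (even) morphism of vector bundles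
`T × V → f^*TM` is an isomorphism, that is, bijective on sections over all open subspaces of
`T`. -/
structure IsFrame [SuperModule V] {T M : SuperSpace} (f : Hom T M) (φ : V →ₗ[ℂ] Vect f) :
    Prop where
  even : ∀ (i : ZMod 2), ∀ v ∈ gr V i, (φ v : OpAlong f) ∈ Der f i
  bijective : ∀ (T' : SuperSpace) (j : Hom T' T), j.IsOpenImmersion →
    Function.Bijective (frameExt (vectPull f j ∘ₗ φ))

/-! ### The group functor `GL(V)` and its subgroups -/

variable (A : Type) [Ring A] [Algebra ℂ A]

/-- The component of parity `i` of the super tensor product `A ⊗ V`. -/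
def tensorGr [SuperAlgebra A] [SuperModule V] (i : ZMod 2) : Submodule ℂ (A ⊗[ℂ] V) :=
  ⨆ j : ZMod 2, Submodule.map₂ (TensorProduct.mk ℂ A V) (gr A j) (gr V (i - j))

variable {A}

/-- The `A`-linear extension `A ⊗ V → A ⊗ V` of a linear map `V → A ⊗ V`. -/
def glExt (g : V →ₗ[ℂ] A ⊗[ℂ] V) : A ⊗[ℂ] V →ₗ[ℂ] A ⊗[ℂ] V :=
  TensorProduct.lift (LinearMap.mk₂ ℂ (fun a v => a • g v)
    (fun a b v => add_smul a b _) (fun c a v => smul_assoc c a _)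
    (fun a v w => by simp) (fun c a v => by rw [map_smul, smul_comm]))

/-- A subset of the even `A`-linear endomorphisms of `A ⊗ V`, given by their restriction to `V`,
for every superalgebra `A`.  For a superspace `T` the automorphisms of the trivial bundle
`T × V → T` are the even automorphisms of the `𝒪(T)`-module `𝒪(T) ⊗ V`, so that `T`-points
are the case `A = 𝒪(T)`. -/
def LinearGroupFunctor (V : Type) [AddCommGroup V] [Module ℂ V] : Type 1 :=
  ∀ (A : Type) [Ring A] [Algebra ℂ A] [SuperAlgebra A], Set (V →ₗ[ℂ] A ⊗[ℂ] V)

/-- `GL(V)`: even automorphisms of the `A`-module `A ⊗ V`. -/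
def GLFunctor (V : Type) [AddCommGroup V] [Module ℂ V] [SuperModule V] :
    LinearGroupFunctor V := fun A _ _ _ =>
  {g | (∀ i, ∀ v ∈ gr V i, g v ∈ tensorGr A i) ∧ Function.Bijective (glExt g)}

/-- The odd `A`-bilinear extension of the odd bilinear form `J` to `A ⊗ V`,
`J(a ⊗ v, b ⊗ w) = (-1)^(|a| + |b| + |b||v|) a b J(v, w)`. -/
def oddExt [SuperAlgebra A] [SuperModule V] (J : V →ₗ[ℂ] V →ₗ[ℂ] ℂ) :
    A ⊗[ℂ] V →ₗ[ℂ] A ⊗[ℂ] V →ₗ[ℂ] A :=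
  TensorProduct.lift (LinearMap.mk₂ ℂ
    (fun a v => TensorProduct.lift (LinearMap.mk₂ ℂ
      (fun b w => ∑ i : ZMod 2, ∑ j : ZMod 2, ∑ k : ZMod 2,
        (sgn (i + j + j * k) * J (homProj V k v) w) • (homProj A i a * homProj A j b))
      (fun b b' w => by simp only [map_add, mul_add, smul_add, Finset.sum_add_distrib])
      (fun c b w => by
        simp only [map_smul, mul_smul_comm, Finset.smul_sum]
        simp only [smul_comm c])
      (fun b w w' => by
        simp only [map_add, mul_add, add_smul, Finset.sum_add_distrib])
      (fun c b w => by
        simp only [map_smul, smul_eq_mul, Finset.smul_sum, smul_smul]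
        simp only [mul_left_comm c])))
    (fun a a' v => by
      ext b w
      simp [add_mul, smul_add, Finset.sum_add_distrib])
    (fun c a v => by
      ext b w
      simp only [map_smul, smul_mul_assoc, TensorProduct.AlgebraTensorModule.curry_apply,
        TensorProduct.curry_apply, LinearMap.restrictScalars_self, TensorProduct.lift.tmul,
        LinearMap.mk₂_apply, LinearMap.smul_apply, Finset.smul_sum]
      simp only [smul_comm c])
    (fun a v v' => by
      ext b w
      simp [mul_add, add_smul, Finset.sum_add_distrib])
    (fun c a v => by
      ext b w
      simp only [map_smul, LinearMap.smul_apply, smul_eq_mul,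
        TensorProduct.AlgebraTensorModule.curry_apply,
        TensorProduct.curry_apply, LinearMap.restrictScalars_self, TensorProduct.lift.tmul,
        LinearMap.mk₂_apply, Finset.smul_sum, smul_smul]
      simp only [mul_left_comm c]))

/-- `P(V, J)`: the elements of `GL(V)` which preserve the odd bilinear form `J`. -/
def PGroup [SuperModule V] (J : V →ₗ[ℂ] V →ₗ[ℂ] ℂ) : LinearGroupFunctor V :=
  fun A _ _ _ => {g | g ∈ GLFunctor V A ∧
    ∀ v w, oddExt J (g v) (g w) = algebraMap ℂ A (J v w)}

/-- `J` is an odd non-degenerate supersymmetric bilinear form on the super vector space `V`. -/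
structure IsOddMetricForm [SuperModule V] (J : V →ₗ[ℂ] V →ₗ[ℂ] ℂ) : Prop where
  odd : ∀ (i : ZMod 2), ∀ v ∈ gr V i, ∀ w ∈ gr V i, J v w = 0
  supersymm : ∀ (i j : ZMod 2), ∀ v ∈ gr V i, ∀ w ∈ gr V j, J v w = sgn (i * j) * J w v
  nondegenerate : J.Nondegenerate

/-! ### Reductions of the frame bundle -/

/-- The right action of `g ∈ GL(V)(T)` on frames, `(φ · g)(v) = φ(g v)`. -/
def frameAct {T M : SuperSpace} {f : Hom T M} (φ : V →ₗ[ℂ] Vect f) (g : V →ₗ[ℂ] T.Γ ⊗[ℂ] V) :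
    V →ₗ[ℂ] Vect f := frameExt φ ∘ₗ g

/-- A reduction of the frame bundle `L(M)` to a subgroup `G` of `GL(V)`: a principal
`G`-subbundle `P` of `L(M)`, given by its functor of points on mixed supermanifolds. -/
structure FrameReduction (G : LinearGroupFunctor V) [SuperModule V] (M : MixedSupermanifold) where
  /-- the linear maps `φ` such that `(f, φ)` is a `T`-point of `P` -/
  points : ∀ (T : MixedSupermanifold) (f : Hom T.toSuperSpace M.toSuperSpace),
    Set (V →ₗ[ℂ] Vect f)
  isFrame : ∀ T f, ∀ φ ∈ points T f, IsFrame f φ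
  pull : ∀ (T T' : MixedSupermanifold) (f : Hom T.toSuperSpace M.toSuperSpace)
    (h : Hom T'.toSuperSpace T.toSuperSpace), ∀ φ ∈ points T f,
    vectPull f h ∘ₗ φ ∈ points T' (f.comp h)
  /-- `P` is a sheaf with respect to open covers -/
  sheaf : ∀ (T : MixedSupermanifold) (f : Hom T.toSuperSpace M.toSuperSpace)
    (φ : V →ₗ[ℂ] Vect f),
    (∀ t : T.carrier, ∃ (T' : MixedSupermanifold) (j : Hom T'.toSuperSpace T.toSuperSpace),
      j.IsOpenImmersion ∧ t ∈ Set.range j.base ∧ vectPull f j ∘ₗ φ ∈ points T' (f.comp j)) →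
    φ ∈ points T f
  /-- `P` is stable under the right action of `G` -/
  act : ∀ T f, ∀ φ ∈ points T f, ∀ g ∈ G T.Γ, frameAct φ g ∈ points T f
  /-- each point has an open neighbourhood `U` and a section `s ∈ P(U)` such that
  `U × G → P|_U`, `(h, g) ↦ h^*s · g` is an isomorphism -/
  locallyTrivial : ∀ m : M.carrier, ∃ (U : MixedSupermanifold)
    (i : Hom U.toSuperSpace M.toSuperSpace), i.IsOpenImmersion ∧ m ∈ Set.range i.base ∧
    ∃ s ∈ points U i, ∀ (T : MixedSupermanifold) (h : Hom T.toSuperSpace U.toSuperSpace)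
      (φ : V →ₗ[ℂ] Vect (i.comp h)),
      φ ∈ points T (i.comp h) ↔ ∃ g ∈ G T.Γ, φ = frameAct (vectPull i h ∘ₗ s) g

end Frames

/-! ### Odd metrics -/

/-- An odd non-degenerate supersymmetric map of vector bundles `TM ⊗ TM → ℂ^{1|0} × M`, that
is, an odd `𝒪_M`-bilinear form on the sheaf of vector fields, given over all open subspaces
`i : U ⟶ M`. -/
structure OddMetric (M : MixedSupermanifold) where
  form : ∀ (U : MixedSupermanifold) (i : Hom U.toSuperSpace M.toSuperSpace),
    i.IsOpenImmersion → Vect i →ₗ[ℂ] Vect i →ₗ[ℂ] U.Γ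
  /-- compatibility with restriction to smaller open subspaces -/
  restrict : ∀ (U U' : MixedSupermanifold) (i : Hom U.toSuperSpace M.toSuperSpace)
    (j : Hom U'.toSuperSpace U.toSuperSpace) (hi : i.IsOpenImmersion)
    (hij : (i.comp j).IsOpenImmersion) (X Y : Vect i),
    form U' (i.comp j) hij (vectPull i j X) (vectPull i j Y) = j.onΓ (form U i hi X Y)
  odd : ∀ U i hi (p q : ZMod 2) (X Y : Vect i), (X : OpAlong i) ∈ Der i p →
    (Y : OpAlong i) ∈ Der i q → form U i hi X Y ∈ gr U.Γ (p + q + 1)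
  /-- `B(aX, bY) = (-1)^(|a| + |b| + |b||X|) a b B(X, Y)` -/
  bilinear : ∀ U i hi (k l p : ZMod 2), ∀ a ∈ gr U.Γ k, ∀ b ∈ gr U.Γ l, ∀ (X Y : Vect i),
    (X : OpAlong i) ∈ Der i p → form U i hi (vectSmul i a X) (vectSmul i b Y) =
      sgn (k + l + l * p) • (a * b * form U i hi X Y)
  supersymm : ∀ U i hi (p q : ZMod 2) (X Y : Vect i), (X : OpAlong i) ∈ Der i p →
    (Y : OpAlong i) ∈ Der i q → form U i hi X Y = sgn (p * q) • form U i hi Y X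
  /-- the induced bilinear form on each tangent space `T_mM` is non-degenerate: if the value at
  `m` of `B(X, Y)` is zero for all vector fields `Y` near `m`, then `X` is zero at `m` (the
  value of a function is zero at `m` iff its germ at `m` is not invertible) -/
  nondegenerate : ∀ (U : MixedSupermanifold) (i : Hom U.toSuperSpace M.toSuperSpace),
    i.IsOpenImmersion → ∀ (u : U.carrier) (X : Vect i),
    (∀ (U' : MixedSupermanifold) (j : Hom U'.toSuperSpace U.toSuperSpace)
      (hij : (i.comp j).IsOpenImmersion) (u' : U'.carrier), j.base u' = u →
      ∀ Y : Vect (i.comp j), ¬ U'.IsUnitAt (form U' (i.comp j) hij (vectPull i j X) Y) u') →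
    ∀ (W : Opens M.carrier) (a : M.O W), i.base u ∈ W → ¬ U.IsUnitAt (X.1 W a) u

/-- The frame `s : V → Γ(U, TM)` is orthonormal: `B(s v, s w) = J(v, w)`. -/
def OddMetric.IsOrthonormal {M : MixedSupermanifold} {V : Type} [AddCommGroup V] [Module ℂ V]
    (B : OddMetric M) (J : V →ₗ[ℂ] V →ₗ[ℂ] ℂ) {U : MixedSupermanifold}
    {i : Hom U.toSuperSpace M.toSuperSpace} (hi : i.IsOpenImmersion) (s : V →ₗ[ℂ] Vect i) :
    Prop :=
  ∀ v w, B.form U i hi (s v) (s w) = algebraMap ℂ U.Γ (J v w)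

/-! ### Lie superalgebras and prolongations -/

/-- The algebra of dual numbers `ℂ[ε]`, `ε² = 0`, with `ε` of parity `i`. -/
def SuperDual (_i : ZMod 2) : Type := DualNumber ℂ

instance (i : ZMod 2) : CommRing (SuperDual i) := inferInstanceAs (CommRing (DualNumber ℂ))

instance (i : ZMod 2) : Algebra ℂ (SuperDual i) := inferInstanceAs (Algebra ℂ (DualNumber ℂ))

/-- The generator `ε`. -/
def SuperDual.eps (i : ZMod 2) : SuperDual i := (DualNumber.eps : DualNumber ℂ)

/-- The body of a dual number as a linear map. -/
def SuperDual.fst (i : ZMod 2) : SuperDual i →ₗ[ℂ] ℂ := TrivSqZeroExt.fstHom ℂ ℂ ℂ |>.toLinearMap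

/-- The coefficient of `ε` as a linear map. -/
def SuperDual.snd (i : ZMod 2) : SuperDual i →ₗ[ℂ] ℂ := TrivSqZeroExt.sndHom ℂ ℂ

/-- The component of parity `j` of `ℂ[ε]`: `x + y ε` lies in it iff `x = 0` unless `j = 0`, and
`y = 0` unless `j = i`. -/
def SuperDual.grading (i j : ZMod 2) : Submodule ℂ (SuperDual i) where
  carrier := {a | (j ≠ 0 → SuperDual.fst i a = 0) ∧ (j ≠ i → SuperDual.snd i a = 0)}
  add_mem' ha hb := ⟨fun h => by simp [ha.1 h, hb.1 h], fun h => by simp [ha.2 h, hb.2 h]⟩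
  zero_mem' := ⟨fun _ => map_zero _, fun _ => map_zero _⟩
  smul_mem' c a ha := ⟨fun h => by simp [ha.1 h], fun h => by simp [ha.2 h]⟩

theorem SuperDual.hext {i : ZMod 2} {a b : SuperDual i} (h : SuperDual.fst i a = SuperDual.fst i b)
    (h' : SuperDual.snd i a = SuperDual.snd i b) : a = b := TrivSqZeroExt.ext h h'

theorem SuperDual.fst_mul {i : ZMod 2} (a b : SuperDual i) :
    SuperDual.fst i (a * b) = SuperDual.fst i a * SuperDual.fst i b :=
  TrivSqZeroExt.fst_mul (R := ℂ) (M := ℂ) a b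

theorem SuperDual.snd_mul {i : ZMod 2} (a b : SuperDual i) :
    SuperDual.snd i (a * b) =
      SuperDual.fst i a * SuperDual.snd i b + SuperDual.fst i b * SuperDual.snd i a :=
  (TrivSqZeroExt.snd_mul (R := ℂ) (M := ℂ) a b).trans
    (congrArg _ (mul_comm _ (SuperDual.fst i b)))

instance (i : ZMod 2) : SuperAlgebra (SuperDual i) where
  gr := SuperDual.grading i
  isCompl := by
    constructor
    · rw [Submodule.disjoint_def]
      intro a h0 h1
      refine SuperDual.hext ?_ ?_
      · rw [h1.1 one_ne_zero, map_zero]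
      · rw [map_zero]
        obtain rfl | rfl := parity_cases i
        · exact h1.2 one_ne_zero
        · exact h0.2 zero_ne_one
    · rw [codisjoint_iff, eq_top_iff]
      intro a _
      obtain rfl | rfl := parity_cases i
      · exact Submodule.mem_sup_left ⟨fun h => absurd rfl h, fun h => absurd rfl h⟩
      · refine Submodule.mem_sup.mpr
          ⟨algebraMap ℂ (SuperDual 1) (SuperDual.fst 1 a), ⟨fun h => absurd rfl h, fun _ => rfl⟩,
            SuperDual.snd 1 a • SuperDual.eps 1, ⟨fun _ => ?_, fun h => absurd rfl h⟩, ?_⟩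
        · rw [map_smul]
          exact mul_zero _
        · refine SuperDual.hext ?_ ?_
          · rw [map_add, map_smul]
            exact (congrArg _ (mul_zero _)).trans (add_zero _)
          · rw [map_add, map_smul]
            exact (congrArg _ (mul_one _)).trans (zero_add _)
  one_mem := ⟨fun h => absurd rfl h, fun _ => rfl⟩
  mul_mem {j k a b} ha hb := by
    have ha : (j ≠ 0 → SuperDual.fst i a = 0) ∧ (j ≠ i → SuperDual.snd i a = 0) := ha
    have hb : (k ≠ 0 → SuperDual.fst i b = 0) ∧ (k ≠ i → SuperDual.snd i b = 0) := hb
    refine ⟨fun h => ?_, fun h => ?_⟩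
    · rw [SuperDual.fst_mul]
      by_cases hj : j = 0
      · by_cases hk : k = 0
        · exact absurd (by simp [hj, hk]) h
        · rw [hb.1 hk, mul_zero]
      · rw [ha.1 hj, zero_mul]
    · rw [SuperDual.snd_mul]
      have h1 : SuperDual.fst i a * SuperDual.snd i b = 0 := by
        by_cases hj : j = 0
        · rw [hb.2 (by rintro rfl; simp [hj] at h), mul_zero]
        · rw [ha.1 hj, zero_mul]
      have h2 : SuperDual.fst i b * SuperDual.snd i a = 0 := by
        by_cases hk : k = 0
        · rw [ha.2 (by rintro rfl; simp [hk] at h), mul_zero]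
        · rw [hb.1 hk, zero_mul]
      rw [h1, h2, add_zero]
  supercomm {j k a b} ha hb := by
    have ha : (j ≠ 0 → SuperDual.fst i a = 0) ∧ (j ≠ i → SuperDual.snd i a = 0) := ha
    have hb : (k ≠ 0 → SuperDual.fst i b = 0) ∧ (k ≠ i → SuperDual.snd i b = 0) := hb
    obtain rfl | rfl := parity_cases j
    · simp [sgn, mul_comm]
    · obtain rfl | rfl := parity_cases k
      · simp [sgn, mul_comm]
      · have : a * b = 0 := by
          refine SuperDual.hext ?_ ?_
          · rw [SuperDual.fst_mul, ha.1 one_ne_zero, zero_mul, map_zero]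
          · rw [SuperDual.snd_mul, ha.1 one_ne_zero, hb.1 one_ne_zero, zero_mul, zero_mul,
              map_zero, add_zero]
        rw [mul_comm b a, this, smul_zero]

section Prolongation

variable {V : Type} [AddCommGroup V] [Module ℂ V] [SuperModule V]

/-- The element `1 + ε X` of `End(V) ⊗ ℂ[ε]`, as a map `V → ℂ[ε] ⊗ V`. -/
def onePlusEps (i : ZMod 2) (X : V →ₗ[ℂ] V) : V →ₗ[ℂ] SuperDual i ⊗[ℂ] V :=
  TensorProduct.mk ℂ (SuperDual i) V 1 + TensorProduct.mk ℂ (SuperDual i) V (SuperDual.eps i) ∘ₗ X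

/-- The Lie superalgebra of a subgroup `G` of `GL(V)`, as a subspace of `𝔤𝔩(V) = End(V)`: it is
spanned by the homogeneous endomorphisms `X` such that `1 + ε X` is a `ℂ[ε]`-point of `G`, where
`ε` has the parity of `X`. -/
def lieSuperalgebra (G : LinearGroupFunctor V) : Submodule ℂ (V →ₗ[ℂ] V) :=
  Submodule.span ℂ {X | ∃ i : ZMod 2,
    (∀ j, ∀ v ∈ gr V j, X v ∈ gr V (i + j)) ∧ onePlusEps i X ∈ G (SuperDual i)}

/-- `V`, `Hom(V, V)`, `Hom(V, Hom(V, V))`, … -/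
def iterHom (V : Type) [AddCommGroup V] [Module ℂ V] : ℕ → ModuleCat.{0} ℂ
  | 0 => ModuleCat.of ℂ V
  | k + 1 => ModuleCat.of ℂ (V →ₗ[ℂ] iterHom V k)

/-- The first prolongation of a subspace `𝔥 ⊆ Hom(V, W)`, `W = iterHom V k`: the linear maps
`X : V → 𝔥` with `X(v)(w) = (-1)^(|v||w|) X(w)(v)` for all homogeneous `v`, `w`. -/
def prolongStep {k : ℕ} (𝔥 : Submodule ℂ (iterHom V (k + 1))) :
    Submodule ℂ (iterHom V (k + 2)) :=
  let S : Submodule ℂ (V →ₗ[ℂ] V →ₗ[ℂ] iterHom V k) :=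
    { carrier := {X | (∀ v, (X v : iterHom V (k + 1)) ∈ 𝔥) ∧
        ∀ (i j : ZMod 2), ∀ v ∈ gr V i, ∀ w ∈ gr V j, X v w = sgn (i * j) • X w v}
      add_mem' := fun {X Y} hX hY => ⟨fun v => 𝔥.add_mem (hX.1 v) (hY.1 v),
        fun i j v hv w hw => by
          simp [hX.2 i j v hv w hw, hY.2 i j v hv w hw]⟩
      zero_mem' := ⟨fun _ => 𝔥.zero_mem, fun _ _ _ _ _ _ => by simp⟩
      smul_mem' := fun c X hX => ⟨fun v => 𝔥.smul_mem c (hX.1 v),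
        fun i j v hv w hw => by
          simp [hX.2 i j v hv w hw, smul_comm c]⟩ }
  S

/-- The `k`-th prolongation `𝔤^(k)`, with `𝔤^(0) = 𝔤`. -/
def prolongation (𝔤 : Submodule ℂ (V →ₗ[ℂ] V)) : (k : ℕ) → Submodule ℂ (iterHom V (k + 1))
  | 0 => 𝔤
  | k + 1 => prolongStep (prolongation 𝔤 k)

/-- A subgroup `G` of `GL(V)` with Lie superalgebra `𝔤` is of finite type if its prolongations
`G^(k)` are trivial for all large `k`; for `k ≥ 1` the group `G^(k)` is the vector group
`𝔤^(k)`. -/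
def IsFiniteType (G : LinearGroupFunctor V) : Prop :=
  ∃ k : ℕ, 1 ≤ k ∧ ∀ l : ℕ, prolongation (lieSuperalgebra G) (k + l) = ⊥

end Prolongation

end

/-!
**Odd metrics and reductions to `P(V, J)`.**

The prolongation vanishes by the argument that a metric connection without torsion is unique. For
`X` in the first prolongation of `𝔭(V, J)` the trilinear form `J(X(v) w, u)` is super skew in
`w, u`, because `X(v)` preserves `J` infinitesimally, and supersymmetric in `v, w`. Such a form is
its own negative (`prolongation_one_eq_bot`), and all higher prolongations vanish with the first
(`prolongation_eq_bot_of_one`).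

A `P(V, J)`-structure determines a metric: two vector fields are paired by `J` in a local frame of
the structure. The result does not depend on the frame, since frames of the structure differ
locally by elements of `P(V, J)`, and it glues (`FrameReduction.oddExt_eq`,
`FrameReduction.metric`). Conversely the frames that are orthonormal for a metric `B` form a
`P(V, J)`-structure (`OddMetric.reduction`), and the two constructions are mutually inverse
(`FrameReduction.reduction_metric`, `OddMetric.metric_reduction`). Two facts carry the converse.

* *Frames pull back to frames.* A reduction has points over all `f : T ⟶ M`, whereas a frame of
  `TM` over an open subspace is only known to be a basis there. On a model supermanifold the
  coordinate vector fields are a basis of the vector fields along every morphism `f`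
  (`frameExt_coordFrame_bijective`): a derivation along `f` that kills the coordinates vanishes, as
  Hadamard's lemma puts its values at a point into every power of a nilpotent ideal
  (`exists_hadamard_section`, `Der_eq_zero`). Any other frame differs locally from a coordinate
  frame by an element of `GL(V)`, which pulls back (`IsFrame.isStableFrame`).

* *Odd metrics have local orthonormal frames* (`OddMetric.exists_orthonormal`). In a homogeneous
  frame `eᵢ, fⱼ` the matrix `B(eᵢ, fⱼ)` has even entries and is invertible at each point by
  non-degeneracy, so that a change of the `eᵢ` turns it into the identity near a given point. The
  remaining values `B(eᵢ, eⱼ)` and `B(fᵢ, fⱼ)` are odd functions. Hence `B(x, y) = J((1 + n) x, y)`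
  with `n` nilpotent and self-adjoint for `J`, and `(1 + n)^(-1/2)` transforms `B` into `J`
  (`exists_isometry_of_nilpotent`, `exists_isometry`). No integrability is involved.
-/

noncomputable section

/-! ### Sheaf property and morphisms of superspaces -/

namespace SuperSpace

variable {X Y Z U T : SuperSpace}

/-- Restriction between two opens that contain each other. The two opens need not be syntactically
equal, which is how preimages and images under morphisms compare. -/
theorem res_bijective_of_le {V W : Opens X.carrier} (h : V ≤ W) (h' : W ≤ V) :
    Function.Bijective (X.res h) := by
  constructor
  · intro a b hab
    have := congrArg (X.res h') hab
    rwa [X.res_res, X.res_res, X.res_refl, X.res_refl] at this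
  · intro a
    exact ⟨X.res h' a, by rw [X.res_res, X.res_refl]⟩

theorem eq_of_locally {W : Opens X.carrier} {a b : X.O W}
    (h : ∀ x ∈ W, ∃ (N : Opens X.carrier) (hN : N ≤ W), x ∈ N ∧ X.res hN a = X.res hN b) :
    a = b := by
  choose N hN hx he using fun x : W => h x.1 x.2
  have hsup : (⨆ x, N x) ≤ W := iSup_le hN
  have hsup' : W ≤ ⨆ x, N x := fun x hxW => Opens.mem_iSup.mpr ⟨⟨x, hxW⟩, hx _⟩
  refine (res_bijective_of_le hsup hsup').1 ?_
  obtain ⟨t, -, ht⟩ := X.glue N (fun x => X.res (hN x) a) (fun k l => by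
    rw [X.res_res, X.res_res])
  rw [ht _ (fun k => X.res_res _ _ _), ht (X.res hsup b) (fun k => by rw [X.res_res, he])]

theorem exists_glue {ι : Type} {W : Opens X.carrier} (N : ι → Opens X.carrier)
    (hW : ∀ x ∈ W, ∃ k, x ∈ N k) (hN : ∀ k, N k ≤ W) (s : ∀ k, X.O (N k))
    (hs : ∀ k l, X.res (inf_le_left : N k ⊓ N l ≤ N k) (s k) = X.res inf_le_right (s l)) :
    ∃ t : X.O W, ∀ k, X.res (hN k) t = s k := by
  obtain ⟨t, ht, -⟩ := X.glue N s hs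
  exact ⟨X.res (fun x hx => Opens.mem_iSup.mpr (hW x hx)) t,
    fun k => by rw [X.res_res]; exact ht k⟩

theorem isUnitAt_res {V W : Opens X.carrier} (h : V ≤ W) (a : X.O W) {x : X.carrier}
    (hx : x ∈ V) : X.IsUnitAt (X.res h a) x ↔ X.IsUnitAt a x := by
  constructor
  · rintro ⟨N, hN, hxN, hu⟩
    exact ⟨N, hN.trans h, hxN, by rwa [X.res_res] at hu⟩
  · rintro ⟨N, hN, hxN, hu⟩
    refine ⟨N ⊓ V, inf_le_right, ⟨hxN, hx⟩, ?_⟩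
    have := hu.map (X.res (inf_le_left : N ⊓ V ≤ N))
    rwa [X.res_res] at this ⊢

theorem Hom.isUnitAt_comap (f : Hom X Y) {V : Opens Y.carrier} (a : Y.O V) {x : X.carrier}
    (hx : f.base x ∈ V) : X.IsUnitAt (f.comap V a) x ↔ Y.IsUnitAt a (f.base x) := by
  refine ⟨f.isLocal V a x hx, ?_⟩
  rintro ⟨N, hN, hxN, hu⟩
  refine ⟨f.pre N, preim_mono _ _ hN, hxN, ?_⟩
  rw [← f.comap_res]
  exact hu.map _

theorem Hom.ext' {f g : Hom X Y} (hb : ∀ x, f.base x = g.base x)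
    (hc : ∀ V (h : f.pre V ≤ g.pre V) (a : Y.O V), f.comap V a = X.res h (g.comap V a)) :
    f = g := by
  obtain ⟨fb, fc, fm, fg, fr, fl⟩ := f
  obtain ⟨gb, gc, gm, gg, gr', gl⟩ := g
  obtain rfl : fb = gb := funext hb
  obtain rfl : fm = gm := by
    funext V
    refine AlgHom.ext fun a => ?_
    rw [hc V le_rfl a, X.res_refl]
  rfl

/-- The identity morphism. -/
abbrev Hom.id (X : SuperSpace) : Hom X X where
  base x := x
  cont := continuous_id
  comap V := AlgHom.id ℂ (X.O V)
  comap_gr _ _ _ ha := ha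
  comap_res _ _ := rfl
  isLocal _ _ _ _ h := h

theorem Hom.onΓ_comp (f : Hom Y Z) (g : Hom X Y) (a : Z.Γ) :
    (f.comp g).onΓ a = g.onΓ (f.onΓ a) := by
  have h := g.comap_res (V := ⊤) (W := f.pre ⊤) (fun _ _ => trivial) (f.comap ⊤ a)
  exact ((congrArg (X.res (V := g.pre ⊤) (fun _ _ => trivial)) h).trans (X.res_res _ _ _)).symm

theorem Hom.onΓ_id (a : X.Γ) : (Hom.id X).onΓ a = a := X.res_refl a

theorem Hom.onΓ_gr (f : Hom X Y) {i : ZMod 2} {a : Y.Γ} (ha : a ∈ gr Y.Γ i) :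
    f.onΓ a ∈ gr X.Γ i := X.res_gr _ (f.comap_gr _ ha)

theorem Hom.comap_res_top (f : Hom X Y) (V : Opens Y.carrier) (a : Y.Γ) :
    f.comap V (Y.res le_top a) = X.res le_top (f.onΓ a) := by
  rw [f.comap_res]
  exact (X.res_res _ _ _).symm

theorem Hom.isUnitAt_onΓ (f : Hom X Y) (a : Y.Γ) {x : X.carrier} :
    X.IsUnitAt (f.onΓ a) x ↔ Y.IsUnitAt a (f.base x) := by
  rw [← f.isUnitAt_comap a trivial]
  exact isUnitAt_res _ _ trivial

/-! ### Open subspaces -/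

/-- An open subset of an open subspace, as an open subset of the whole space. -/
def img {X : Type} [TopologicalSpace X] {N : Opens X} (V : Opens N) : Opens X :=
  ⟨Subtype.val '' (V : Set N), N.isOpen.isOpenMap_subtype_val _ V.isOpen⟩

theorem img_mono {X : Type} [TopologicalSpace X] {N : Opens X} {V W : Opens N} (h : V ≤ W) :
    img V ≤ img W := Set.image_mono h

theorem mem_img {X : Type} [TopologicalSpace X] {N : Opens X} {V : Opens N} {x : N} :
    (x : X) ∈ img V ↔ x ∈ V := by
  constructor
  · rintro ⟨y, hy, hxy⟩
    rwa [← Subtype.ext hxy]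
  · exact fun h => ⟨x, h, rfl⟩

/-- The open subspace of a superspace with underlying set `N`. -/
def restrict (X : SuperSpace) (N : Opens X.carrier) : SuperSpace where
  carrier := N
  O V := X.O (img V)
  res h := X.res (img_mono h)
  res_gr h _ _ ha := X.res_gr _ ha
  res_refl a := X.res_refl a
  res_res h h' a := X.res_res _ _ a
  glue {ι} V s hs := by
    have h1 : img (⨆ k, V k) ≤ ⨆ k, img (V k) := by
      rintro _ ⟨x, hx, rfl⟩
      obtain ⟨k, hk⟩ := Opens.mem_iSup.mp hx
      exact Opens.mem_iSup.mpr ⟨k, x, hk, rfl⟩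
    have h2 : ⨆ k, img (V k) ≤ img (⨆ k, V k) := iSup_le fun k => img_mono (le_iSup V k)
    have h3 : ∀ k l, img (V k) ⊓ img (V l) ≤ img (V k ⊓ V l) := by
      rintro k l _ ⟨⟨x, hx, rfl⟩, hx'⟩
      exact ⟨x, ⟨hx, mem_img.mp hx'⟩, rfl⟩
    obtain ⟨t, ht, htu⟩ := X.glue (fun k => img (V k)) s (fun k l => by
      have := congrArg (X.res (h3 k l)) (hs k l)
      rwa [X.res_res, X.res_res] at this)
    refine ⟨X.res h1 t, fun k => ?_, fun t' ht' => ?_⟩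
    · change X.res _ (X.res h1 t) = s k
      rw [X.res_res]
      exact ht k
    · refine (res_bijective_of_le h2 h1).1 ?_
      rw [X.res_res, X.res_refl]
      exact htu _ fun k => (X.res_res _ _ _).trans (ht' k)

/-- The inclusion of an open subspace. -/
def incl (X : SuperSpace) (N : Opens X.carrier) : Hom (X.restrict N) X where
  base x := x.1
  cont := continuous_subtype_val
  comap V := X.res (by rintro _ ⟨x, hx, rfl⟩; exact hx)
  comap_gr _ _ _ ha := X.res_gr _ ha
  comap_res h a := (X.res_res _ _ _).trans (X.res_res _ _ _).symm
  isLocal V a x hx := by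
    rintro ⟨W, hW, hxW, hu⟩
    refine ⟨img W, ?_, ⟨x, hxW, rfl⟩, ?_⟩
    · rintro _ ⟨y, hy, rfl⟩
      exact hW hy
    · change IsUnit (X.res _ (X.res _ a)) at hu
      rwa [X.res_res] at hu

theorem isOpenImmersion_incl (X : SuperSpace) (N : Opens X.carrier) :
    (X.incl N).IsOpenImmersion where
  isOpenEmbedding := N.isOpen.isOpenEmbedding_subtypeVal
  bijective V hV := res_bijective_of_le _ fun x hx => by
    obtain ⟨y, hy⟩ := hV hx
    exact ⟨y, by change y.1 ∈ V; rw [show y.1 = x from hy]; exact hx, hy⟩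

theorem range_incl (X : SuperSpace) (N : Opens X.carrier) :
    Set.range (X.incl N).base = N := Subtype.range_coe

/-! ### Open immersions -/

namespace Hom

theorem isOpenImmersion_id (X : SuperSpace) : (Hom.id X).IsOpenImmersion where
  isOpenEmbedding := Topology.IsOpenEmbedding.id
  bijective _ _ := Function.bijective_id

namespace IsOpenImmersion

variable {i : Hom U X}

theorem comp {f : Hom Y Z} {g : Hom X Y} (hf : f.IsOpenImmersion) (hg : g.IsOpenImmersion) :
    (f.comp g).IsOpenImmersion where
  isOpenEmbedding := hf.isOpenEmbedding.comp hg.isOpenEmbedding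
  bijective V hV := by
    refine (hg.bijective _ fun y hy => ?_).comp (hf.bijective V fun z hz => ?_)
    · obtain ⟨x, hx⟩ := hV hy
      exact ⟨x, hf.isOpenEmbedding.injective hx⟩
    · obtain ⟨x, hx⟩ := hV hz
      exact ⟨_, hx⟩

/-- The image of an open set under an open immersion. -/
def image (hi : i.IsOpenImmersion) (V : Opens U.carrier) : Opens X.carrier :=
  ⟨i.base '' V, hi.isOpenEmbedding.isOpenMap _ V.isOpen⟩

variable (hi : i.IsOpenImmersion)

theorem image_mono {V W : Opens U.carrier} (h : V ≤ W) : hi.image V ≤ hi.image W :=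
  Set.image_mono h

theorem le_pre_image (V : Opens U.carrier) : V ≤ i.pre (hi.image V) :=
  fun x hx => ⟨x, hx, rfl⟩

theorem pre_image_le (V : Opens U.carrier) : i.pre (hi.image V) ≤ V := by
  rintro x ⟨y, hy, hxy⟩
  rwa [← hi.isOpenEmbedding.injective hxy]

theorem image_pre_le (W : Opens X.carrier) : hi.image (i.pre W) ≤ W := by
  rintro _ ⟨x, hx, rfl⟩
  exact hx

/-- An open immersion identifies the functions on `V` with the functions on its image. -/
def equiv (V : Opens U.carrier) : X.O (hi.image V) ≃ₐ[ℂ] U.O V :=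
  AlgEquiv.ofBijective ((U.res (hi.le_pre_image V)).comp (i.comap (hi.image V)))
    ((res_bijective_of_le (hi.le_pre_image V) (hi.pre_image_le V)).comp
      (hi.bijective _ (Set.image_subset_range _ _)))

theorem equiv_apply (V : Opens U.carrier) (a : X.O (hi.image V)) :
    hi.equiv V a = U.res (hi.le_pre_image V) (i.comap _ a) := rfl

theorem equiv_res {V W : Opens U.carrier} (h : V ≤ W) (a : X.O (hi.image W)) :
    hi.equiv V (X.res (hi.image_mono h) a) = U.res h (hi.equiv W a) := by
  rw [equiv_apply, equiv_apply, i.comap_res, U.res_res, U.res_res]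

theorem equiv_symm_res {V W : Opens U.carrier} (h : V ≤ W) (a : U.O W) :
    (hi.equiv V).symm (U.res h a) = X.res (hi.image_mono h) ((hi.equiv W).symm a) := by
  rw [AlgEquiv.symm_apply_eq, equiv_res, AlgEquiv.apply_symm_apply]

theorem equiv_symm_comap (W : Opens X.carrier) (a : X.O W) :
    (hi.equiv (i.pre W)).symm (i.comap W a) = X.res (hi.image_pre_le W) a := by
  rw [AlgEquiv.symm_apply_eq, equiv_apply, i.comap_res, U.res_res, U.res_refl]

theorem comap_equiv_symm (V : Opens U.carrier) (a : U.O V) :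
    i.comap _ ((hi.equiv V).symm a) = U.res (hi.pre_image_le V) a := by
  conv_rhs => rw [← (hi.equiv V).apply_symm_apply a, equiv_apply, U.res_res, U.res_refl]

end IsOpenImmersion
end Hom

/-- An injective parity preserving map reflects parities. -/
theorem mem_of_map_mem {E F : Type} [AddCommGroup E] [Module ℂ E] [AddCommGroup F] [Module ℂ F]
    {P : ZMod 2 → Submodule ℂ E} {Q : ZMod 2 → Submodule ℂ F} (hP : P 0 ⊔ P 1 = ⊤)
    (hQ : Disjoint (Q 0) (Q 1)) (f : E →ₗ[ℂ] F) (hf : Function.Injective f)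
    (h : ∀ i, ∀ x ∈ P i, f x ∈ Q i) {i : ZMod 2} {x : E} (hx : f x ∈ Q i) : x ∈ P i := by
  obtain ⟨y, hy, z, hz, rfl⟩ := Submodule.mem_sup.mp (hP ▸ Submodule.mem_top : x ∈ P 0 ⊔ P 1)
  have hd := Submodule.disjoint_def.mp hQ
  rw [map_add] at hx
  obtain rfl | rfl := parity_cases i
  · have h1 : f z ∈ Q 0 := (Submodule.add_mem_iff_right _ (h _ _ hy)).mp hx
    rw [hf ((hd _ h1 (h _ _ hz)).trans (map_zero f).symm), add_zero]
    exact hy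
  · have h1 : f y ∈ Q 1 := (Submodule.add_mem_iff_left _ (h _ _ hz)).mp hx
    rw [hf ((hd _ (h _ _ hy) h1).trans (map_zero f).symm), zero_add]
    exact hz

namespace Hom.IsOpenImmersion

variable {i : Hom U X} (hi : i.IsOpenImmersion)

theorem equiv_symm_gr (V : Opens U.carrier) {p : ZMod 2} {a : U.O V} (ha : a ∈ gr (U.O V) p) :
    (hi.equiv V).symm a ∈ gr (X.O (hi.image V)) p := by
  refine mem_of_map_mem (SuperModule.isCompl (V := X.O (hi.image V))).sup_eq_top
    (SuperModule.isCompl (V := U.O V)).disjoint (hi.equiv V).toLinearMap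
    (hi.equiv V).injective (fun i a ha => ?_) ?_
  · exact U.res_gr _ (Hom.comap_gr _ _ ha)
  · simpa using ha

theorem isUnitAt_equiv_symm {V : Opens U.carrier} (a : U.O V) {u : U.carrier} (hu : u ∈ V) :
    X.IsUnitAt ((hi.equiv V).symm a) (i.base u) ↔ U.IsUnitAt a u := by
  rw [← Hom.isUnitAt_comap i _ (hi.le_pre_image V hu), comap_equiv_symm, isUnitAt_res _ _
    (hi.le_pre_image V hu)]

/-- A morphism whose image is contained in the image of an open immersion factors through it. -/
def lift (f : Hom T X) (hr : ∀ t, ∃ u, i.base u = f.base t) : Hom T U :=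
  have hb : ∀ t, i.base (hr t).choose = f.base t := fun t => (hr t).choose_spec
  have hc : Continuous fun t => (hr t).choose :=
    hi.isOpenEmbedding.isInducing.continuous_iff.mpr
      (f.cont.congr fun t => (hb t).symm)
  have hle : ∀ V : Opens U.carrier, preim _ hc V ≤ f.pre (hi.image V) :=
    fun V t ht => ⟨_, ht, hb t⟩
  { base t := (hr t).choose
    cont := hc
    comap V := ((T.res (hle V)).comp (f.comap (hi.image V))).comp
      (hi.equiv V).symm.toAlgHom
    comap_gr V _ _ ha := T.res_gr _ (f.comap_gr _ (hi.equiv_symm_gr V ha))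
    comap_res {V W} h a := by
      change T.res _ (f.comap _ ((hi.equiv V).symm _)) =
        T.res _ (T.res _ (f.comap _ ((hi.equiv W).symm _)))
      rw [hi.equiv_symm_res, f.comap_res, T.res_res, T.res_res]
    isLocal V a t ht hu := by
      have h1 := (f.isUnitAt_comap ((hi.equiv V).symm a) (hle V ht)).mp
        ((isUnitAt_res (hle V) _ ht).mp hu)
      rw [← hb t] at h1
      exact (hi.isUnitAt_equiv_symm a ht).mp h1 }

theorem comp_lift (f : Hom T X) (hr : ∀ t, ∃ u, i.base u = f.base t) :
    i.comp (hi.lift f hr) = f := by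
  refine Hom.ext' (fun t => (hr t).choose_spec) fun V h a => ?_
  change T.res _ (f.comap _ ((hi.equiv _).symm (i.comap V a))) = _
  rw [hi.equiv_symm_comap, f.comap_res]
  exact T.res_res _ _ _

theorem of_comp {h : Hom T U} (hi : i.IsOpenImmersion) (hc : (i.comp h).IsOpenImmersion) :
    h.IsOpenImmersion where
  isOpenEmbedding := by
    have h1 : Topology.IsOpenEmbedding (i.base ∘ h.base) := hc.isOpenEmbedding
    exact Topology.IsOpenEmbedding.of_comp _ hi.isOpenEmbedding h1
  bijective V hV := by
    have h1 := hc.bijective (hi.image V) (by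
      rintro _ ⟨x, hx, rfl⟩
      obtain ⟨t, rfl⟩ := hV hx
      exact ⟨t, rfl⟩)
    have h2 : Function.Bijective ((h.comap (i.pre (hi.image V))).comp (i.comap (hi.image V))) := h1
    have h3 : Function.Bijective (h.comap (i.pre (hi.image V))) := by
      refine (Function.Bijective.of_comp_iff _ (hi.bijective _ (Set.image_subset_range _ _))).mp ?_
      exact h2
    have h4 : ∀ a : U.O V, T.res (preim_mono _ _ (hi.pre_image_le V)) (h.comap V a) =
        h.comap (i.pre (hi.image V)) (U.res (hi.pre_image_le V) a) := fun a =>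
      (h.comap_res _ _).symm
    refine (Function.Bijective.of_comp_iff' (f := T.res (preim_mono h.base h.cont (hi.pre_image_le V)))
      (res_bijective_of_le _ (preim_mono _ _ (hi.le_pre_image V))) _).mp ?_
    have h5 : (T.res (preim_mono h.base h.cont (hi.pre_image_le V))) ∘ (h.comap V) =
      (h.comap (i.pre (hi.image V))) ∘ (U.res (hi.pre_image_le V)) := funext h4
    rw [h5]
    exact h3.comp (res_bijective_of_le _ (hi.le_pre_image V))

end Hom.IsOpenImmersion

/-! ### Gluing along covers by open immersions -/

theorem eq_of_comap_eq {V : Opens X.carrier} {a b : X.O V}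
    (h : ∀ x ∈ V, ∃ (U : SuperSpace) (j : Hom U X), j.IsOpenImmersion ∧ x ∈ Set.range j.base ∧
      j.comap V a = j.comap V b) : a = b := by
  refine eq_of_locally fun x hx => ?_
  obtain ⟨U, j, hj, ⟨u, rfl⟩, he⟩ := h x hx
  refine ⟨hj.image (j.pre V), hj.image_pre_le V, ⟨u, hx, rfl⟩, ?_⟩
  rw [← hj.equiv_symm_comap, he, hj.equiv_symm_comap]

/-- Global functions which agree on the members of a cover by open immersions are equal. -/
theorem eq_of_onΓ_eq {a b : X.Γ}
    (h : ∀ x, ∃ (U : SuperSpace) (j : Hom U X), j.IsOpenImmersion ∧ x ∈ Set.range j.base ∧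
      j.onΓ a = j.onΓ b) : a = b := by
  refine eq_of_comap_eq fun x _ => ?_
  obtain ⟨U, j, hj, hx, he⟩ := h x
  exact ⟨U, j, hj, hx, (res_bijective_of_le (X := U) (V := ⊤) (W := j.pre ⊤) _ le_top).1 he⟩

/-- Global functions `c k` on the members of a cover by open immersions glue. Compatibility on
overlaps is tested on all superspaces `R` over two members whose map to `X` is an open immersion,
so that no fibre product has to be chosen. -/
theorem exists_glueΓ {ι : Type} (U : ι → SuperSpace) (j : ∀ k, Hom (U k) X)
    (hj : ∀ k, (j k).IsOpenImmersion) (hcov : ∀ x, ∃ k, x ∈ Set.range (j k).base)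
    (c : ∀ k, (U k).Γ)
    (hc : ∀ k l (R : SuperSpace) (a : Hom R (U k)) (b : Hom R (U l)),
      ((j k).comp a).IsOpenImmersion → (j k).comp a = (j l).comp b → a.onΓ (c k) = b.onΓ (c l)) :
    ∃ t : X.Γ, ∀ k, (j k).onΓ t = c k := by
  obtain ⟨t, ht⟩ := exists_glue (X := X) (W := ⊤) (fun k => (hj k).image ⊤)
    (fun x _ => by
      obtain ⟨k, u, hu⟩ := hcov x
      exact ⟨k, u, trivial, hu⟩)
    (fun k => le_top) (fun k => ((hj k).equiv ⊤).symm (c k)) (fun k l => by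
      let N := (hj k).image ⊤ ⊓ (hj l).image ⊤
      have hk : ∀ r, ∃ u, (j k).base u = (X.incl N).base r := by
        rintro ⟨_, ⟨u, -, rfl⟩, _⟩
        exact ⟨u, rfl⟩
      have hl : ∀ r, ∃ u, (j l).base u = (X.incl N).base r := by
        rintro ⟨_, _, ⟨u, -, rfl⟩⟩
        exact ⟨u, rfl⟩
      have ek := (hj k).comp_lift (X.incl N) hk
      have el := (hj l).comp_lift (X.incl N) hl
      have h1 := hc k l _ _ _ (by rw [ek]; exact isOpenImmersion_incl X N) (ek.trans el.symm)
      have h2 : ∀ m (hm : ∀ r, ∃ u, (j m).base u = (X.incl N).base r)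
          (hN : N ≤ (hj m).image ⊤) (h' : img ⊤ ≤ N),
          ((hj m).lift (X.incl N) hm).onΓ (c m) =
            X.res h' (X.res hN (((hj m).equiv ⊤).symm (c m))) := by
        intro m hm hN h'
        exact ((congrArg _ (X.res_res _ _ _)).trans (X.res_res _ _ _)).trans (X.res_res _ _ _).symm
      have h3 : img (⊤ : Opens N) ≤ N := by
        rintro _ ⟨x, -, rfl⟩; exact x.2
      rw [h2 k hk inf_le_left h3, h2 l hl inf_le_right h3] at h1
      exact (res_bijective_of_le h3 fun x hx => ⟨⟨x, hx⟩, trivial, rfl⟩).1 h1)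
  refine ⟨t, fun k => ?_⟩
  have := congrArg ((hj k).equiv ⊤) (ht k)
  rw [AlgEquiv.apply_symm_apply, Hom.IsOpenImmersion.equiv_apply, Hom.comap_res,
    SuperSpace.res_res] at this
  exact this

end SuperSpace

open SuperSpace

theorem HasChartAt.restrict {X : SuperSpace} {N : Opens X.carrier} {x : N} {n m q : ℕ}
    (h : HasChartAt X x n m q) : HasChartAt (X.restrict N) x n m q := by
  obtain ⟨C, i, j, hi, hj, c, hc⟩ := h
  have hr : ∀ t, ∃ u, (X.incl N).base u = (i.comp (C.incl (i.pre N))).base t := by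
    rintro ⟨t, ht⟩
    exact ⟨⟨_, ht⟩, rfl⟩
  have hic := hi.comp (isOpenImmersion_incl C (i.pre N))
  have hN := isOpenImmersion_incl X N
  have he := hN.comp_lift _ hr
  refine ⟨C.restrict (i.pre N), hN.lift _ hr, j.comp (C.incl _), ?_,
    hj.comp (isOpenImmersion_incl _ _), ⟨c, ?_⟩, ?_⟩
  · exact hN.of_comp (by rw [he]; exact hic)
  · exact (congrArg (· ∈ N) hc).mpr x.2
  · exact hN.isOpenEmbedding.injective ((congrFun (congrArg Hom.base he) _).trans hc)

/-- An open subspace of a mixed supermanifold. -/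
def MixedSupermanifold.restrict (M : MixedSupermanifold) (N : Opens M.carrier) :
    MixedSupermanifold where
  toSuperSpace := M.toSuperSpace.restrict N
  t2 := by
    have := M.t2
    exact inferInstanceAs (T2Space N)
  secondCountable := by
    have := M.secondCountable
    exact inferInstanceAs (SecondCountableTopology N)
  charts x := by
    obtain ⟨n, m, q, h⟩ := M.charts x.1
    exact ⟨n, m, q, h.restrict⟩

/-- An open subspace of a model space is a mixed supermanifold. -/
def MixedSupermanifold.ofModel {C : SuperSpace} {n m q : ℕ} {j : Hom C (modelSpace n m q)}
    (hj : j.IsOpenImmersion) : MixedSupermanifold where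
  toSuperSpace := C
  t2 := by
    have : T2Space (modelSpace n m q).carrier := inferInstanceAs (T2Space (ModelBody n m))
    exact hj.isOpenEmbedding.isEmbedding.t2Space
  secondCountable := by
    have : SecondCountableTopology (modelSpace n m q).carrier :=
      inferInstanceAs (SecondCountableTopology (ModelBody n m))
    exact hj.isOpenEmbedding.isEmbedding.secondCountableTopology
  charts x := ⟨n, m, q, C, Hom.id C, j, Hom.isOpenImmersion_id C, hj, x, rfl⟩

/-! ### Super linear algebra -/

section SuperModule

variable {V W : Type} [AddCommGroup V] [Module ℂ V] [SuperModule V]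
  [AddCommGroup W] [Module ℂ W] [SuperModule W]

theorem homProj_of_mem {i : ZMod 2} {v : V} (hv : v ∈ gr V i) : homProj V i v = v := by
  obtain rfl | rfl := parity_cases i
  · exact Submodule.projection_apply_left SuperModule.isCompl ⟨v, hv⟩
  · exact Submodule.projection_apply_left SuperModule.isCompl.symm ⟨v, hv⟩

theorem homProj_of_ne {i j : ZMod 2} (h : i ≠ j) {v : V} (hv : v ∈ gr V j) :
    homProj V i v = 0 := by
  obtain rfl | rfl := parity_cases i
  · obtain rfl : j = 1 := (parity_cases j).resolve_left h.symm
    simp only [homProj, if_true]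
    exact Submodule.projection_apply_of_mem_right SuperModule.isCompl hv
  · obtain rfl : j = 0 := (parity_cases j).resolve_right h.symm
    simp only [homProj, one_ne_zero, if_false]
    exact Submodule.projection_apply_of_mem_right SuperModule.isCompl.symm hv

theorem homProj_apply_of_mem (i : ZMod 2) {j : ZMod 2} {v : V} (hv : v ∈ gr V j) :
    homProj V i v = if i = j then v else 0 := by
  split_ifs with h
  · subst h; exact homProj_of_mem hv
  · exact homProj_of_ne h hv

theorem gr_sup : gr V 0 ⊔ gr V 1 = ⊤ := SuperModule.isCompl.sup_eq_top

theorem gr_disjoint : Disjoint (gr V 0) (gr V 1) := SuperModule.isCompl.disjoint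

@[elab_as_elim]
theorem super_induction {p : V → Prop} (h : ∀ i, ∀ v ∈ gr V i, p v)
    (hadd : ∀ v w, p v → p w → p (v + w)) (v : V) : p v := by
  obtain ⟨y, hy, z, hz, rfl⟩ :=
    Submodule.mem_sup.mp (gr_sup (V := V) ▸ Submodule.mem_top : v ∈ gr V 0 ⊔ gr V 1)
  exact hadd _ _ (h _ _ hy) (h _ _ hz)

theorem homProj_mem (i : ZMod 2) (v : V) : homProj V i v ∈ gr V i := by
  induction v using super_induction with
  | h j v hv =>
    rw [homProj_apply_of_mem i hv]
    split_ifs with h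
    · rwa [h]
    · exact zero_mem _
  | hadd v w hv hw => rw [map_add]; exact add_mem hv hw

theorem sum_homProj (v : V) : ∑ i, homProj V i v = v := by
  induction v using super_induction with
  | h j v hv => simp [homProj_apply_of_mem _ hv]
  | hadd v w hv hw => simp_rw [map_add, Finset.sum_add_distrib, hv, hw]

theorem map_homProj (f : V →ₗ[ℂ] W) (hf : ∀ i, ∀ v ∈ gr V i, f v ∈ gr W i) (i : ZMod 2) (v : V) :
    f (homProj V i v) = homProj W i (f v) := by
  induction v using super_induction with
  | h j v hv =>
    rw [homProj_apply_of_mem i hv, homProj_apply_of_mem i (hf j v hv)]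
    split_ifs <;> simp
  | hadd v w hv hw => simp_rw [map_add, hv, hw]

theorem mem_gr_of_homProj {i : ZMod 2} {v : V} (h : ∀ j, j ≠ i → homProj V j v = 0) :
    v ∈ gr V i := by
  rw [← sum_homProj v]
  refine Submodule.sum_mem _ fun j _ => ?_
  by_cases hj : j = i
  · exact hj ▸ homProj_mem j v
  · rw [h j hj]; exact zero_mem _

end SuperModule

/-- The odd elements square to zero, so that characters vanish on them. -/
theorem map_eq_zero_of_odd {A : Type} [Ring A] [Algebra ℂ A] [SuperAlgebra A] (χ : A →ₐ[ℂ] ℂ)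
    {a : A} (ha : a ∈ gr A 1) : χ a = 0 := by
  have h := congrArg χ (SuperAlgebra.supercomm ha ha)
  simp only [sgn, mul_one, one_ne_zero, if_false, neg_smul, one_smul, map_neg, map_mul] at h
  exact mul_self_eq_zero.mp (self_eq_neg.mp h)

theorem sgn_mul_self (i : ZMod 2) : sgn i * sgn i = 1 := by
  rw [sgn_mul_sgn, CharTwo.add_self_eq_zero]; rfl

theorem sgn_ne_zero (i : ZMod 2) : sgn i ≠ 0 := fun h => by
  simpa [h] using sgn_mul_self i

/-! ### The module `A ⊗ V` -/

section Tensor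

variable {V : Type} [AddCommGroup V] [Module ℂ V]
variable {A : Type} [Ring A] [Algebra ℂ A] {B : Type} [Ring B] [Algebra ℂ B]

theorem glExt_tmul (g : V →ₗ[ℂ] A ⊗[ℂ] V) (a : A) (v : V) : glExt g (a ⊗ₜ v) = a • g v := rfl

theorem glExt_one_tmul (g : V →ₗ[ℂ] A ⊗[ℂ] V) (v : V) : glExt g (1 ⊗ₜ v) = g v := by
  rw [glExt_tmul, one_smul]

theorem glExt_smul (g : V →ₗ[ℂ] A ⊗[ℂ] V) (a : A) (x : A ⊗[ℂ] V) :
    glExt g (a • x) = a • glExt g x := by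
  induction x using TensorProduct.induction_on with
  | zero => simp
  | tmul b v => rw [TensorProduct.smul_tmul', smul_eq_mul, glExt_tmul, glExt_tmul, mul_smul]
  | add x y hx hy => rw [smul_add, map_add, hx, hy, map_add, smul_add]

theorem glExt_glExt (g h : V →ₗ[ℂ] A ⊗[ℂ] V) (x : A ⊗[ℂ] V) :
    glExt (glExt g ∘ₗ h) x = glExt g (glExt h x) := by
  induction x using TensorProduct.induction_on with
  | zero => simp
  | tmul b v => rw [glExt_tmul, glExt_tmul, glExt_smul]; rfl
  | add x y hx hy => rw [map_add, hx, hy, map_add, map_add]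

theorem glExt_add (g h : V →ₗ[ℂ] A ⊗[ℂ] V) (x : A ⊗[ℂ] V) :
    glExt (g + h) x = glExt g x + glExt h x := by
  induction x using TensorProduct.induction_on with
  | zero => simp
  | tmul a v => rw [glExt_tmul, glExt_tmul, glExt_tmul, LinearMap.add_apply, smul_add]
  | add x y hx hy => rw [map_add, map_add, map_add, hx, hy]; abel

theorem glExt_mk (x : A ⊗[ℂ] V) : glExt (TensorProduct.mk ℂ A V 1) x = x := by
  induction x using TensorProduct.induction_on with
  | zero => simp
  | tmul b v =>
    rw [glExt_tmul, TensorProduct.mk_apply, TensorProduct.smul_tmul', smul_eq_mul, mul_one]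
  | add x y hx hy => rw [map_add, hx, hy]

/-- Base change of `A ⊗ V` along a homomorphism of algebras. -/
def baseMap (V : Type) [AddCommGroup V] [Module ℂ V] (ρ : A →ₐ[ℂ] B) :
    A ⊗[ℂ] V →ₗ[ℂ] B ⊗[ℂ] V := LinearMap.rTensor V ρ.toLinearMap

theorem baseMap_tmul (ρ : A →ₐ[ℂ] B) (a : A) (v : V) :
    baseMap V ρ (a ⊗ₜ v) = ρ a ⊗ₜ v := rfl

theorem baseMap_smul (ρ : A →ₐ[ℂ] B) (a : A) (x : A ⊗[ℂ] V) :
    baseMap V ρ (a • x) = ρ a • baseMap V ρ x := by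
  induction x using TensorProduct.induction_on with
  | zero => simp
  | tmul b v => simp [TensorProduct.smul_tmul', baseMap_tmul]
  | add x y hx hy => rw [smul_add, map_add, hx, hy, map_add, smul_add]

theorem baseMap_glExt (ρ : A →ₐ[ℂ] B) (g : V →ₗ[ℂ] A ⊗[ℂ] V) (x : A ⊗[ℂ] V) :
    baseMap V ρ (glExt g x) = glExt (baseMap V ρ ∘ₗ g) (baseMap V ρ x) := by
  induction x using TensorProduct.induction_on with
  | zero => simp
  | tmul b v => rw [glExt_tmul, baseMap_smul, baseMap_tmul, glExt_tmul]; rfl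
  | add x y hx hy => rw [map_add, map_add, hx, hy, map_add, map_add]

variable [SuperAlgebra A] [SuperAlgebra B] [SuperModule V]

theorem tmul_mem_tensorGr {j k : ZMod 2} {a : A} {v : V} (ha : a ∈ gr A j) (hv : v ∈ gr V k) :
    a ⊗ₜ[ℂ] v ∈ tensorGr (V := V) A (j + k) := by
  refine Submodule.mem_iSup_of_mem j (Submodule.apply_mem_map₂ _ ha ?_)
  rwa [add_sub_cancel_left]

theorem one_tmul_mem_tensorGr {k : ZMod 2} {v : V} (hv : v ∈ gr V k) :
    (1 : A) ⊗ₜ[ℂ] v ∈ tensorGr (V := V) A k := by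
  have := tmul_mem_tensorGr (A := A) SuperAlgebra.one_mem hv
  rwa [zero_add] at this

/-- To prove a linear statement about the elements of parity `i` of `A ⊗ V` it suffices to
consider the tensors `a ⊗ v` of homogeneous elements. -/
theorem tensorGr_le {i : ZMod 2} {N : Submodule ℂ (A ⊗[ℂ] V)}
    (h : ∀ j k, j + k = i → ∀ a ∈ gr A j, ∀ v ∈ gr V k, a ⊗ₜ[ℂ] v ∈ N) :
    tensorGr (V := V) A i ≤ N :=
  iSup_le fun j => Submodule.map₂_le.mpr fun a ha v hv =>
    h j (i - j) (add_sub_cancel _ _) a ha v hv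

theorem tensor_hom_induction {p : A ⊗[ℂ] V → Prop} (h : ∀ j k, ∀ a ∈ gr A j, ∀ v ∈ gr V k,
    p (a ⊗ₜ[ℂ] v)) (hadd : ∀ x y, p x → p y → p (x + y)) (x : A ⊗[ℂ] V) : p x := by
  induction x using TensorProduct.induction_on with
  | zero => simpa using h 0 0 0 (zero_mem _) 0 (zero_mem _)
  | tmul a v =>
    induction a using super_induction with
    | h j a ha =>
      induction v using super_induction with
      | h k v hv => exact h j k a ha v hv
      | hadd v w hv hw => rw [TensorProduct.tmul_add]; exact hadd _ _ hv hw
    | hadd a b ha hb => rw [TensorProduct.add_tmul]; exact hadd _ _ ha hb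
  | add x y hx hy => exact hadd _ _ hx hy

theorem tensorGr_sup : tensorGr (V := V) A 0 ⊔ tensorGr (V := V) A 1 = ⊤ := by
  rw [eq_top_iff]
  rintro x -
  induction x using tensor_hom_induction with
  | h j k a ha v hv =>
    have := tmul_mem_tensorGr ha hv
    obtain h | h := parity_cases (j + k)
    · exact Submodule.mem_sup_left (h ▸ this)
    · exact Submodule.mem_sup_right (h ▸ this)
  | hadd x y hx hy => exact add_mem hx hy

theorem smul_mem_tensorGr {j k : ZMod 2} {a : A} (ha : a ∈ gr A j) {x : A ⊗[ℂ] V}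
    (hx : x ∈ tensorGr A k) : a • x ∈ tensorGr (V := V) A (j + k) := by
  have : tensorGr A k ≤ (tensorGr (V := V) A (j + k)).comap
      (Algebra.lsmul ℂ ℂ (A ⊗[ℂ] V) a) := by
    refine tensorGr_le fun l m hlm b hb v hv => ?_
    change a • (b ⊗ₜ[ℂ] v) ∈ tensorGr A (j + k)
    rw [TensorProduct.smul_tmul', ← hlm, ← add_assoc]
    exact tmul_mem_tensorGr (SuperAlgebra.mul_mem ha hb) hv
  exact this hx

theorem glExt_mem_tensorGr {g : V →ₗ[ℂ] A ⊗[ℂ] V} (hg : ∀ i, ∀ v ∈ gr V i, g v ∈ tensorGr A i)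
    {i : ZMod 2} {x : A ⊗[ℂ] V} (hx : x ∈ tensorGr A i) : glExt g x ∈ tensorGr (V := V) A i := by
  have : tensorGr A i ≤ (tensorGr (V := V) A i).comap (glExt g) := by
    refine tensorGr_le fun l m hlm b hb v hv => ?_
    rw [Submodule.mem_comap, glExt_tmul, ← hlm]
    exact smul_mem_tensorGr hb (hg m v hv)
  exact this hx

theorem baseMap_mem_tensorGr {ρ : A →ₐ[ℂ] B} (hρ : ∀ i, ∀ a ∈ gr A i, ρ a ∈ gr B i)
    {i : ZMod 2} {x : A ⊗[ℂ] V} (hx : x ∈ tensorGr A i) :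
    baseMap V ρ x ∈ tensorGr (V := V) B i := by
  have : tensorGr A i ≤ (tensorGr (V := V) B i).comap (baseMap V ρ) := by
    refine tensorGr_le fun l m hlm b hb v hv => ?_
    rw [Submodule.mem_comap, baseMap_tmul, ← hlm]
    exact tmul_mem_tensorGr (hρ l b hb) hv
  exact this hx

/-! ### The group functors `GL(V)` and `P(V, J)` -/

theorem mk_mem_GLFunctor : TensorProduct.mk ℂ A V 1 ∈ GLFunctor V A :=
  ⟨fun _ _ hv => one_tmul_mem_tensorGr hv, by
    have : glExt (TensorProduct.mk ℂ A V 1) = LinearMap.id :=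
      LinearMap.ext fun x => glExt_mk x
    rw [this]
    exact Function.bijective_id⟩

theorem GLFunctor_mul {g h : V →ₗ[ℂ] A ⊗[ℂ] V} (hg : g ∈ GLFunctor V A)
    (hh : h ∈ GLFunctor V A) : glExt g ∘ₗ h ∈ GLFunctor V A := by
  refine ⟨fun i v hv => glExt_mem_tensorGr hg.1 (hh.1 i v hv), ?_⟩
  have : ⇑(glExt (glExt g ∘ₗ h)) = glExt g ∘ glExt h := funext (glExt_glExt g h)
  rw [this]
  exact hg.2.comp hh.2

theorem mem_GLFunctor_of_inverse {g h : V →ₗ[ℂ] A ⊗[ℂ] V}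
    (hg : ∀ i, ∀ v ∈ gr V i, g v ∈ tensorGr A i) (h1 : ∀ v, glExt g (h v) = 1 ⊗ₜ v)
    (h2 : ∀ v, glExt h (g v) = 1 ⊗ₜ v) : g ∈ GLFunctor V A := by
  refine ⟨hg, Function.bijective_iff_has_inverse.mpr ⟨glExt h, fun x => ?_, fun x => ?_⟩⟩
  · rw [← glExt_glExt, show glExt h ∘ₗ g = TensorProduct.mk ℂ A V 1 from LinearMap.ext h2, glExt_mk]
  · rw [← glExt_glExt, show glExt g ∘ₗ h = TensorProduct.mk ℂ A V 1 from LinearMap.ext h1, glExt_mk]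

/-- Automorphisms stay invertible under base change: the inverse of `g` has coefficients in `A`, and
its image inverts the image of `g`. -/
theorem GLFunctor_baseMap {ρ : A →ₐ[ℂ] B} (hρ : ∀ i, ∀ a ∈ gr A i, ρ a ∈ gr B i)
    {g : V →ₗ[ℂ] A ⊗[ℂ] V} (hg : g ∈ GLFunctor V A) : baseMap V ρ ∘ₗ g ∈ GLFunctor V B := by
  let e := LinearEquiv.ofBijective (glExt g) hg.2
  let h : V →ₗ[ℂ] A ⊗[ℂ] V := e.symm.toLinearMap ∘ₗ TensorProduct.mk ℂ A V 1
  have he : ∀ v, glExt g (h v) = 1 ⊗ₜ v := fun v => e.apply_symm_apply _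
  refine mem_GLFunctor_of_inverse (h := baseMap V ρ ∘ₗ h)
    (fun i v hv => baseMap_mem_tensorGr hρ (hg.1 i v hv)) (fun v => ?_) (fun v => ?_)
  · rw [LinearMap.comp_apply, ← baseMap_glExt, he, baseMap_tmul, map_one]
  · rw [LinearMap.comp_apply, ← baseMap_glExt]
    have : glExt h (g v) = 1 ⊗ₜ v := by
      refine hg.2.1 ?_
      rw [← glExt_glExt, show glExt g ∘ₗ h = TensorProduct.mk ℂ A V 1 from LinearMap.ext he,
        glExt_mk, glExt_one_tmul]
    rw [this, baseMap_tmul, map_one]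

/-- The rule `F(a x, b y) = (-1)^(|a| + |b| + |b||x|) a b F(x, y)` for odd forms on `A ⊗ V`. -/
def IsOddBilinear (F : A ⊗[ℂ] V →ₗ[ℂ] A ⊗[ℂ] V →ₗ[ℂ] A) : Prop :=
  ∀ (k l p : ZMod 2), ∀ a ∈ gr A k, ∀ b ∈ gr A l, ∀ x ∈ tensorGr A p, ∀ y,
    F (a • x) (b • y) = sgn (k + l + l * p) • (a * b * F x y)

/-- An odd `A`-bilinear form is determined by its values on `V`. -/
theorem IsOddBilinear.ext {F G : A ⊗[ℂ] V →ₗ[ℂ] A ⊗[ℂ] V →ₗ[ℂ] A} (hF : IsOddBilinear F)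
    (hG : IsOddBilinear G) (h : ∀ v w, F (1 ⊗ₜ v) (1 ⊗ₜ w) = G (1 ⊗ₜ v) (1 ⊗ₜ w)) : F = G := by
  refine LinearMap.ext fun x => LinearMap.ext fun y => ?_
  have e : ∀ (a : A) (v : V), a ⊗ₜ[ℂ] v = a • (1 ⊗ₜ v) := fun a v => by
    rw [TensorProduct.smul_tmul', smul_eq_mul, mul_one]
  induction x using tensor_hom_induction with
  | h j k a ha v hv =>
    induction y using tensor_hom_induction with
    | h l m b hb w hw =>
      rw [e a, e b, hF _ _ _ a ha b hb _ (one_tmul_mem_tensorGr hv),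
        hG _ _ _ a ha b hb _ (one_tmul_mem_tensorGr hv), h]
    | hadd y z hy hz => rw [map_add, map_add, hy, hz]
  | hadd x z hx hz => rw [map_add, map_add, LinearMap.add_apply, LinearMap.add_apply, hx, hz]

theorem IsOddBilinear.comp {F : A ⊗[ℂ] V →ₗ[ℂ] A ⊗[ℂ] V →ₗ[ℂ] A} (hF : IsOddBilinear F)
    {g h : V →ₗ[ℂ] A ⊗[ℂ] V} (hg : ∀ i, ∀ v ∈ gr V i, g v ∈ tensorGr A i) :
    IsOddBilinear (F.compl₁₂ (glExt g) (glExt h)) := by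
  intro k l p a ha b hb x hx y
  rw [LinearMap.compl₁₂_apply, LinearMap.compl₁₂_apply, glExt_smul, glExt_smul]
  exact hF _ _ _ a ha b hb _ (glExt_mem_tensorGr hg hx) _

variable (J : V →ₗ[ℂ] V →ₗ[ℂ] ℂ)

theorem oddExt_tmul {i j k : ZMod 2} {a b : A} {v : V} (ha : a ∈ gr A i) (hb : b ∈ gr A j)
    (hv : v ∈ gr V k) (w : V) :
    oddExt J (a ⊗ₜ v) (b ⊗ₜ w) = (sgn (i + j + j * k) * J v w) • (a * b) := by
  change ∑ i' : ZMod 2, ∑ j' : ZMod 2, ∑ k' : ZMod 2,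
        (sgn (i' + j' + j' * k') * J (homProj V k' v) w) • (homProj A i' a * homProj A j' b) = _
  rw [Finset.sum_eq_single i, Finset.sum_eq_single j, Finset.sum_eq_single k]
  · rw [homProj_of_mem ha, homProj_of_mem hb, homProj_of_mem hv]
  · intro k' _ hk; simp [homProj_of_ne hk hv]
  · simp
  · intro j' _ hj; simp [homProj_of_ne hj hb]
  · simp
  · intro i' _ hi; simp [homProj_of_ne hi ha]
  · simp

theorem oddExt_one_tmul (v w : V) :
    oddExt (A := A) J (1 ⊗ₜ v) (1 ⊗ₜ w) = algebraMap ℂ A (J v w) := by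
  induction v using super_induction with
  | h k v hv =>
    rw [oddExt_tmul J SuperAlgebra.one_mem SuperAlgebra.one_mem hv]
    simp [sgn, Algebra.algebraMap_eq_smul_one]
  | hadd v v' hv hv' => rw [TensorProduct.tmul_add, map_add, LinearMap.add_apply, hv, hv']; simp

theorem isOddBilinear_oddExt : IsOddBilinear (A := A) (oddExt J) := by
  intro k l p a ha b hb x hx y
  have key : ∀ y : A ⊗[ℂ] V, tensorGr A p ≤ LinearMap.ker
      ((oddExt J).flip (b • y) ∘ₗ Algebra.lsmul ℂ ℂ (A ⊗[ℂ] V) a -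
        sgn (k + l + l * p) • (LinearMap.mulLeft ℂ (a * b) ∘ₗ (oddExt J).flip y)) := by
    intro y
    refine tensorGr_le fun i m him c hc v hv => ?_
    rw [LinearMap.mem_ker, LinearMap.sub_apply, sub_eq_zero]
    change oddExt J (a • (c ⊗ₜ v)) (b • y) =
      sgn (k + l + l * p) • (a * b * oddExt J (c ⊗ₜ v) y)
    induction y using tensor_hom_induction with
    | h j n d hd w hw =>
      rw [TensorProduct.smul_tmul', TensorProduct.smul_tmul', smul_eq_mul, smul_eq_mul,
        oddExt_tmul J (SuperAlgebra.mul_mem ha hc) (SuperAlgebra.mul_mem hb hd) hv,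
        oddExt_tmul J hc hd hv, mul_smul_comm, smul_smul,
        show a * c * (b * d) = a * (c * b) * d by simp only [mul_assoc],
        SuperAlgebra.supercomm hc hb, mul_smul_comm, smul_mul_assoc, smul_smul,
        show a * (b * c) * d = a * b * (c * d) by simp only [mul_assoc], ← mul_assoc, mul_right_comm,
        sgn_mul_sgn, ← mul_assoc (sgn (k + l + l * p)), sgn_mul_sgn, ← him]
      have e : ∀ k i l j m : ZMod 2, k + i + (l + j) + (l + j) * m + i * l =
          k + l + l * (i + m) + (i + j + j * m) := by decide
      rw [e]
    | hadd y z hy hz => rw [smul_add, map_add, hy, hz, map_add, mul_add, smul_add]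
  have := key y hx
  rw [LinearMap.mem_ker, LinearMap.sub_apply, sub_eq_zero] at this
  exact this

variable {J}

/-- The sign rule of `oddExt` is the one that makes the extension supersymmetric again; odd forms
need this to be checked, since `J` itself moves past the coefficients. -/
theorem oddExt_supersymm (hJ : IsOddMetricForm J) {p q : ZMod 2} {x y : A ⊗[ℂ] V}
    (hx : x ∈ tensorGr A p) (hy : y ∈ tensorGr A q) :
    oddExt J x y = sgn (p * q) • oddExt J y x := by
  suffices h : ∀ y ∈ tensorGr (V := V) A q, tensorGr A p ≤ LinearMap.ker
      ((oddExt J).flip y - sgn (p * q) • oddExt J y) by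
    have := h y hy hx
    rwa [LinearMap.mem_ker, LinearMap.sub_apply, sub_eq_zero] at this
  intro y hy
  refine tensorGr_le fun i k hik a ha v hv => ?_
  suffices h : tensorGr A q ≤ LinearMap.ker
      (oddExt J (a ⊗ₜ v) - sgn (p * q) • (oddExt J).flip (a ⊗ₜ v)) by
    have := h hy
    rw [LinearMap.mem_ker, LinearMap.sub_apply, sub_eq_zero] at this ⊢
    exact this
  refine tensorGr_le fun j l hjl b hb w hw => ?_
  rw [LinearMap.mem_ker, LinearMap.sub_apply, sub_eq_zero]
  change oddExt J (a ⊗ₜ v) (b ⊗ₜ w) = sgn (p * q) • oddExt J (b ⊗ₜ w) (a ⊗ₜ v)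
  rw [oddExt_tmul J ha hb hv, oddExt_tmul J hb ha hw, hJ.supersymm k l v hv w hw,
    SuperAlgebra.supercomm ha hb, smul_smul, smul_smul, ← hik, ← hjl]
  congr 1
  rw [mul_right_comm, ← mul_assoc, ← mul_assoc, sgn_mul_sgn, sgn_mul_sgn, sgn_mul_sgn]
  have e : ∀ i j k l : ZMod 2, i + j + j * k + i * j + k * l =
      (i + k) * (j + l) + (j + i + i * l) := by decide
  rw [e]

theorem oddExt_mem (hJ : IsOddMetricForm J) {p q : ZMod 2} {x y : A ⊗[ℂ] V}
    (hx : x ∈ tensorGr A p) (hy : y ∈ tensorGr A q) : oddExt J x y ∈ gr A (p + q + 1) := by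
  suffices h : ∀ y ∈ tensorGr (V := V) A q, tensorGr A p ≤
      (gr A (p + q + 1)).comap ((oddExt J).flip y) from h y hy hx
  intro y hy
  refine tensorGr_le fun i k hik a ha v hv => ?_
  suffices h : tensorGr A q ≤ (gr A (p + q + 1)).comap (oddExt J (a ⊗ₜ v)) from h hy
  refine tensorGr_le fun j l hjl b hb w hw => ?_
  rw [Submodule.mem_comap, oddExt_tmul J ha hb hv]
  by_cases hkl : k = l
  · subst hkl
    rw [hJ.odd k v hv w hw, mul_zero, zero_smul]
    exact zero_mem _
  · refine Submodule.smul_mem _ _ ?_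
    have e : ∀ i j k l : ZMod 2, k ≠ l → i + k + (j + l) + 1 = i + j := by decide
    rw [← hik, ← hjl, e i j k l hkl]
    exact SuperAlgebra.mul_mem ha hb

theorem map_oddExt (ρ : A →ₐ[ℂ] B) (hρ : ∀ i, ∀ a ∈ gr A i, ρ a ∈ gr B i) (x y : A ⊗[ℂ] V) :
    ρ (oddExt J x y) = oddExt J (baseMap V ρ x) (baseMap V ρ y) := by
  induction x using tensor_hom_induction with
  | h j k a ha v hv =>
    induction y using tensor_hom_induction with
    | h l m b hb w hw =>
      rw [baseMap_tmul, baseMap_tmul, oddExt_tmul J ha hb hv,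
        oddExt_tmul J (hρ _ _ ha) (hρ _ _ hb) hv, map_smul, map_mul]
    | hadd y z hy hz => simp only [map_add, hy, hz]
  | hadd x z hx hz => simp only [map_add, LinearMap.add_apply, hx, hz]

/-- The elements of `P(V, J)` preserve `J` on all of `A ⊗ V`, and not just on `V`. -/
theorem oddExt_glExt {g : V →ₗ[ℂ] A ⊗[ℂ] V} (hg : g ∈ PGroup J A) (x y : A ⊗[ℂ] V) :
    oddExt J (glExt g x) (glExt g y) = oddExt J x y := by
  have : (oddExt J).compl₁₂ (glExt g) (glExt g) = oddExt (A := A) J :=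
    IsOddBilinear.ext ((isOddBilinear_oddExt J).comp hg.1.1) (isOddBilinear_oddExt J)
      fun v w => by
        rw [LinearMap.compl₁₂_apply, glExt_one_tmul, glExt_one_tmul, hg.2, oddExt_one_tmul]
  exact LinearMap.congr_fun₂ this x y

theorem mk_mem_PGroup : TensorProduct.mk ℂ A V 1 ∈ PGroup J A :=
  ⟨mk_mem_GLFunctor, fun v w => oddExt_one_tmul J v w⟩

theorem PGroup_mul {g h : V →ₗ[ℂ] A ⊗[ℂ] V} (hg : g ∈ PGroup J A)
    (hh : h ∈ PGroup J A) : glExt g ∘ₗ h ∈ PGroup J A :=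
  ⟨GLFunctor_mul hg.1 hh.1, fun v w => by
    rw [LinearMap.comp_apply, LinearMap.comp_apply, oddExt_glExt hg, hh.2]⟩

theorem PGroup_baseMap {ρ : A →ₐ[ℂ] B} (hρ : ∀ i, ∀ a ∈ gr A i, ρ a ∈ gr B i)
    {g : V →ₗ[ℂ] A ⊗[ℂ] V} (hg : g ∈ PGroup J A) : baseMap V ρ ∘ₗ g ∈ PGroup J B :=
  ⟨GLFunctor_baseMap hρ hg.1, fun v w => by
    rw [LinearMap.comp_apply, LinearMap.comp_apply, ← map_oddExt ρ hρ, hg.2, AlgHom.commutes]⟩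

end Tensor

/-! ### Frames -/

section Frames

variable {V : Type} [AddCommGroup V] [Module ℂ V] {T T' M : SuperSpace} {f : Hom T M}

theorem vectSmul_mul (a b : T.Γ) (X : Vect f) :
    vectSmul f (a * b) X = vectSmul f a (vectSmul f b X) := by
  refine Subtype.ext (funext fun W => LinearMap.ext fun c => ?_)
  change T.res le_top (a * b) * _ = T.res le_top a * (T.res le_top b * _)
  rw [map_mul, mul_assoc]

theorem vectSmul_one (X : Vect f) : vectSmul f 1 X = X := by
  refine Subtype.ext (funext fun W => LinearMap.ext fun c => ?_)
  change T.res le_top 1 * _ = _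
  rw [map_one, one_mul]

theorem vectSmul_mem_Der {i p : ZMod 2} {a : T.Γ} (ha : a ∈ gr T.Γ i) {X : Vect f}
    (hX : (X : OpAlong f) ∈ Der f p) : (vectSmul f a X : OpAlong f) ∈ Der f (i + p) :=
  opSmul_mem_Der f ha hX

theorem frameExt_tmul (φ : V →ₗ[ℂ] Vect f) (a : T.Γ) (v : V) :
    frameExt φ (a ⊗ₜ v) = vectSmul f a (φ v) := rfl

theorem frameExt_one_tmul (φ : V →ₗ[ℂ] Vect f) (v : V) : frameExt φ (1 ⊗ₜ v) = φ v := by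
  rw [frameExt_tmul, vectSmul_one]

theorem frameExt_smul (φ : V →ₗ[ℂ] Vect f) (a : T.Γ) (x : T.Γ ⊗[ℂ] V) :
    frameExt φ (a • x) = vectSmul f a (frameExt φ x) := by
  induction x using TensorProduct.induction_on with
  | zero => simp
  | tmul b v => rw [TensorProduct.smul_tmul', smul_eq_mul, frameExt_tmul, frameExt_tmul,
      vectSmul_mul]
  | add x y hx hy => rw [smul_add, map_add, hx, hy, map_add, map_add]

theorem frameExt_frameAct (φ : V →ₗ[ℂ] Vect f) (g : V →ₗ[ℂ] T.Γ ⊗[ℂ] V) (x : T.Γ ⊗[ℂ] V) :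
    frameExt (frameAct φ g) x = frameExt φ (glExt g x) := by
  induction x using TensorProduct.induction_on with
  | zero => simp
  | tmul b v => rw [glExt_tmul, frameExt_smul, frameExt_tmul]; rfl
  | add x y hx hy => rw [map_add, hx, hy, map_add, map_add]

theorem frameAct_frameAct (φ : V →ₗ[ℂ] Vect f) (g h : V →ₗ[ℂ] T.Γ ⊗[ℂ] V) :
    frameAct (frameAct φ g) h = frameAct φ (glExt g ∘ₗ h) :=
  LinearMap.ext fun v => frameExt_frameAct φ g (h v)

theorem frameAct_mk (φ : V →ₗ[ℂ] Vect f) : frameAct φ (TensorProduct.mk ℂ T.Γ V 1) = φ :=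
  LinearMap.ext fun v => frameExt_one_tmul φ v

theorem vectPull_vectSmul (h : Hom T' T) (a : T.Γ) (X : Vect f) :
    vectPull f h (vectSmul f a X) = vectSmul (f.comp h) (h.onΓ a) (vectPull f h X) := by
  refine Subtype.ext (funext fun W => LinearMap.ext fun c => ?_)
  change h.comap _ (T.res le_top a * _) = T'.res le_top (h.onΓ a) * _
  rw [map_mul, h.comap_res_top]
  rfl

theorem vectPull_frameExt (φ : V →ₗ[ℂ] Vect f) (h : Hom T' T) (x : T.Γ ⊗[ℂ] V) :
    vectPull f h (frameExt φ x) = frameExt (vectPull f h ∘ₗ φ) (baseMap V h.onΓ x) := by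
  induction x using TensorProduct.induction_on with
  | zero => simp
  | tmul b v => rw [frameExt_tmul, baseMap_tmul, frameExt_tmul, vectPull_vectSmul]; rfl
  | add x y hx hy => simp only [map_add, hx, hy]

theorem vectPull_frameAct (φ : V →ₗ[ℂ] Vect f) (h : Hom T' T) (g : V →ₗ[ℂ] T.Γ ⊗[ℂ] V) :
    vectPull f h ∘ₗ frameAct φ g = frameAct (vectPull f h ∘ₗ φ) (baseMap V h.onΓ ∘ₗ g) :=
  LinearMap.ext fun v => vectPull_frameExt φ h (g v)

theorem Der_disjoint (f : Hom T M) : Disjoint (Der f 0) (Der f 1) := by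
  rw [Submodule.disjoint_def]
  intro D h0 h1
  refine funext fun W => LinearMap.ext fun a => ?_
  induction a using super_induction with
  | h i a ha =>
    have e0 := h0.2.1 W i a ha
    have e1 := h1.2.1 W i a ha
    have hd := Submodule.disjoint_def.mp (gr_disjoint (V := T.O (f.pre W)))
    obtain rfl | rfl := parity_cases i
    · exact hd _ e0 e1
    · exact hd _ e1 e0
  | hadd a b ha hb => rw [map_add, ha, hb]; simp

variable [SuperModule V]

theorem frameExt_mem_Der {φ : V →ₗ[ℂ] Vect f}
    (hφ : ∀ i, ∀ v ∈ gr V i, (φ v : OpAlong f) ∈ Der f i) {i : ZMod 2} {x : T.Γ ⊗[ℂ] V}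
    (hx : x ∈ tensorGr T.Γ i) : (frameExt φ x : OpAlong f) ∈ Der f i := by
  have : tensorGr T.Γ i ≤ (Der f i).comap ((Vect f).subtype ∘ₗ frameExt φ) := by
    refine tensorGr_le fun j k hjk a ha v hv => ?_
    rw [← hjk]
    exact vectSmul_mem_Der ha (hφ k v hv)
  exact this hx

/-- A morphism of vector bundles that is bijective on sections reflects parities. -/
theorem mem_tensorGr_of_frameExt {φ : V →ₗ[ℂ] Vect f}
    (hφ : ∀ i, ∀ v ∈ gr V i, (φ v : OpAlong f) ∈ Der f i)
    (hi : Function.Injective (frameExt φ)) {i : ZMod 2} {x : T.Γ ⊗[ℂ] V}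
    (hx : (frameExt φ x : OpAlong f) ∈ Der f i) : x ∈ tensorGr T.Γ i :=
  mem_of_map_mem tensorGr_sup (Der_disjoint f) ((Vect f).subtype ∘ₗ frameExt φ)
    (Subtype.val_injective.comp hi) (fun _ _ h => frameExt_mem_Der hφ h) hx

end Frames

/-! ### The Lie superalgebra of `P(V, J)` and its prolongations -/

section LieAlgebra

variable {V : Type} [AddCommGroup V] [Module ℂ V] [SuperModule V] {J : V →ₗ[ℂ] V →ₗ[ℂ] ℂ}

/-- An odd supersymmetric form is symmetric in the ordinary sense. -/
theorem IsOddMetricForm.symm (hJ : IsOddMetricForm J) (v w : V) : J v w = J w v := by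
  induction v using super_induction with
  | h i v hv =>
    induction w using super_induction with
    | h j w hw =>
      by_cases hij : i = j
      · subst hij
        rw [hJ.odd i v hv w hw, hJ.odd i w hw v hv]
      · have h : ∀ i j : ZMod 2, i ≠ j → i * j = 0 := by decide
        rw [hJ.supersymm i j v hv w hw, h i j hij]
        simp [sgn]
    | hadd w u hw hu => rw [map_add, hw, hu, map_add, LinearMap.add_apply]
  | hadd v u hv hu => rw [map_add, LinearMap.add_apply, hv, hu, map_add]

theorem SuperDual.eps_mem (i : ZMod 2) : SuperDual.eps i ∈ gr (SuperDual i) i :=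
  ⟨fun _ => rfl, fun h => absurd rfl h⟩

theorem SuperDual.eps_mul_eps (i : ZMod 2) : SuperDual.eps i * SuperDual.eps i = 0 :=
  DualNumber.eps_mul_eps

/-- The coefficient of `ε` in the equation that `1 + ε X` preserves `J`. For odd `ε` it carries the
overall sign `sgn i`, by which one may divide. -/
theorem skew_of_onePlusEps_mem {i : ZMod 2} {X : V →ₗ[ℂ] V}
    (hX : ∀ j, ∀ v ∈ gr V j, X v ∈ gr V (i + j)) (h : onePlusEps i X ∈ PGroup J (SuperDual i))
    {k : ZMod 2} {v : V} (hv : v ∈ gr V k) (w : V) :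
    J (X v) w + sgn (i * k) * J v (X w) = 0 := by
  have h1 := h.2 v w
  have e : ∀ v, onePlusEps i X v = 1 ⊗ₜ v + SuperDual.eps i ⊗ₜ X v := fun _ => rfl
  have hε := SuperDual.eps_mem i
  have h0 : (1 : SuperDual i) ∈ gr (SuperDual i) 0 := SuperAlgebra.one_mem
  rw [e, e, map_add, map_add, LinearMap.add_apply, LinearMap.add_apply,
    oddExt_tmul J h0 h0 hv, oddExt_tmul J h0 hε hv, oddExt_tmul J hε h0 (hX k v hv),
    oddExt_tmul J hε hε (hX k v hv), SuperDual.eps_mul_eps, smul_zero, mul_one, one_mul,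
    mul_one] at h1
  have h2 := congrArg (SuperDual.snd i) h1
  have s1 : SuperDual.snd i 1 = 0 := rfl
  have s2 : SuperDual.snd i (SuperDual.eps i) = 1 := rfl
  have s3 : SuperDual.snd i (algebraMap ℂ (SuperDual i) (J v w)) = 0 := rfl
  simp only [map_add, map_smul, s1, s2, s3, smul_eq_mul, mul_zero, mul_one, add_zero,
    zero_add, zero_mul] at h2
  rw [← sgn_mul_sgn] at h2
  refine (mul_eq_zero.mp ?_).resolve_left (sgn_ne_zero i)
  linear_combination h2

/-- On homogeneous vectors the elements of `𝔭(V, J)` are skew for `J` up to the sign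
`(-1)^(|v||w|)`; the parity of the element is determined by those of the vectors, because `J`
is odd. -/
theorem skew_of_mem_lieSuperalgebra (hJ : IsOddMetricForm J) {X : V →ₗ[ℂ] V}
    (hX : X ∈ lieSuperalgebra (PGroup J)) {k l : ZMod 2} {v w : V} (hv : v ∈ gr V k)
    (hw : w ∈ gr V l) : J (X v) w = -(sgn (k * l) * J (X w) v) := by
  induction hX using Submodule.span_induction with
  | mem X hX =>
    obtain ⟨i, hi, hP⟩ := hX
    by_cases h : i = k + l + 1
    · have h1 := skew_of_onePlusEps_mem hi hP hv w
      have h2 : ∀ k l : ZMod 2, (k + l + 1) * k = k * l := by decide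
      rw [h, h2, hJ.symm v] at h1
      exact eq_neg_of_add_eq_zero_left h1
    -- otherwise both sides pair vectors of the same parity and vanish
    · have e : ∀ i k l : ZMod 2, i ≠ k + l + 1 → i + k = l ∧ i + l = k := by decide
      obtain ⟨e1, e2⟩ := e i k l h
      rw [hJ.odd l _ (e1 ▸ hi k v hv) w hw, hJ.odd k _ (e2 ▸ hi l w hw) v hv]
      simp
  | zero => simp
  | add X Y _ _ hX hY => simp only [LinearMap.add_apply, map_add, hX, hY]; ring
  | smul c X _ hX => simp only [LinearMap.smul_apply, map_smul, smul_eq_mul, hX]; ring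

theorem mem_prolongStep {k : ℕ} {𝔥 : Submodule ℂ (iterHom V (k + 1))}
    {X : V →ₗ[ℂ] V →ₗ[ℂ] iterHom V k} : (X : iterHom V (k + 2)) ∈ prolongStep 𝔥 ↔
      (∀ v, (X v : iterHom V (k + 1)) ∈ 𝔥) ∧
        ∀ (i j : ZMod 2), ∀ v ∈ gr V i, ∀ w ∈ gr V j, X v w = sgn (i * j) • X w v := Iff.rfl

/-- The trilinear form `J(X(v) w, u)` is super skew-symmetric in `w, u` and supersymmetric in
`v, w`. Using these alternately three times each, it equals its own negative. -/
theorem prolongation_one_eq_bot (hJ : IsOddMetricForm J) :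
    prolongation (lieSuperalgebra (PGroup J)) 1 = ⊥ := by
  rw [eq_bot_iff]
  intro X hX
  obtain ⟨h𝔤, hs⟩ := mem_prolongStep (k := 0) (X := X) |>.mp hX
  change V →ₗ[ℂ] V →ₗ[ℂ] V at X
  change ∀ v, X v ∈ lieSuperalgebra (PGroup J) at h𝔤
  change ∀ (i j : ZMod 2), ∀ v ∈ gr V i, ∀ w ∈ gr V j, X v w = sgn (i * j) • X w v at hs
  have h1 : ∀ a b c : ZMod 2, ∀ v ∈ gr V a, ∀ w ∈ gr V b, ∀ u ∈ gr V c,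
      J (X v w) u = -(sgn (b * c) * J (X v u) w) := fun a b c v hv w hw u hu =>
    skew_of_mem_lieSuperalgebra hJ (h𝔤 v) hw hu
  have h2 : ∀ a b : ZMod 2, ∀ v ∈ gr V a, ∀ w ∈ gr V b, ∀ u,
      J (X v w) u = sgn (a * b) * J (X w v) u := fun a b v hv w hw u => by
    rw [hs a b v hv w hw, map_smul, LinearMap.smul_apply, smul_eq_mul]
  have h3 : ∀ a b c : ZMod 2, ∀ v ∈ gr V a, ∀ w ∈ gr V b, ∀ u ∈ gr V c, J (X v w) u = 0 := by
    intro a b c v hv w hw u hu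
    -- the six transpositions of `(v, w, u)`, alternating between symmetry in the first two
    -- arguments and skewness in the last two
    have e1 := h2 a b v hv w hw u
    have e2 := h1 b a c w hw v hv u hu
    have e3 := h2 b c w hw u hu v
    have e4 := h1 c b a u hu w hw v hv
    have e5 := h2 c a u hu v hv w
    have e6 := h1 a b c v hv w hw u hu
    have s : sgn (a * b) * sgn (a * c) * sgn (b * c) * sgn (b * a) * sgn (c * a) =
        sgn (b * c) := by
      simp only [sgn_mul_sgn]
      congr 1
      have : ∀ a b c : ZMod 2, a * b + a * c + b * c + b * a + c * a = b * c := by decide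
      exact this a b c
    have e7 : J (X v w) u = sgn (b * c) * J (X v u) w := by
      rw [e1, e2, e3, e4, e5]
      linear_combination J (X v u) w * s
    have : (2 : ℂ) * J (X v w) u = 0 := by linear_combination e6 + e7
    simpa using this
  have h4 : X = 0 := by
    refine LinearMap.ext fun v => LinearMap.ext fun w => hJ.nondegenerate.1 _ fun u => ?_
    induction v using super_induction with
    | h a v hv =>
      induction w using super_induction with
      | h b w hw =>
        induction u using super_induction with
        | h c u hu => exact h3 a b c v hv w hw u hu
        | hadd u u' hu hu' => rw [map_add, hu, hu', add_zero]
      | hadd w w' hw hw' => rw [map_add, map_add, LinearMap.add_apply, hw, hw', add_zero]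
    | hadd v v' hv hv' =>
      rw [map_add, LinearMap.add_apply, map_add, LinearMap.add_apply, hv, hv', add_zero]
  exact h4

theorem prolongation_succ_eq_bot {𝔤 : Submodule ℂ (V →ₗ[ℂ] V)} {k : ℕ}
    (h : prolongation 𝔤 k = ⊥) : prolongation 𝔤 (k + 1) = ⊥ := by
  rw [eq_bot_iff]
  intro X hX
  obtain ⟨h1, -⟩ := mem_prolongStep (X := X) |>.mp hX
  rw [h] at h1
  exact LinearMap.ext h1

theorem prolongation_eq_bot_of_one {𝔤 : Submodule ℂ (V →ₗ[ℂ] V)} (h : prolongation 𝔤 1 = ⊥)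
    (l : ℕ) : prolongation 𝔤 (1 + l) = ⊥ := by
  induction l with
  | zero => exact h
  | succ l ih => exact prolongation_succ_eq_bot ih

end LieAlgebra

/-! ### Evaluation of functions at points -/

/-- An evaluation of the germs at `x` in an algebra `R` with a character `body : R → ℂ` whose
kernel is nilpotent, such that a germ is invertible iff its body is non-zero. On a model space `R`
is the exterior algebra of the odd coordinates; the value at `x` alone would not separate
functions, but the evaluations in `R` do. -/
structure PtEval (X : SuperSpace) (x : X.carrier) where
  R : Type
  [ring : Ring R]
  [algebra : Algebra ℂ R]
  ev : ∀ U : Opens X.carrier, x ∈ U → X.O U →ₐ[ℂ] R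
  ev_res : ∀ {U V : Opens X.carrier} (h : U ≤ V) (hx : x ∈ U) (a : X.O V),
    ev U hx (X.res h a) = ev V (h hx) a
  body : R →ₐ[ℂ] ℂ
  nilpotent : ∃ N : ℕ, (LinearMap.ker body.toLinearMap) ^ N = ⊥
  isUnitAt_iff : ∀ (U : Opens X.carrier) (hx : x ∈ U) (a : X.O U),
    X.IsUnitAt a x ↔ body (ev U hx a) ≠ 0

attribute [instance] PtEval.ring PtEval.algebra

namespace PtEval

/-- Evaluations are transported along morphisms. -/
def map {X Y : SuperSpace} (i : Hom X Y) {x : X.carrier} (e : PtEval X x) :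
    PtEval Y (i.base x) where
  R := e.R
  ev U hx := (e.ev (i.pre U) hx).comp (i.comap U)
  ev_res h hx a := by
    rw [AlgHom.comp_apply, i.comap_res]
    exact e.ev_res (preim_mono _ _ h) hx _
  body := e.body
  nilpotent := e.nilpotent
  isUnitAt_iff U hx a := (i.isUnitAt_comap a hx).symm.trans (e.isUnitAt_iff (i.pre U) hx _)

/-- Evaluations are pulled back along open immersions. -/
def comap {X Y : SuperSpace} {i : Hom X Y} (hi : i.IsOpenImmersion) {x : X.carrier}
    (e : PtEval Y (i.base x)) : PtEval X x where
  R := e.R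
  ev U hx := (e.ev (hi.image U) ⟨x, hx, rfl⟩).comp (hi.equiv U).symm.toAlgHom
  ev_res {U V} h hx a := by
    change e.ev _ _ ((hi.equiv U).symm _) = e.ev _ _ ((hi.equiv V).symm _)
    rw [hi.equiv_symm_res h]
    exact e.ev_res _ _ _
  body := e.body
  nilpotent := e.nilpotent
  isUnitAt_iff U hx a := (hi.isUnitAt_equiv_symm a hx).symm.trans (e.isUnitAt_iff _ _ _)

variable {X : SuperSpace} {x : X.carrier} (e : PtEval X x)

/-- The value of a function at the point. -/
def val {U : Opens X.carrier} (hx : x ∈ U) : X.O U →ₐ[ℂ] ℂ := e.body.comp (e.ev U hx)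

theorem val_res {U V : Opens X.carrier} (h : U ≤ V) (hx : x ∈ U) (a : X.O V) :
    e.val hx (X.res h a) = e.val (h hx) a := congrArg e.body (e.ev_res h hx a)

theorem isUnitAt_iff_val {U : Opens X.carrier} (hx : x ∈ U) (a : X.O U) :
    X.IsUnitAt a x ↔ e.val hx a ≠ 0 := e.isUnitAt_iff U hx a

theorem val_odd {U : Opens X.carrier} (hx : x ∈ U) {a : X.O U} (ha : a ∈ gr (X.O U) 1) :
    e.val hx a = 0 := map_eq_zero_of_odd (e.val hx) ha

end PtEval

/-- A superspace with evaluations at every point that jointly separate functions. -/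
structure EvalSpace (X : SuperSpace) : Prop where
  exists_ptEval : ∀ x, Nonempty (PtEval X x)
  eq_zero : ∀ (U : Opens X.carrier) (a : X.O U),
    (∀ x (hx : x ∈ U) (e : PtEval X x), e.ev U hx a = 0) → a = 0

theorem EvalSpace.of_isOpenImmersion {X Y : SuperSpace} {i : Hom X Y} (hi : i.IsOpenImmersion)
    (hY : EvalSpace Y) : EvalSpace X where
  exists_ptEval x := (hY.exists_ptEval (i.base x)).map (PtEval.comap hi)
  eq_zero U a h := by
    refine (hi.equiv U).symm.injective ?_
    rw [map_zero]
    refine hY.eq_zero _ _ ?_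
    rintro _ ⟨x, hx, rfl⟩ e
    exact h x hx (e.comap hi)

theorem EvalSpace.of_cover {X : SuperSpace} (h : ∀ x, ∃ (U : SuperSpace) (i : Hom U X),
    i.IsOpenImmersion ∧ x ∈ Set.range i.base ∧ EvalSpace U) : EvalSpace X where
  exists_ptEval x := by
    obtain ⟨U, i, -, ⟨u, rfl⟩, hU⟩ := h x
    exact (hU.exists_ptEval u).map (PtEval.map i)
  eq_zero V a ha := by
    refine eq_of_comap_eq fun x _ => ?_
    obtain ⟨U, i, hi, hx, hU⟩ := h x
    refine ⟨U, i, hi, hx, ?_⟩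
    rw [map_zero]
    exact hU.eq_zero _ _ fun u hu e => ha _ hu (e.map i)

/-! ### Evaluation on the model spaces -/

section Model

/-- The augmentation of the exterior algebra. -/
abbrev oddBody (q : ℕ) : OddCoord q →ₐ[ℂ] ℂ := ExteriorAlgebra.algebraMapInv

theorem oddBody_ι {q : ℕ} (v : Fin q → ℂ) : oddBody q (ExteriorAlgebra.ι ℂ v) = 0 := by
  simp [oddBody, ExteriorAlgebra.algebraMapInv]

theorem oddBody_algebraMap {q : ℕ} (c : ℂ) : oddBody q (algebraMap ℂ _ c) = c :=
  AlgHom.commutes _ c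

/-- The augmentation ideal is the right ideal generated by the odd coordinates. -/
theorem ker_oddBody_le (q : ℕ) : LinearMap.ker (oddBody q).toLinearMap ≤
    LinearMap.range (ExteriorAlgebra.ι ℂ (M := Fin q → ℂ)) * ⊤ := by
  have key : ∀ a : OddCoord q, a - algebraMap ℂ _ (oddBody q a) ∈
      LinearMap.range (ExteriorAlgebra.ι ℂ (M := Fin q → ℂ)) * ⊤ := by
    intro a
    induction a using ExteriorAlgebra.induction with
    | algebraMap c => rw [oddBody_algebraMap, sub_self]; exact zero_mem _
    | ι v =>
      rw [oddBody_ι, map_zero, sub_zero, ← mul_one (ExteriorAlgebra.ι ℂ v)]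
      exact Submodule.mul_mem_mul ⟨v, rfl⟩ trivial
    | mul a b ha hb =>
      rw [map_mul, map_mul, show a * b - algebraMap ℂ _ (oddBody q a) * algebraMap ℂ _ (oddBody q b)
        = (a - algebraMap ℂ _ (oddBody q a)) * b + oddBody q a • (b - algebraMap ℂ _ (oddBody q b))
        by rw [Algebra.smul_def]; noncomm_ring]
      refine add_mem ?_ (Submodule.smul_mem _ _ hb)
      have := Submodule.mul_mem_mul ha (Submodule.mem_top (R := ℂ) (x := b))
      rw [mul_assoc] at this
      exact (mul_le_mul' le_rfl le_top : _ ≤ LinearMap.range _ * (⊤ : Submodule ℂ (OddCoord q))) this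
    | add a b ha hb =>
      rw [map_add, map_add, add_sub_add_comm]
      exact add_mem ha hb
  intro a ha
  have := key a
  rw [show oddBody q a = 0 from ha, map_zero, sub_zero] at this
  exact this

/-- The augmentation ideal of the exterior algebra on `q` generators is nilpotent: the odd
coordinates can be moved to the left, and a product of `q + 1` of them vanishes. -/
theorem ker_oddBody_pow (q : ℕ) : LinearMap.ker (oddBody q).toLinearMap ^ (q + 1) = ⊥ := by
  set L := LinearMap.range (ExteriorAlgebra.ι ℂ (M := Fin q → ℂ)) with hL
  set I := LinearMap.ker (oddBody q).toLinearMap with hI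
  have h1 : (⊤ : Submodule ℂ (OddCoord q)) * L ≤ L * ⊤ := by
    refine le_trans (Submodule.mul_le.mpr ?_) (ker_oddBody_le q)
    rintro a - _ ⟨v, rfl⟩
    rw [LinearMap.mem_ker, AlgHom.toLinearMap_apply, map_mul, oddBody_ι, mul_zero]
  have h2 : ∀ N : ℕ, (⊤ : Submodule ℂ (OddCoord q)) * L ^ N ≤ L ^ N * ⊤ := by
    intro N
    induction N with
    | zero => rw [pow_zero, one_mul, mul_one]
    | succ N ih =>
      rw [pow_succ, ← mul_assoc]
      refine (mul_le_mul' ih le_rfl).trans ?_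
      rw [mul_assoc, mul_assoc]
      exact mul_le_mul' le_rfl h1
  have h3 : ∀ N : ℕ, I ^ N ≤ L ^ N * ⊤ := by
    intro N
    induction N with
    | zero => rw [pow_zero, pow_zero, one_mul]; exact le_top
    | succ N ih =>
      rw [pow_succ', pow_succ']
      refine (mul_le_mul' (ker_oddBody_le q) ih).trans ?_
      rw [mul_assoc, mul_assoc, ← mul_assoc ⊤]
      refine mul_le_mul' le_rfl ((mul_le_mul' (h2 N) le_rfl).trans ?_)
      rw [mul_assoc]
      exact mul_le_mul' le_rfl le_top
  have h4 : L ^ (q + 1) = ⊥ := by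
    have := exteriorPower.finrank_eq ℂ (n := q + 1) (M := Fin q → ℂ)
    rw [Module.finrank_fin_fun, Nat.choose_succ_self] at this
    exact Submodule.finrank_eq_zero.mp this
  rw [eq_bot_iff]
  refine (h3 (q + 1)).trans ?_
  rw [h4, Submodule.bot_mul]

theorem PartHolAt.inv {n m : ℕ} {F : ModelBody n m → ℂ} {x : ModelBody n m}
    (hF : PartHolAt F x) (h : F x ≠ 0) : PartHolAt (fun y => (F y)⁻¹) x := by
  refine ⟨hF.1.inv h, fun w => ?_⟩
  have h1 : HasFDerivAt (fun y => (F y)⁻¹) (-(F x ^ 2)⁻¹ • fderiv ℝ F x) x :=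
    (hasDerivAt_inv h).comp_hasFDerivAt x
      (hF.1.differentiableAt (by simp)).hasFDerivAt
  rw [h1.fderiv]
  simp only [smul_apply, smul_eq_mul, hF.2 w]
  ring

theorem extZero_apply {n m : ℕ} {U : Opens (ModelBody n m)} (F : U → ℂ) {x : ModelBody n m}
    (hx : x ∈ U) : extZero F x = F ⟨x, hx⟩ := by
  simp [extZero, hx]

theorem isModelSection_smul {n m q : ℕ} {U : Opens (ModelBody n m)} {F : U → ℂ}
    (hF : ∀ x ∈ U, PartHolAt (extZero F) x) (c : OddCoord q) :
    IsModelSection fun x => F x • c := by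
  intro l x hx
  refine ((hF x hx).mul (PartHolAt.const (l c) x)).congr (extZero_eventuallyEq' hx fun y hy => ?_)
  rw [map_smul, smul_eq_mul, extZero_apply F hy]

/-- A section is invertible near a point iff its body is non-zero there: multiplied with the inverse
of its body, which exists near the point, it differs from `1` by a nilpotent section. -/
theorem isUnitAt_model {n m q : ℕ} {U : Opens (ModelBody n m)} (a : modelSections n m q U)
    {x : ModelBody n m} (hx : x ∈ U) :
    (modelSpace n m q).IsUnitAt (U := U) a x ↔ oddBody q (a.1 ⟨x, hx⟩) ≠ 0 := by
  constructor
  · rintro ⟨W, hW, hxW, hu⟩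
    let ev : modelSections n m q W →ₐ[ℂ] OddCoord q :=
      (Pi.evalAlgHom ℂ (fun _ : W => OddCoord q) ⟨x, hxW⟩).comp (modelSections n m q W).val
    exact ((hu.map ev).map (oddBody q)).ne_zero
  · intro h
    let β : U → ℂ := fun y => oddBody q (a.1 y)
    have hβ : ∀ y ∈ U, PartHolAt (extZero β) y := a.2 (oddBody q).toLinearMap
    let W : Opens (ModelBody n m) := ⟨{y | y ∈ U ∧ extZero β y ≠ 0}, by
      refine isOpen_iff_mem_nhds.mpr fun y hy => ?_
      exact Filter.inter_mem (U.isOpen.mem_nhds hy.1)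
        ((hβ y hy.1).1.continuousAt.eventually_ne hy.2)⟩
    have hWU : W ≤ U := fun y hy => hy.1
    have hxW : x ∈ W := ⟨hx, by rwa [extZero_apply β hx]⟩
    refine ⟨W, hWU, hxW, ?_⟩
    let γ : W → ℂ := fun y => (β ⟨y, hWU y.2⟩)⁻¹
    have hγ : ∀ y ∈ W, PartHolAt (extZero γ) y := fun y hy =>
      ((hβ y (hWU hy)).inv hy.2).congr (extZero_eventuallyEq' hy fun z hz => by
        rw [extZero_apply β (hWU hz)])
    -- `s` is the inverse of the body of `a` over the open set `W` where that body does not vanish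
    let s : modelSections n m q W := ⟨fun y => γ y • 1, isModelSection_smul hγ 1⟩
    let b : modelSections n m q W := (modelSpace n m q).res hWU a
    have hb : ∀ y, b.1 y = a.1 ⟨y, hWU y.2⟩ := fun _ => rfl
    have hc : Commute s b := Subtype.ext (funext fun y => by
      change γ y • 1 * b.1 y = b.1 y * γ y • 1
      rw [smul_mul_assoc, one_mul, mul_smul_comm, mul_one])
    have hn : IsNilpotent (s * b - 1) := by
      refine ⟨q + 1, Subtype.ext (funext fun y => ?_)⟩
      have h1 : (s * b - 1).1 y ∈ LinearMap.ker (oddBody q).toLinearMap := by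
        change oddBody q (γ y • 1 * b.1 y - 1) = 0
        rw [smul_mul_assoc, one_mul, map_sub, map_smul, hb, map_one, smul_eq_mul]
        change (β ⟨y, hWU y.2⟩)⁻¹ * β ⟨y, hWU y.2⟩ - 1 = 0
        have hy := y.2.2
        rw [extZero_apply β (hWU y.2)] at hy
        rw [inv_mul_cancel₀ hy, sub_self]
      have h2 := Submodule.pow_mem_pow _ h1 (q + 1)
      rw [ker_oddBody_pow] at h2
      exact h2
    have hu : IsUnit (s * b) := by
      have := hn.isUnit_one_add
      rwa [add_sub_cancel] at this
    exact (hc.isUnit_mul_iff.mp hu).2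

/-- Evaluation of sections of the model space at a point of the body. -/
def modelEval (n m q : ℕ) (x : ModelBody n m) : PtEval (modelSpace n m q) x where
  R := OddCoord q
  ev U hx := (Pi.evalAlgHom ℂ (fun _ : U => OddCoord q) ⟨x, hx⟩).comp (modelSections n m q U).val
  ev_res _ _ _ := rfl
  body := oddBody q
  nilpotent := ⟨q + 1, ker_oddBody_pow q⟩
  isUnitAt_iff _ hx a := isUnitAt_model a hx

theorem evalSpace_model (n m q : ℕ) : EvalSpace (modelSpace n m q) where
  exists_ptEval x := ⟨modelEval n m q x⟩
  eq_zero U _ h := Subtype.ext (funext fun x : U => h x.1 x.2 (modelEval n m q x.1))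

theorem MixedSupermanifold.evalSpace (M : MixedSupermanifold) : EvalSpace M.toSuperSpace :=
  EvalSpace.of_cover fun x => by
    obtain ⟨n, m, q, C, i, j, hi, hj, hx⟩ := M.charts x
    exact ⟨C, i, hi, hx, EvalSpace.of_isOpenImmersion hj (evalSpace_model n m q)⟩

end Model

/-! ### Hadamard's lemma -/

section Hadamard

open MeasureTheory

/-- Differentiation under the integral sign to all orders, as an instance of the smoothness of
convolutions `(f ⋆ g p) 0` which depend on a parameter `p`. -/
theorem contDiff_integral_of_contDiff {P : Type} [NormedAddCommGroup P] [NormedSpace ℝ P]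
    {H : P → ℝ → ℂ} (hH : ContDiff ℝ ∞ ↿H) :
    ContDiff ℝ ∞ fun p => ∫ t in (0 : ℝ)..1, H p t := by
  -- `f` is the indicator of `[0, 1]`, and `g p s = H p (-s)` is cut off outside `[-2, 2]` to have
  -- compact support, which does not change it where `-s` lies in `[0, 1]`
  let χ : ContDiffBump (0 : ℝ) := ⟨1, 2, one_pos, one_lt_two⟩
  let g : P → ℝ → ℂ := fun p s => χ s • H p (-s)
  have hg : ContDiff ℝ ∞ ↿g := by
    have h1 : ContDiff ℝ ∞ fun q : P × ℝ => χ q.2 := χ.contDiff.comp contDiff_snd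
    have h2 : ContDiff ℝ ∞ fun q : P × ℝ => H q.1 (-q.2) :=
      hH.comp (contDiff_fst.prodMk contDiff_snd.neg)
    exact h1.smul h2
  have h := contDiffOn_convolution_right_with_param_comp (n := ⊤) (μ := (volume : Measure ℝ))
    (f := (Set.Icc (0 : ℝ) 1).indicator fun _ => (1 : ℝ)) (g := g)
    (ContinuousLinearMap.lsmul ℝ ℝ) (s := (Set.univ : Set P)) (v := fun _ => (0 : ℝ))
    contDiffOn_const isOpen_univ (isCompact_closedBall (0 : ℝ) 2)
    (fun p x _ hx => by
      have : χ x = 0 := χ.zero_of_le_dist (by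
        rw [Metric.mem_closedBall, not_le] at hx
        exact hx.le)
      simp [g, this])
    ((integrable_indicator_iff measurableSet_Icc).mpr
      (integrableOn_const (by simp))).locallyIntegrable hg.contDiffOn
  rw [contDiffOn_univ] at h
  convert h using 2 with p
  rw [convolution_def, intervalIntegral.integral_of_le zero_le_one,
    ← integral_Icc_eq_integral_Ioc, ← integral_indicator measurableSet_Icc]
  congr 1
  ext t
  by_cases ht : t ∈ Set.Icc (0 : ℝ) 1
  · have : χ (-t) = 1 := χ.one_of_mem_closedBall (by
      rw [Metric.mem_closedBall, dist_zero_right, norm_neg, Real.norm_eq_abs]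
      exact abs_le.mpr ⟨by linarith [ht.1], ht.2⟩)
    simp [g, ht, this]
  · simp [ht]

/-- The even coordinate directions of the body. -/
def bodyBasis {n : ℕ} (i : Fin n) : ModelBody n 0 := (Pi.single i 1, 0)

theorem sum_bodyBasis {n : ℕ} (x : ModelBody n 0) : ∑ i, x.1 i • bodyBasis i = x := by
  refine Prod.ext ?_ (Subsingleton.elim _ _)
  rw [Prod.fst_sum]
  simp only [Prod.smul_fst, bodyBasis]
  ext j
  simp [Finset.sum_apply, Pi.single_apply]

/-- Hadamard's lemma for globally defined smooth functions. -/
theorem exists_hadamard {n : ℕ} {F : ModelBody n 0 → ℂ} (hF : ContDiff ℝ ∞ F)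
    (x₀ : ModelBody n 0) : ∃ G : Fin n → ModelBody n 0 → ℂ, (∀ i, ContDiff ℝ ∞ (G i)) ∧
      ∀ x, F x = F x₀ + ∑ i, ((x.1 i : ℂ) - x₀.1 i) * G i x := by
  have hF' : ContDiff ℝ ∞ (fderiv ℝ F) := hF.fderiv_right (by simp)
  have hH : ∀ v : ModelBody n 0, ContDiff ℝ ∞
      ↿(fun (x : ModelBody n 0) (t : ℝ) => fderiv ℝ F (x₀ + t • (x - x₀)) v) := fun v => by
    have h1 : ContDiff ℝ ∞ fun q : ModelBody n 0 × ℝ => x₀ + q.2 • (q.1 - x₀) :=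
      contDiff_const.add (contDiff_snd.smul (contDiff_fst.sub contDiff_const))
    exact (hF'.comp h1).clm_apply contDiff_const
  refine ⟨fun i x => ∫ t in (0 : ℝ)..1, fderiv ℝ F (x₀ + t • (x - x₀)) (bodyBasis i),
    fun i => contDiff_integral_of_contDiff (hH (bodyBasis i)), fun x => ?_⟩
  have hcont : ∀ v, Continuous fun t : ℝ => fderiv ℝ F (x₀ + t • (x - x₀)) v := fun v =>
    ((hH v).continuous.comp (Continuous.prodMk_right x) : _)
  have h1 : ∫ t in (0 : ℝ)..1, fderiv ℝ F (x₀ + t • (x - x₀)) (x - x₀) = F x - F x₀ := by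
    have h2 : ∀ t : ℝ, HasDerivAt (fun t : ℝ => F (x₀ + t • (x - x₀)))
        (fderiv ℝ F (x₀ + t • (x - x₀)) (x - x₀)) t := fun t => by
      have h3 : HasDerivAt (fun t : ℝ => x₀ + t • (x - x₀)) (x - x₀) t := by
        simpa using ((hasDerivAt_id t).smul_const (x - x₀)).const_add x₀
      exact ((hF.differentiable (by simp)) _).hasFDerivAt.comp_hasDerivAt t h3
    rw [intervalIntegral.integral_eq_sub_of_hasDerivAt (fun t _ => h2 t)
      ((hcont _).intervalIntegrable _ _)]
    simp
  have h4 : ∀ t : ℝ, fderiv ℝ F (x₀ + t • (x - x₀)) (x - x₀) =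
      ∑ i, ((x.1 i : ℂ) - x₀.1 i) * fderiv ℝ F (x₀ + t • (x - x₀)) (bodyBasis i) := fun t => by
    conv_lhs => rw [← sum_bodyBasis (x - x₀), map_sum]
    refine Finset.sum_congr rfl fun i _ => ?_
    rw [map_smul, sum_bodyBasis, Complex.real_smul, Prod.fst_sub, Pi.sub_apply,
      Complex.ofReal_sub]
  rw [← sub_eq_iff_eq_add', ← h1]
  simp_rw [h4]
  rw [intervalIntegral.integral_finsetSum fun i _ =>
    (((hcont _).const_mul _).intervalIntegrable _ _)]
  simp_rw [intervalIntegral.integral_const_mul]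

/-- A smooth function on an open set agrees near any point with a globally defined one. -/
theorem exists_contDiff_eqOn {n : ℕ} (x₀ : ModelBody n 0) {W : Set (ModelBody n 0)}
    (hW : W ∈ nhds x₀) : ∃ N : Opens (ModelBody n 0), x₀ ∈ N ∧ (N : Set (ModelBody n 0)) ⊆ W ∧
      ∀ F : ModelBody n 0 → ℂ, (∀ x ∈ W, ContDiffAt ℝ ∞ F x) →
        ∃ G : ModelBody n 0 → ℂ, ContDiff ℝ ∞ G ∧ ∀ x ∈ N, G x = F x := by
  obtain ⟨r, hr, hrW⟩ := Metric.nhds_basis_closedBall.mem_iff.mp hW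
  let χ : ContDiffBump x₀ := ⟨r / 2, r, by positivity, by linarith⟩
  refine ⟨⟨Metric.ball x₀ (r / 2), Metric.isOpen_ball⟩, Metric.mem_ball_self (by positivity),
    fun x hx => hrW (Metric.ball_subset_closedBall (Metric.ball_subset_ball (by linarith) hx)),
    fun F hF => ⟨fun x => χ x • F x, ?_, fun x hx => ?_⟩⟩
  · rw [contDiff_iff_contDiffAt]
    intro x
    by_cases hx : x ∈ Metric.closedBall x₀ r
    · exact χ.contDiffAt.smul (hF x (hrW hx))
    · refine (contDiffAt_const (c := (0 : ℂ))).congr_of_eventuallyEq ?_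
      filter_upwards [Metric.isClosed_closedBall.isOpen_compl.mem_nhds hx] with y hy
      have : χ y = 0 := χ.zero_of_le_dist (by
        have hy : y ∉ Metric.closedBall x₀ r := hy
        rw [Metric.mem_closedBall, not_le] at hy
        exact hy.le)
      rw [this, zero_smul]
  · have : χ x = 1 := χ.one_of_mem_closedBall (Metric.ball_subset_closedBall hx)
    change χ x • F x = F x
    rw [this, one_smul]

/-- Without complex coordinates there is no holomorphy condition. -/
theorem partHolAt_iff {n : ℕ} {F : ModelBody n 0 → ℂ} {x : ModelBody n 0} :
    PartHolAt F x ↔ ContDiffAt ℝ ∞ F x := by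
  refine ⟨fun h => h.1, fun h => ⟨h, fun w => ?_⟩⟩
  rw [Subsingleton.elim w 0, smul_zero, show ((0 : Fin n → ℝ), (0 : Fin 0 → ℂ)) = 0 from rfl,
    map_zero, mul_zero]

variable {n q : ℕ}

/-- The sections of the model space that are constant along the body, with values in the exterior
algebra. -/
def constModelSection (n q : ℕ) (U : Opens (ModelBody n 0)) :
    OddCoord q →ₐ[ℂ] modelSections n 0 q U where
  toFun c := ⟨fun _ => c, fun l x hx => (PartHolAt.const (l c) x).congr
    (extZero_eventuallyEq' hx fun _ _ => rfl)⟩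
  map_one' := rfl
  map_mul' _ _ := rfl
  map_zero' := rfl
  map_add' _ _ := rfl
  commutes' _ := rfl

/-- The even coordinate functions, as sections of the model space. -/
def coordModelSection (q : ℕ) (U : Opens (ModelBody n 0)) (i : Fin n) : modelSections n 0 q U :=
  ⟨fun x => (x.1.1 i : ℂ) • 1, isModelSection_smul (fun x hx => by
    refine ((partHolAt_iff (F := fun x : ModelBody n 0 => (x.1 i : ℂ))).mpr ?_).congr
      (extZero_eventuallyEq' hx fun _ _ => rfl)
    exact Complex.ofRealCLM.contDiff.contDiffAt.comp x
      ((contDiff_apply ℝ ℝ i).contDiffAt.comp x contDiffAt_fst)) 1⟩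

/-- Hadamard's lemma for sections of the model space, applied to each coefficient with respect to a
basis of the exterior algebra. -/
theorem exists_hadamard_modelSection {U : Opens (ModelBody n 0)} (a : modelSections n 0 q U)
    {x₀ : ModelBody n 0} (hx₀ : x₀ ∈ U) : ∃ (N : Opens (ModelBody n 0)) (hN : N ≤ U)
      (g : Fin n → modelSections n 0 q N), x₀ ∈ N ∧
      (modelSpace n 0 q).res hN a = constModelSection n q N (a.1 ⟨x₀, hx₀⟩) +
        ∑ i, (coordModelSection q N i - algebraMap ℂ _ (x₀.1 i : ℂ)) * g i := by
  -- the neighbourhood `N` is chosen before the coefficient functions, so that it serves all of them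
  let B := (Pi.basisFun ℂ (Fin q)).ExteriorAlgebra
  obtain ⟨N, hxN, hNU, hN⟩ := exists_contDiff_eqOn x₀ (U.isOpen.mem_nhds hx₀)
  choose F hF hFe using fun s => hN (extZero fun y => B.coord s (a.1 y))
    (fun x hx => (a.2 (B.coord s) x hx).1)
  choose G hG hGe using fun s => exists_hadamard (hF s) x₀
  have hs : ∀ i s, IsModelSection (U := N) (q := q) fun y => G s i y.1 • B s := fun i s =>
    isModelSection_smul (fun x hx => (partHolAt_iff.mpr (hG s i).contDiffAt).congr
      (extZero_eventuallyEq' hx fun _ _ => rfl)) _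
  refine ⟨N, hNU, fun i => ∑ s, ⟨_, hs i s⟩, hxN, Subtype.ext (funext fun y => ?_)⟩
  have e1 : ∀ (y : ModelBody n 0) (hy : y ∈ N), a.1 ⟨y, hNU hy⟩ = ∑ s, F s y • B s := by
    intro y hy
    conv_lhs => rw [← B.sum_repr (a.1 ⟨y, hNU hy⟩)]
    refine Finset.sum_congr rfl fun s _ => ?_
    rw [hFe s y hy, extZero_apply _ (hNU hy)]
    rfl
  have e2 : ∀ i, ((∑ s, (⟨_, hs i s⟩ : modelSections n 0 q N) : modelSections n 0 q N)).1 y =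
      ∑ s, G s i y.1 • B s := fun i => by
    rw [AddSubmonoidClass.coe_finsetSum, Finset.sum_apply]
  have e3 : ((∑ i, (coordModelSection q N i - algebraMap ℂ _ (x₀.1 i : ℂ)) *
      ∑ s, (⟨_, hs i s⟩ : modelSections n 0 q N) : modelSections n 0 q N)).1 y =
      ∑ i, ((y.1.1 i : ℂ) - x₀.1 i) • ∑ s, G s i y.1 • B s := by
    rw [AddSubmonoidClass.coe_finsetSum, Finset.sum_apply]
    refine Finset.sum_congr rfl fun i _ => ?_
    rw [← e2, sub_smul, Algebra.smul_def (x₀.1 i : ℂ), ← smul_one_mul (y.1.1 i : ℂ), ← sub_mul]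
    rfl
  change a.1 ⟨y.1, hNU y.2⟩ = a.1 ⟨x₀, hx₀⟩ + (∑ i, (coordModelSection q N i -
    algebraMap ℂ _ (x₀.1 i : ℂ)) * ∑ s, (⟨_, hs i s⟩ : modelSections n 0 q N) :
      modelSections n 0 q N).1 y
  rw [e3, e1 y.1 y.2, e1 x₀ hxN]
  simp_rw [Finset.smul_sum, smul_smul]
  rw [Finset.sum_comm, ← Finset.sum_add_distrib]
  refine Finset.sum_congr rfl fun s _ => ?_
  rw [hGe s y.1, add_smul, Finset.sum_smul]

/-- The functions with constant coefficients; `constModelSection` in terms of the structure sheaf of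
the model space. -/
def constSection (U : Opens (modelSpace n 0 q).carrier) :
    OddCoord q →ₐ[ℂ] (modelSpace n 0 q).O U :=
  constModelSection n q U

/-- The even coordinate functions; `coordModelSection` in terms of the structure sheaf of the model
space. -/
def coordSection (U : Opens (modelSpace n 0 q).carrier) (i : Fin n) : (modelSpace n 0 q).O U :=
  coordModelSection q U i

/-- The value of a function on a model supermanifold at a point of the body. -/
def sectionVal {U : Opens (modelSpace n 0 q).carrier} (a : (modelSpace n 0 q).O U)
    {x : (modelSpace n 0 q).carrier} (hx : x ∈ U) : OddCoord q :=
  Subtype.val (p := IsModelSection) a ⟨x, hx⟩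

/-- Hadamard's lemma for the functions on a model supermanifold. -/
theorem exists_hadamard_section {U : Opens (modelSpace n 0 q).carrier} (a : (modelSpace n 0 q).O U)
    {x₀ : (modelSpace n 0 q).carrier} (hx₀ : x₀ ∈ U) :
    ∃ (N : Opens (modelSpace n 0 q).carrier) (hN : N ≤ U)
      (g : Fin n → (modelSpace n 0 q).O N), x₀ ∈ N ∧
      (modelSpace n 0 q).res hN a = constSection N (sectionVal a hx₀) +
        ∑ i, (coordSection N i - algebraMap ℂ ((modelSpace n 0 q).O N) (x₀.1 i : ℂ)) * g i :=
  exists_hadamard_modelSection a hx₀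

end Hadamard

/-! ### Vector fields along morphisms to a model supermanifold -/

section Derivations

variable {n q : ℕ} {T : SuperSpace}

theorem Der_one {M : SuperSpace} {f : Hom T M} {p : ZMod 2} {D : OpAlong f} (hD : D ∈ Der f p)
    (W : Opens M.carrier) : D W 1 = 0 := by
  have h := hD.2.2 W 0 1 SuperAlgebra.one_mem 1
  simpa [sgn] using h

theorem Der_algebraMap {M : SuperSpace} {f : Hom T M} {p : ZMod 2} {D : OpAlong f}
    (hD : D ∈ Der f p) (W : Opens M.carrier) (c : ℂ) : D W (algebraMap ℂ _ c) = 0 := by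
  rw [Algebra.algebraMap_eq_smul_one, map_smul, Der_one hD, smul_zero]

theorem constSection_mem {U : Opens (modelSpace n 0 q).carrier} {i : ZMod 2} {c : OddCoord q}
    (hc : c ∈ oddGr q i) : constSection U c ∈ gr ((modelSpace n 0 q).O U) i :=
  show constModelSection n q U c ∈ modelGr n 0 q U i from fun _ => hc

theorem coordSection_mem (U : Opens (modelSpace n 0 q).carrier) (i : Fin n) :
    coordSection U i ∈ gr ((modelSpace n 0 q).O U) 0 :=
  show coordModelSection q U i ∈ modelGr n 0 q U 0 from fun _ =>
  Submodule.smul_mem _ _ (CliffordAlgebra.one_le_evenOdd_zero _ (Submodule.one_le.mp le_rfl))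

theorem ι_mem_oddGr (v : Fin q → ℂ) : ExteriorAlgebra.ι ℂ v ∈ oddGr q 1 :=
  CliffordAlgebra.ι_mem_evenOdd_one _ _

/-- The coordinate functions of the model supermanifold. -/
def coordFun (U : Opens (modelSpace n 0 q).carrier) : Fin n ⊕ Fin q → (modelSpace n 0 q).O U :=
  Sum.elim (coordSection U) fun k => constSection U (ExteriorAlgebra.ι ℂ (Pi.single k 1))

variable (f : Hom T (modelSpace n 0 q))

/-- A derivation that kills the odd coordinates kills all polynomials in them. -/
theorem Der_const_eq_zero {p : ZMod 2} {D : OpAlong f} (hD : D ∈ Der f p)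
    (h : ∀ k, D ⊤ (coordFun ⊤ k) = 0) (W : Opens (modelSpace n 0 q).carrier) (c : OddCoord q) :
    D W (constSection W c) = 0 := by
  have hι : ∀ v, D W (constSection W (ExteriorAlgebra.ι ℂ v)) = 0 := by
    intro v
    have h1 : ∀ k : Fin q, D W (constSection W (ExteriorAlgebra.ι ℂ (Pi.single k 1))) = 0 := by
      intro k
      have := hD.1 W ⊤ le_top (coordFun ⊤ (Sum.inr k))
      rw [h, map_zero] at this
      exact this
    let F : (Fin q → ℂ) →ₗ[ℂ] T.O (f.pre W) :=
      D W ∘ₗ (constSection W).toLinearMap ∘ₗ ExteriorAlgebra.ι ℂ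
    have hF : F = 0 := LinearMap.pi_ext' fun k => LinearMap.ext_ring (h1 k)
    exact LinearMap.congr_fun hF v
  induction c using CliffordAlgebra.left_induction with
  | algebraMap r => exact Der_algebraMap hD W r
  | add x y hx hy =>
    rw [map_add]
    rw [map_add, hx, hy, add_zero]
  | ι_mul x m hx =>
    rw [map_mul, hD.2.2 W 1 _ (constSection_mem (ι_mem_oddGr m)), hx, hι, zero_mul, mul_zero,
      smul_zero, add_zero]

/-- A homogeneous derivation along `f` that kills the coordinate functions vanishes: by Hadamard's
lemma all its values at a point lie in every power of the nilpotent ideal of elements with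
vanishing body. -/
theorem Der_eq_zero (hT : EvalSpace T) {p : ZMod 2} {D : OpAlong f} (hD : D ∈ Der f p)
    (h : ∀ k, D ⊤ (coordFun ⊤ k) = 0) : D = 0 := by
  have hx : ∀ (W : Opens (modelSpace n 0 q).carrier) i, D W (coordSection W i) = 0 := by
    intro W i
    have := hD.1 W ⊤ le_top (coordFun ⊤ (Sum.inl i))
    rw [h, map_zero] at this
    exact this
  refine funext fun W => LinearMap.ext fun a => hT.eq_zero _ _ fun t ht e => ?_
  -- Write `a = const + ∑ (xᵢ - xᵢ(f t)) gᵢ` near `f t`. As `D` kills the constants and the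
  -- `xᵢ`, `D a = ∑ f^*(xᵢ - xᵢ(f t)) D gᵢ`, whose first factors have vanishing body at `t`; then
  -- iterate with the `gᵢ` in place of `a`.
  have key : ∀ (N : ℕ) (W : Opens (modelSpace n 0 q).carrier) (ht : f.base t ∈ W)
      (a : (modelSpace n 0 q).O W), e.ev (f.pre W) ht (D W a) ∈
        LinearMap.ker e.body.toLinearMap ^ N * ⊤ := by
    intro N
    induction N with
    | zero =>
      intro W ht a
      rw [pow_zero, one_mul]
      trivial
    | succ N ih =>
      intro W ht a
      obtain ⟨W', hW', g, htW', hg⟩ := exists_hadamard_section a ht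
      let c : Fin n → (modelSpace n 0 q).O W' := fun i =>
        coordSection W' i - algebraMap ℂ ((modelSpace n 0 q).O W') ((f.base t).1 i : ℂ)
      have h1 : e.ev (f.pre W) ht (D W a) =
          e.ev (f.pre W') htW' (D W' ((modelSpace n 0 q).res hW' a)) := by
        rw [hD.1 W' W hW' a]
        exact (e.ev_res (preim_mono _ _ hW') htW' _).symm
      have h2 : D W' ((modelSpace n 0 q).res hW' a) = ∑ i, f.comap W' (c i) * D W' (g i) := by
        rw [hg, map_add, Der_const_eq_zero f hD h, zero_add, map_sum]
        refine Finset.sum_congr rfl fun i _ => ?_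
        have h3 : c i ∈ gr ((modelSpace n 0 q).O W') 0 :=
          sub_mem (coordSection_mem W' i) (by
            rw [Algebra.algebraMap_eq_smul_one]
            exact Submodule.smul_mem _ _ SuperAlgebra.one_mem)
        have h4 : D W' (c i) = 0 := by
          rw [map_sub, hx, Der_algebraMap hD, sub_zero]
        rw [hD.2.2 W' 0 (c i) h3, h4, zero_mul, zero_add, mul_zero]
        exact one_smul ℂ _
      rw [h1, h2, map_sum, pow_succ', mul_assoc]
      refine Submodule.sum_mem _ fun i _ => ?_
      rw [map_mul]
      refine Submodule.mul_mem_mul ?_ (ih W' htW' _)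
      -- the body of `f^*(xᵢ - xᵢ(f t))` is detected by invertibility, which morphisms preserve and
      -- reflect
      by_contra hne
      have h5 := (e.isUnitAt_iff (f.pre W') htW' _).mpr hne
      have h6 := (f.isUnitAt_comap (c i) htW').mp h5
      refine (isUnitAt_model (c i) htW').mp h6 ?_
      change oddBody q (((f.base t).1 i : ℂ) • 1 - algebraMap ℂ _ ((f.base t).1 i : ℂ)) = 0
      rw [Algebra.algebraMap_eq_smul_one, sub_self, map_zero]
  obtain ⟨N, hN⟩ := e.nilpotent
  have := key N W ht a
  rw [hN, Submodule.bot_mul] at this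
  exact this

end Derivations

section CoordFields

variable {n q : ℕ}

/-- The canonical basis of the exterior algebra. -/
abbrev oddBasis (q : ℕ) : Module.Basis (Finset (Fin q)) ℂ (OddCoord q) :=
  (Pi.basisFun ℂ (Fin q)).ExteriorAlgebra

theorem oddCoord_ext {a b : OddCoord q} (h : ∀ l : OddCoord q →ₗ[ℂ] ℂ, l a = l b) : a = b :=
  (oddBasis q).ext_elem fun s => h ((oddBasis q).coord s)

/-- The partial derivative at `x` of a function with values in the exterior algebra, taken
coefficient by coefficient because the exterior algebra carries no norm. -/
def pderivAt {U : Opens (ModelBody n 0)} (a : U → OddCoord q) (i : Fin n) (x : ModelBody n 0) :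
    OddCoord q :=
  ∑ s, fderiv ℝ (extZero fun y => (oddBasis q).coord s (a y)) x (bodyBasis i) • oddBasis q s

variable {U : Opens (ModelBody n 0)} {a b : U → OddCoord q}

theorem IsModelSection.hasFDerivAt (ha : IsModelSection a) (l : OddCoord q →ₗ[ℂ] ℂ)
    {x : ModelBody n 0} (hx : x ∈ U) : HasFDerivAt (extZero fun y => l (a y))
      (fderiv ℝ (extZero fun y => l (a y)) x) x :=
  ((ha l x hx).1.differentiableAt (by simp)).hasFDerivAt

/-- Differentiation commutes with every linear form on the exterior algebra, not just with the
coordinates in which the derivative is defined. -/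
theorem apply_pderivAt (ha : IsModelSection a) (i : Fin n) (l : OddCoord q →ₗ[ℂ] ℂ)
    {x : ModelBody n 0} (hx : x ∈ U) :
    l (pderivAt a i x) = fderiv ℝ (extZero fun y => l (a y)) x (bodyBasis i) := by
  have h1 : HasFDerivAt (fun y => ∑ s, extZero (fun y => (oddBasis q).coord s (a y)) y *
      l (oddBasis q s)) (∑ s, l (oddBasis q s) •
        fderiv ℝ (extZero fun y => (oddBasis q).coord s (a y)) x) x :=
    HasFDerivAt.fun_sum fun s _ => (ha.hasFDerivAt _ hx).mul_const _
  have h2 := h1.congr_of_eventuallyEq (extZero_eventuallyEq' (F := fun y => l (a y)) hx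
    fun y hy => by
      simp_rw [extZero_apply _ hy]
      conv_lhs => rw [← (oddBasis q).sum_repr (a ⟨y, hy⟩)]
      simp [-Module.Basis.sum_repr])
  rw [h2.fderiv, pderivAt, map_sum, sum_apply]
  refine Finset.sum_congr rfl fun s _ => ?_
  rw [map_smul, smul_apply, smul_eq_mul, smul_eq_mul, mul_comm]

theorem isModelSection_pderivAt (ha : IsModelSection a) (i : Fin n) :
    IsModelSection fun x : U => pderivAt a i x := by
  intro l x hx
  rw [partHolAt_iff]
  have h1 : ContDiffAt ℝ ∞ (fun y => fderiv ℝ (extZero fun y => l (a y)) y (bodyBasis i)) x :=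
    ((ha l x hx).1.fderiv_right (by simp)).clm_apply contDiffAt_const
  exact h1.congr_of_eventuallyEq (extZero_eventuallyEq' hx fun y hy => apply_pderivAt ha i l hy)

theorem pderivAt_mul (ha : IsModelSection a) (hb : IsModelSection b) (i : Fin n)
    (hab : IsModelSection (a * b)) {x : ModelBody n 0} (hx : x ∈ U) :
    pderivAt (a * b) i x = pderivAt a i x * b ⟨x, hx⟩ + a ⟨x, hx⟩ * pderivAt b i x := by
  refine oddCoord_ext fun l => ?_
  let B := oddBasis q
  have key : ∀ c d : OddCoord q, l (c * d) = ∑ s, ∑ t, (B.coord s c * B.coord t d) *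
      l (B s * B t) := by
    intro c d
    conv_lhs => rw [← B.sum_repr c, ← B.sum_repr d]
    rw [Finset.sum_mul_sum, map_sum]
    refine Finset.sum_congr rfl fun s _ => ?_
    rw [map_sum]
    refine Finset.sum_congr rfl fun t _ => ?_
    rw [smul_mul_smul_comm, map_smul, smul_eq_mul]
    rfl
  have h1 : HasFDerivAt (fun y => ∑ s, ∑ t, (extZero (fun y => B.coord s (a y)) y *
      extZero (fun y => B.coord t (b y)) y) * l (B s * B t)) _ x :=
    HasFDerivAt.fun_sum fun s _ => HasFDerivAt.fun_sum fun t _ =>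
      ((ha.hasFDerivAt (B.coord s) hx).mul (hb.hasFDerivAt (B.coord t) hx)).mul_const _
  have h2 := h1.congr_of_eventuallyEq (extZero_eventuallyEq' (F := fun y => l ((a * b) y)) hx
    fun y hy => by
      simp_rw [extZero_apply _ hy]
      exact key _ _)
  rw [apply_pderivAt hab i l hx, h2.fderiv, map_add, key, key, ← Finset.sum_add_distrib,
    sum_apply]
  refine Finset.sum_congr rfl fun s _ => ?_
  rw [← Finset.sum_add_distrib, sum_apply]
  refine Finset.sum_congr rfl fun t _ => ?_
  rw [apply_pderivAt ha i _ hx, apply_pderivAt hb i _ hx, extZero_apply _ hx, extZero_apply _ hx]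
  simp only [smul_apply, add_apply, smul_eq_mul]
  ring

/-- The partial derivative in an even coordinate direction. -/
def evenField (n q : ℕ) (i : Fin n) : OpAlong (Hom.id (modelSpace n 0 q)) := fun U =>
  { toFun := fun a : modelSections n 0 q U => ⟨_, isModelSection_pderivAt a.2 i⟩
    map_add' := fun a b => Subtype.ext (funext fun x => oddCoord_ext fun l => by
      change l (pderivAt (a + b : modelSections n 0 q U).1 i x) =
        l (pderivAt a.1 i x + pderivAt b.1 i x)
      have h1 := ((a.2.hasFDerivAt l x.2).add (b.2.hasFDerivAt l x.2)).congr_of_eventuallyEq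
        (extZero_eventuallyEq' (F := fun y => l ((a + b : modelSections n 0 q U).1 y)) x.2
          fun y hy => by
            rw [Pi.add_apply, extZero_apply _ hy, extZero_apply _ hy]
            exact map_add l _ _)
      rw [apply_pderivAt (a + b : modelSections n 0 q U).2 i l x.2, h1.fderiv, map_add,
        apply_pderivAt a.2 i l x.2, apply_pderivAt b.2 i l x.2]
      rfl)
    map_smul' := fun c a => Subtype.ext (funext fun x => oddCoord_ext fun l => by
      change l (pderivAt (c • a : modelSections n 0 q U).1 i x) = l (c • pderivAt a.1 i x)
      have h1 := ((a.2.hasFDerivAt l x.2).const_mul c).congr_of_eventuallyEq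
        (extZero_eventuallyEq' (F := fun y => l ((c • a : modelSections n 0 q U).1 y)) x.2
          fun y hy => by
            rw [extZero_apply _ hy]
            exact map_smul l _ _)
      rw [apply_pderivAt (c • a : modelSections n 0 q U).2 i l x.2, h1.fderiv, map_smul,
        apply_pderivAt a.2 i l x.2]
      rfl) }

theorem evenField_mem_Der (i : Fin n) : evenField n q i ∈ Der (Hom.id (modelSpace n 0 q)) 0 := by
  refine ⟨fun W W' h a => ?_, fun W j a ha => ?_, fun W j a ha b => ?_⟩
  · refine Subtype.ext (funext fun x : W => oddCoord_ext fun l => ?_)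
    refine (apply_pderivAt ((modelSpace n 0 q).res h a).2 i l x.2).trans
      (Eq.trans ?_ (apply_pderivAt a.2 i l (h x.2)).symm)
    have h1 : (extZero fun y => l (((modelSpace n 0 q).res h a : modelSections n 0 q W).1 y))
        =ᶠ[nhds (show ModelBody n 0 from x.1)]
          extZero fun y => l (Subtype.val (p := IsModelSection) a y) :=
      extZero_eventuallyEq x.2 le_rfl h fun _ _ => rfl
    exact congrArg (fun L : ModelBody n 0 →L[ℝ] ℂ => L (bodyBasis i)) h1.fderiv_eq
  · have ha : ∀ x : W, a.1 x ∈ oddGr q j := ha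
    rw [zero_add]
    intro x
    -- a projection to the part of parity `j` fixes `a`, hence its derivative
    obtain ⟨P, hP, hPj⟩ : ∃ P : OddCoord q →ₗ[ℂ] OddCoord q, (∀ c ∈ oddGr q j, P c = c) ∧
        ∀ c, P c ∈ oddGr q j := by
      have hc : IsCompl (oddGr q 0) (oddGr q 1) := CliffordAlgebra.evenOdd_isCompl _
      obtain rfl | rfl := parity_cases j
      · exact ⟨(oddGr q 0).projection _ hc, fun c hc' => Submodule.projection_apply_left hc ⟨c, hc'⟩,
          fun c => SetLike.coe_mem ((oddGr q 0).projectionOnto _ hc c)⟩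
      · exact ⟨(oddGr q 1).projection _ hc.symm,
          fun c hc' => Submodule.projection_apply_left hc.symm ⟨c, hc'⟩,
          fun c => SetLike.coe_mem ((oddGr q 1).projectionOnto _ hc.symm c)⟩
    change pderivAt a.1 i x ∈ oddGr q j
    have : pderivAt a.1 i x = P (pderivAt a.1 i x) := by
      refine oddCoord_ext fun l => ?_
      have h1 := apply_pderivAt a.2 i l x.2
      have h2 := apply_pderivAt a.2 i (l ∘ₗ P) x.2
      rw [LinearMap.comp_apply] at h2
      rw [h1, h2]
      congr 2
      congr 1
      funext y
      rw [LinearMap.comp_apply, hP _ (ha y)]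
    rw [this]
    exact hPj _
  · rw [zero_mul]
    refine Subtype.ext (funext fun x : W => ?_)
    refine (pderivAt_mul a.2 b.2 i ((a : modelSections n 0 q W) * b).2 x.2).trans ?_
    exact congrArg (fun c => pderivAt (Subtype.val (p := IsModelSection) a) i x.1 *
      Subtype.val (p := IsModelSection) b x + c) (one_smul ℂ _).symm

/-- Contraction with a dual vector is an odd derivation of the exterior algebra. -/
theorem contractLeft_mul (d : Module.Dual ℂ (Fin q → ℂ)) (c e : OddCoord q) :
    CliffordAlgebra.contractLeft d (c * e) = CliffordAlgebra.contractLeft d c * e +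
      CliffordAlgebra.involute c * CliffordAlgebra.contractLeft d e := by
  induction c using CliffordAlgebra.left_induction generalizing e with
  | algebraMap r =>
    rw [CliffordAlgebra.contractLeft_algebraMap_mul, CliffordAlgebra.contractLeft_algebraMap,
      zero_mul, zero_add, AlgHom.commutes]
  | add x y hx hy => simp only [add_mul, map_add, hx, hy]; abel
  | ι_mul x m hx =>
    rw [mul_assoc, CliffordAlgebra.contractLeft_ι_mul, hx, CliffordAlgebra.contractLeft_ι_mul,
      map_mul, CliffordAlgebra.involute_ι, sub_mul, smul_mul_assoc, mul_add, neg_mul, neg_mul,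
      mul_assoc, mul_assoc]
    abel

theorem contractLeft_mem (d : Module.Dual ℂ (Fin q → ℂ)) (j : ZMod 2) (c : OddCoord q)
    (hc : c ∈ oddGr q j) : CliffordAlgebra.contractLeft d c ∈ oddGr q (1 + j) := by
  have hι := ι_mem_oddGr (q := q)
  induction c, hc using CliffordAlgebra.evenOdd_induction with
  | range_ι_pow c hc =>
    obtain rfl | rfl := parity_cases j
    · obtain ⟨r, rfl⟩ := Submodule.mem_one.mp (by simpa using hc)
      rw [CliffordAlgebra.contractLeft_algebraMap]
      exact zero_mem _
    · obtain ⟨v, rfl⟩ : c ∈ LinearMap.range (CliffordAlgebra.ι (0 : QuadraticForm ℂ _)) := by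
        simpa [ZMod.val_one] using hc
      rw [CliffordAlgebra.contractLeft_ι]
      exact SetLike.algebraMap_mem_graded (oddGr q) _
  | add x y _ _ hx hy => rw [map_add]; exact add_mem hx hy
  | ι_mul_ι_mul m₁ m₂ x hx ih =>
    have e1 : (1 : ZMod 2) + (1 + (1 + j)) = 1 + j := by
      rw [← add_assoc, CharTwo.add_self_eq_zero, zero_add]
    rw [mul_assoc, CliffordAlgebra.contractLeft_ι_mul, CliffordAlgebra.contractLeft_ι_mul, mul_sub,
      mul_smul_comm]
    refine sub_mem (Submodule.smul_mem _ _ (SetLike.mul_mem_graded (hι _) hx))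
      (sub_mem (Submodule.smul_mem _ _ (SetLike.mul_mem_graded (hι _) hx)) ?_)
    have := SetLike.mul_mem_graded (hι m₁) (SetLike.mul_mem_graded (hι m₂) ih)
    rwa [e1] at this

/-- The derivative in an odd coordinate direction is the contraction with a dual vector. -/
def oddField (n q : ℕ) (k : Fin q) : OpAlong (Hom.id (modelSpace n 0 q)) := fun U =>
  { toFun := fun a : modelSections n 0 q U =>
      ⟨_, a.2.map (CliffordAlgebra.contractLeft (LinearMap.proj k))⟩
    map_add' := fun _ _ => Subtype.ext (funext fun _ => map_add _ _ _)
    map_smul' := fun a b => Subtype.ext (funext fun x =>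
      map_smul (CliffordAlgebra.contractLeft (Q := (0 : QuadraticForm ℂ (Fin q → ℂ)))
        (LinearMap.proj k : Module.Dual ℂ (Fin q → ℂ))) a (b.1 x)) }

theorem oddField_mem_Der (k : Fin q) : oddField n q k ∈ Der (Hom.id (modelSpace n 0 q)) 1 := by
  refine ⟨fun _ _ _ _ => Subtype.ext rfl, fun W j a ha => ?_, fun W j a ha b => ?_⟩
  · exact fun x => contractLeft_mem (LinearMap.proj k) j _ (ha x)
  · refine Subtype.ext (funext fun x : W => ?_)
    refine (contractLeft_mul _ _ _).trans ?_
    change _ = _ + sgn (1 * j) • (a.1 x * CliffordAlgebra.contractLeft _ (b.1 x))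
    have ha : a.1 x ∈ oddGr q j := ha x
    congr 1
    obtain rfl | rfl := parity_cases j
    · rw [CliffordAlgebra.involute_eq_of_mem_even ha]
      exact (one_smul ℂ _).symm
    · rw [CliffordAlgebra.involute_eq_of_mem_odd ha]
      simp [sgn]

end CoordFields

/-! ### Coordinate frames -/

section CoordFrame

variable {n q : ℕ}

/-- The coordinate vector fields of the model supermanifold, dual to `coordFun`. -/
def modelField (n q : ℕ) : Fin n ⊕ Fin q → OpAlong (Hom.id (modelSpace n 0 q)) :=
  Sum.elim (evenField n q) (oddField n q)

/-- The parities of the coordinates. -/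
def coordParity (n q : ℕ) : Fin n ⊕ Fin q → ZMod 2 := Sum.elim (fun _ => 0) fun _ => 1

theorem modelField_mem_Der (k : Fin n ⊕ Fin q) :
    modelField n q k ∈ Der (Hom.id (modelSpace n 0 q)) (coordParity n q k) := by
  obtain i | k := k
  · exact evenField_mem_Der i
  · exact oddField_mem_Der k

theorem coordFun_mem (U : Opens (modelSpace n 0 q).carrier) (k : Fin n ⊕ Fin q) :
    coordFun U k ∈ gr ((modelSpace n 0 q).O U) (coordParity n q k) := by
  obtain i | k := k
  · exact coordSection_mem U i
  · exact constSection_mem (ι_mem_oddGr _)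

theorem pderivAt_const {U : Opens (ModelBody n 0)} (c : OddCoord q) (i : Fin n)
    {x : ModelBody n 0} (hx : x ∈ U) : pderivAt (U := U) (fun _ => c) i x = 0 := by
  refine oddCoord_ext fun l => ?_
  refine (apply_pderivAt (constModelSection n q U c).2 i l hx).trans ?_
  have h1 := (hasFDerivAt_const (𝕜 := ℝ) (l c) x).congr_of_eventuallyEq
    (extZero_eventuallyEq' (F := fun _ => l c) hx fun _ _ => rfl)
  refine (congrArg (fun L : ModelBody n 0 →L[ℝ] ℂ => L (bodyBasis i)) h1.fderiv).trans ?_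
  simp

theorem pderivAt_coord {U : Opens (ModelBody n 0)} (i j : Fin n) {x : ModelBody n 0}
    (hx : x ∈ U) : pderivAt (coordModelSection q U j).1 i x = if i = j then 1 else 0 := by
  refine oddCoord_ext fun l => ?_
  rw [apply_pderivAt (coordModelSection q U j).2 i l hx]
  let L : ModelBody n 0 →L[ℝ] ℂ := Complex.ofRealCLM ∘L (ContinuousLinearMap.proj j) ∘L
    (ContinuousLinearMap.fst ℝ (Fin n → ℝ) (Fin 0 → ℂ))
  have h1 := (L.hasFDerivAt (x := x).mul_const (l 1)).congr_of_eventuallyEq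
    (extZero_eventuallyEq' (F := fun y => l ((coordModelSection q U j).1 y)) hx fun y hy => by
      change l ((y.1 j : ℂ) • 1) = _
      rw [map_smul]
      rfl)
  rw [h1.fderiv]
  change l 1 * ((bodyBasis i).1 j : ℂ) = _
  by_cases hij : i = j
  · simp [hij, bodyBasis]
  · simp [hij, bodyBasis, Ne.symm hij]

theorem modelField_coordFun (W : Opens (modelSpace n 0 q).carrier) (k l : Fin n ⊕ Fin q) :
    modelField n q k W (coordFun W l) = if k = l then 1 else 0 := by
  obtain i | i := k
  all_goals obtain j | j := l
  · refine Subtype.ext (funext fun x : W => ?_)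
    refine (pderivAt_coord (q := q) (U := W) i j x.2).trans ?_
    by_cases hij : i = j
    · subst hij; simp only [if_true]; rfl
    · rw [if_neg hij, if_neg (by simpa using hij)]; rfl
  · rw [if_neg (by simp)]
    exact Subtype.ext (funext fun x : W => pderivAt_const (U := W)
      (ExteriorAlgebra.ι ℂ (Pi.single j 1) : OddCoord q) i x.2)
  · rw [if_neg (by simp)]
    refine Subtype.ext (funext fun x : W => ?_)
    change CliffordAlgebra.contractLeft _ (((x.1.1 j : ℝ) : ℂ) • 1) = (0 : OddCoord q)
    rw [map_smul, CliffordAlgebra.contractLeft_one, smul_zero]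
  · refine Subtype.ext (funext fun x : W => ?_)
    refine (CliffordAlgebra.contractLeft_ι (Q := (0 : QuadraticForm ℂ (Fin q → ℂ))) _ _).trans ?_
    rw [LinearMap.proj_apply]
    by_cases hij : i = j
    · subst hij
      simp only [if_true, Pi.single_eq_same, map_one]; rfl
    · rw [if_neg (by simpa using hij), Pi.single_eq_of_ne hij, map_zero]; rfl

variable {T : SuperSpace}

/-- The coordinate vector fields along a morphism `f` to the model supermanifold: pullbacks along
`f` of the coordinate vector fields of the model. -/
def coordField (f : Hom T (modelSpace n 0 q)) (k : Fin n ⊕ Fin q) : Vect f :=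
  ⟨opPull (Hom.id _) f (modelField n q k),
    Der_le_Vect f _ (opPull_mem_Der (Hom.id _) f (modelField_mem_Der k))⟩

theorem coordField_mem_Der (f : Hom T (modelSpace n 0 q)) (k : Fin n ⊕ Fin q) :
    (coordField f k : OpAlong f) ∈ Der f (coordParity n q k) :=
  opPull_mem_Der (Hom.id _) f (modelField_mem_Der k)

theorem coordField_coordFun (f : Hom T (modelSpace n 0 q)) (k l : Fin n ⊕ Fin q) :
    (coordField f k).1 ⊤ (coordFun ⊤ l) = if k = l then 1 else 0 := by
  change f.comap ⊤ (modelField n q k ⊤ (coordFun ⊤ l)) = _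
  rw [modelField_coordFun]
  split_ifs <;> simp

theorem Vect_res {M : SuperSpace} {f : Hom T M} (X : Vect f) {W W' : Opens M.carrier} (h : W ≤ W')
    (a : M.O W') : X.1 W (M.res h a) = T.res (preim_mono f.base f.cont h) (X.1 W' a) := by
  obtain ⟨D0, h0, D1, h1, e⟩ := Submodule.mem_sup.mp X.2
  rw [← e]
  simp only [Pi.add_apply, LinearMap.add_apply, map_add, h0.1 W W' h a, h1.1 W W' h a]

variable {V : Type} [AddCommGroup V] [Module ℂ V]

/-- A parity preserving assignment on a homogeneous basis extends to a parity preserving linear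
map. -/
theorem even_of_homBasis [SuperModule V] {ι κ : Type} [Fintype ι] [Fintype κ]
    (b : Module.Basis (ι ⊕ κ) ℂ V) (h0 : ∀ i, b (Sum.inl i) ∈ gr V 0)
    (h1 : ∀ k, b (Sum.inr k) ∈ gr V 1) {F : Type} [AddCommGroup F] [Module ℂ F]
    {Q : ZMod 2 → Submodule ℂ F} {φ : V →ₗ[ℂ] F} (e0 : ∀ i, φ (b (Sum.inl i)) ∈ Q 0)
    (e1 : ∀ k, φ (b (Sum.inr k)) ∈ Q 1) (i : ZMod 2) (v : V) (hv : v ∈ gr V i) : φ v ∈ Q i := by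
  have hs : v = ∑ i, b.repr v (Sum.inl i) • b (Sum.inl i) +
      ∑ k, b.repr v (Sum.inr k) • b (Sum.inr k) := by
    conv_lhs => rw [← b.sum_repr v, Fintype.sum_sum_type]
  set v0 := ∑ i, b.repr v (Sum.inl i) • b (Sum.inl i)
  set v1 := ∑ k, b.repr v (Sum.inr k) • b (Sum.inr k)
  have hv0 : v0 ∈ gr V 0 := Submodule.sum_mem _ fun i _ => Submodule.smul_mem _ _ (h0 i)
  have hv1 : v1 ∈ gr V 1 := Submodule.sum_mem _ fun i _ => Submodule.smul_mem _ _ (h1 i)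
  have hφ0 : φ v0 ∈ Q 0 := by
    rw [map_sum]
    exact Submodule.sum_mem _ fun i _ => by
      rw [map_smul]; exact Submodule.smul_mem _ _ (e0 i)
  have hφ1 : φ v1 ∈ Q 1 := by
    rw [map_sum]
    exact Submodule.sum_mem _ fun i _ => by
      rw [map_smul]; exact Submodule.smul_mem _ _ (e1 i)
  have hd := Submodule.disjoint_def.mp (gr_disjoint (V := V))
  rw [hs] at hv ⊢
  obtain rfl | rfl := parity_cases i
  · rw [hd v1 ((Submodule.add_mem_iff_right _ hv0).mp hv) hv1, add_zero]
    exact hφ0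
  · rw [hd v0 hv0 ((Submodule.add_mem_iff_left _ hv1).mp hv), zero_add]
    exact hφ1

/-- The coordinate frame along a morphism to the model supermanifold, which sends the basis vectors
`b` to the coordinate vector fields. -/
def coordFrame (b : Module.Basis (Fin n ⊕ Fin q) ℂ V) (f : Hom T (modelSpace n 0 q)) :
    V →ₗ[ℂ] Vect f := b.constr ℂ (coordField f)

theorem coordFrame_apply (b : Module.Basis (Fin n ⊕ Fin q) ℂ V) (f : Hom T (modelSpace n 0 q))
    (k : Fin n ⊕ Fin q) : coordFrame b f (b k) = coordField f k := b.constr_basis ℂ _ k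

theorem vectPull_coordFrame (b : Module.Basis (Fin n ⊕ Fin q) ℂ V)
    (f : Hom T (modelSpace n 0 q)) {T' : SuperSpace} (h : Hom T' T) :
    vectPull f h ∘ₗ coordFrame b f = coordFrame b (f.comp h) :=
  b.ext fun k => by
    rw [LinearMap.comp_apply, coordFrame_apply, coordFrame_apply]
    rfl

theorem tensor_eq_sum {A : Type} [Ring A] [Algebra ℂ A] {ι : Type} [Fintype ι]
    (b : Module.Basis ι ℂ V) (x : A ⊗[ℂ] V) : ∃ c : ι → A, x = ∑ k, c k ⊗ₜ b k := by
  refine ⟨fun k => (Algebra.TensorProduct.basis A b).repr x k, ?_⟩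
  conv_lhs => rw [← (Algebra.TensorProduct.basis A b).sum_repr x]
  simp [TensorProduct.smul_tmul']

/-- The coefficients of a vector field in the coordinate frame are its values on the coordinate
functions. -/
theorem frameExt_coordFrame_coordFun (b : Module.Basis (Fin n ⊕ Fin q) ℂ V)
    (f : Hom T (modelSpace n 0 q)) (c : Fin n ⊕ Fin q → T.Γ) (l : Fin n ⊕ Fin q) :
    (frameExt (coordFrame b f) (∑ k, c k ⊗ₜ b k)).1 ⊤ (coordFun ⊤ l) =
      T.res le_top (c l) := by
  rw [map_sum, AddSubmonoidClass.coe_finsetSum, Finset.sum_apply, LinearMap.sum_apply,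
    Finset.sum_eq_single l]
  · rw [frameExt_tmul, coordFrame_apply]
    change T.res le_top (c l) * (coordField f l).1 ⊤ (coordFun ⊤ l) = _
    rw [coordField_coordFun, if_pos rfl, mul_one]
  · intro k _ hk
    rw [frameExt_tmul, coordFrame_apply]
    change T.res le_top (c k) * (coordField f k).1 ⊤ (coordFun ⊤ l) = _
    rw [coordField_coordFun, if_neg hk, mul_zero]
  · simp

/-- The coordinate vector fields form a basis of the vector fields along any morphism `f` to the
model supermanifold. As `f` is arbitrary, the coordinate frame stays a frame under all pullbacks. -/
theorem frameExt_coordFrame_bijective (b : Module.Basis (Fin n ⊕ Fin q) ℂ V)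
    (hT : EvalSpace T) (f : Hom T (modelSpace n 0 q)) :
    Function.Bijective (frameExt (coordFrame b f)) := by
  have hres : Function.Bijective (T.res (le_top : f.pre ⊤ ≤ ⊤)) :=
    res_bijective_of_le _ fun _ _ => trivial
  constructor
  · rw [injective_iff_map_eq_zero]
    intro x hx
    obtain ⟨c, rfl⟩ := tensor_eq_sum b x
    refine Finset.sum_eq_zero fun l _ => ?_
    have := frameExt_coordFrame_coordFun b f c l
    rw [hx] at this
    rw [hres.1 ((map_zero _).trans this).symm, TensorProduct.zero_tmul]
  · intro X
    choose c hc using fun l => hres.2 (X.1 ⊤ (coordFun ⊤ l))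
    refine ⟨∑ k, c k ⊗ₜ b k, ?_⟩
    rw [← sub_eq_zero]
    set Y := frameExt (coordFrame b f) (∑ k, c k ⊗ₜ b k) - X with hY
    have hYl : ∀ l, Y.1 ⊤ (coordFun ⊤ l) = 0 := fun l => by
      change (frameExt (coordFrame b f) (∑ k, c k ⊗ₜ b k)).1 ⊤ (coordFun ⊤ l) -
        X.1 ⊤ (coordFun ⊤ l) = 0
      rw [frameExt_coordFrame_coordFun, hc, sub_self]
    -- `Der_eq_zero` applies to homogeneous derivations only, so the even and the odd part of `Y`
    -- are shown separately to kill the coordinates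
    obtain ⟨D0, h0, D1, h1, e⟩ := Submodule.mem_sup.mp Y.2
    have hl : ∀ l, D0 ⊤ (coordFun ⊤ l) = 0 ∧ D1 ⊤ (coordFun ⊤ l) = 0 := by
      intro l
      have h2 := hYl l
      rw [← e, Pi.add_apply, LinearMap.add_apply] at h2
      have m0 := h0.2.1 ⊤ _ _ (coordFun_mem ⊤ l)
      have m1 := h1.2.1 ⊤ _ _ (coordFun_mem ⊤ l)
      have h3 : D0 ⊤ (coordFun ⊤ l) = -D1 ⊤ (coordFun ⊤ l) := eq_neg_of_add_eq_zero_left h2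
      -- the values of `D0` and `D1` on a coordinate have different parities and add up to zero
      have h4 : D0 ⊤ (coordFun ⊤ l) = 0 := by
        have m0' : D0 ⊤ (coordFun ⊤ l) ∈ gr (T.O (f.pre ⊤)) (1 + coordParity n q l) :=
          h3 ▸ neg_mem m1
        have hd := Submodule.disjoint_def.mp (gr_disjoint (V := T.O (f.pre ⊤)))
        obtain hp | hp := parity_cases (coordParity n q l)
        · rw [hp] at m0 m0'
          exact hd _ m0 m0'
        · rw [hp] at m0 m0'
          exact hd _ m0' m0
      exact ⟨h4, by rwa [h4, zero_add] at h2⟩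
    refine Subtype.ext ?_
    rw [← e, Der_eq_zero f hT h0 fun l => (hl l).1, Der_eq_zero f hT h1 fun l => (hl l).2,
      add_zero]
    rfl

end CoordFrame

/-! ### Vector fields and open immersions -/

section Push

variable {T U M : SuperSpace} (i : Hom U M) (h : Hom T U)

/-- A vector field along `h : T ⟶ U` as a vector field along the composite with `i : U ⟶ M`. -/
def opPush : OpAlong h →ₗ[ℂ] OpAlong (i.comp h) where
  toFun D W := D (i.pre W) ∘ₗ (i.comap W).toLinearMap
  map_add' _ _ := rfl
  map_smul' _ _ := rfl

variable {i h}

theorem opPush_mem_Der {p : ZMod 2} {D : OpAlong h} (hD : D ∈ Der h p) :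
    opPush i h D ∈ Der (i.comp h) p := by
  have hap : ∀ W (b : M.O W), opPush i h D W b = D (i.pre W) (i.comap W b) := fun _ _ => rfl
  refine ⟨fun W W' hW b => ?_, fun W j b hb => ?_, fun W j b hb c => ?_⟩
  · rw [hap, hap, i.comap_res]
    exact hD.1 _ _ _ _
  · exact hD.2.1 _ _ _ (i.comap_gr W hb)
  · rw [hap, hap, hap, map_mul]
    exact hD.2.2 _ _ _ (i.comap_gr W hb) _

variable (i h)

/-- The vector fields along `h` as vector fields along the composite with `i`. -/
def vectPush : Vect h →ₗ[ℂ] Vect (i.comp h) :=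
  (opPush i h).restrict fun _ hD =>
    (Vect_induction (N := (Vect (i.comp h)).comap (opPush i h))
      fun p _ hE => Der_le_Vect _ p (opPush_mem_Der hE)) hD

variable {i h}

/-- The restriction of a vector field along a morphism that factors through an open subspace. -/
def opUnpush (hi : i.IsOpenImmersion) (D : OpAlong (i.comp h)) : OpAlong h := fun V =>
  (T.res (fun _ ht => hi.le_pre_image V ht : h.pre V ≤ (i.comp h).pre (hi.image V))).toLinearMap ∘ₗ
    D (hi.image V) ∘ₗ (hi.equiv V).symm.toLinearMap

theorem opUnpush_mem_Der (hi : i.IsOpenImmersion) {p : ZMod 2} {D : OpAlong (i.comp h)}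
    (hD : D ∈ Der (i.comp h) p) : opUnpush hi D ∈ Der h p := by
  have hap : ∀ V (b : U.O V), opUnpush hi D V b = T.res (fun _ ht => hi.le_pre_image V ht)
    (D (hi.image V) ((hi.equiv V).symm b)) := fun _ _ => rfl
  have hc : ∀ V (b : U.O V), T.res (fun _ ht => hi.le_pre_image V ht : h.pre V ≤ _)
      ((i.comp h).comap (hi.image V) ((hi.equiv V).symm b)) = h.comap V b := fun V b => by
    change T.res _ (h.comap _ (i.comap _ ((hi.equiv V).symm b))) = _
    rw [hi.comap_equiv_symm, h.comap_res, T.res_res, T.res_refl]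
  refine ⟨fun W W' hW b => ?_, fun W j b hb => ?_, fun W j b hb c => ?_⟩
  · rw [hap, hap, hi.equiv_symm_res hW, hD.1 _ _ (hi.image_mono hW), T.res_res, T.res_res]
  · exact T.res_gr _ (hD.2.1 _ _ _ (hi.equiv_symm_gr W hb))
  · rw [hap, hap, hap, map_mul, hD.2.2 _ _ _ (hi.equiv_symm_gr W hb), map_add, map_smul, map_mul,
      map_mul, hc, hc]

theorem opPush_opUnpush (hi : i.IsOpenImmersion) (X : Vect (i.comp h)) :
    opPush i h (opUnpush hi X.1) = X.1 := by
  refine funext fun W => LinearMap.ext fun a => ?_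
  change T.res _ (X.1 _ ((hi.equiv (i.pre W)).symm (i.comap W a))) = _
  rw [hi.equiv_symm_comap, Vect_res X (hi.image_pre_le W)]
  exact (T.res_res _ _ _).trans (T.res_refl _)

theorem opUnpush_opPush (hi : i.IsOpenImmersion) (X : Vect h) :
    opUnpush hi (opPush i h X.1) = X.1 := by
  refine funext fun V => LinearMap.ext fun b => ?_
  change T.res _ (X.1 (i.pre (hi.image V)) (i.comap _ ((hi.equiv V).symm b))) = _
  rw [hi.comap_equiv_symm, Vect_res X (hi.pre_image_le V)]
  exact (T.res_res _ _ _).trans (T.res_refl _)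

theorem vectPush_bijective (hi : i.IsOpenImmersion) : Function.Bijective (vectPush i h) := by
  constructor
  · intro X Y hXY
    refine Subtype.ext ?_
    rw [← opUnpush_opPush hi X, ← opUnpush_opPush hi Y]
    exact congrArg (fun Z : Vect (i.comp h) => opUnpush hi Z.1) hXY
  · intro X
    have : opUnpush hi X.1 ∈ Vect h := by
      obtain ⟨D0, h0, D1, h1, e⟩ := Submodule.mem_sup.mp X.2
      have : opUnpush hi X.1 = opUnpush hi D0 + opUnpush hi D1 := by
        refine funext fun V => LinearMap.ext fun b => ?_
        rw [← e]
        exact map_add (T.res _) _ _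
      rw [this]
      exact add_mem (Der_le_Vect _ _ (opUnpush_mem_Der hi h0))
        (Der_le_Vect _ _ (opUnpush_mem_Der hi h1))
    exact ⟨⟨_, this⟩, Subtype.ext (opPush_opUnpush hi X)⟩

theorem mem_Der_of_vectPush (hi : i.IsOpenImmersion) {p : ZMod 2} {X : Vect h}
    (hX : (vectPush i h X : OpAlong (i.comp h)) ∈ Der (i.comp h) p) : (X : OpAlong h) ∈ Der h p := by
  rw [← opUnpush_opPush hi X]
  exact opUnpush_mem_Der hi hX

theorem vectPush_mem_Der {p : ZMod 2} {X : Vect h} (hX : (X : OpAlong h) ∈ Der h p) :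
    (vectPush i h X : OpAlong (i.comp h)) ∈ Der (i.comp h) p := opPush_mem_Der hX

variable {V : Type} [AddCommGroup V] [Module ℂ V]

theorem frameExt_vectPush (φ : V →ₗ[ℂ] Vect h) (x : T.Γ ⊗[ℂ] V) :
    frameExt (vectPush i h ∘ₗ φ) x = vectPush i h (frameExt φ x) := by
  induction x using TensorProduct.induction_on with
  | zero => simp
  | tmul a v => rfl
  | add x y hx hy => rw [map_add, map_add, hx, hy, map_add]

theorem frameExt_vectPush_bijective (hi : i.IsOpenImmersion) (φ : V →ₗ[ℂ] Vect h) :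
    Function.Bijective (frameExt (vectPush i h ∘ₗ φ)) ↔ Function.Bijective (frameExt φ) := by
  rw [show ⇑(frameExt (vectPush i h ∘ₗ φ)) = vectPush i h ∘ frameExt φ from
    funext (frameExt_vectPush φ)]
  exact Function.Bijective.of_comp_iff' (vectPush_bijective hi) _

end Push

/-! ### Frames and their pullbacks -/

section Frames

variable {V : Type} [AddCommGroup V] [Module ℂ V]

section Coefficients

variable {A B : Type} [Ring A] [Algebra ℂ A] [Ring B] [Algebra ℂ B] {ι : Type}

/-- The coefficients of an element of `A ⊗ V` in a basis of `V` change by `ρ` under base change. -/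
theorem repr_baseMap (b : Module.Basis ι ℂ V) (ρ : A →ₐ[ℂ] B) (x : A ⊗[ℂ] V) (k : ι) :
    (Algebra.TensorProduct.basis B b).repr (baseMap V ρ x) k =
      ρ ((Algebra.TensorProduct.basis A b).repr x k) := by
  induction x using TensorProduct.induction_on with
  | zero => simp
  | tmul a v => simp [baseMap_tmul, Algebra.TensorProduct.basis_repr_tmul]
  | add x y hx hy => simp only [map_add, Finsupp.add_apply, hx, hy]

end Coefficients

variable {M T T' U : SuperSpace}

theorem vect_eq_of_locally {f : Hom T M} {X Y : Vect f}
    (h : ∀ t, ∃ (R : SuperSpace) (k : Hom R T), k.IsOpenImmersion ∧ t ∈ Set.range k.base ∧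
      vectPull f k X = vectPull f k Y) : X = Y := by
  refine Subtype.ext (funext fun W => LinearMap.ext fun a => eq_of_comap_eq fun t _ => ?_)
  obtain ⟨R, k, hk, ht, e⟩ := h t
  exact ⟨R, k, hk, ht, congrArg (fun Z : Vect (f.comp k) => Z.1 W a) e⟩

theorem vectPull_mem_Der {f : Hom T M} (k : Hom T' T) {p : ZMod 2} {X : Vect f}
    (hX : (X : OpAlong f) ∈ Der f p) : (vectPull f k X : OpAlong (f.comp k)) ∈ Der (f.comp k) p :=
  opPull_mem_Der f k hX

/-- The parity of a vector field can be checked locally: its component of the other parity vanishes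
locally, hence globally. -/
theorem mem_Der_of_locally {f : Hom T M} {X : Vect f} {p : ZMod 2}
    (h : ∀ t, ∃ (R : SuperSpace) (k : Hom R T), k.IsOpenImmersion ∧ t ∈ Set.range k.base ∧
      (vectPull f k X : OpAlong (f.comp k)) ∈ Der (f.comp k) p) : (X : OpAlong f) ∈ Der f p := by
  obtain ⟨D0, h0, D1, h1, e⟩ := Submodule.mem_sup.mp X.2
  let X0 : Vect f := ⟨D0, Der_le_Vect f 0 h0⟩
  let X1 : Vect f := ⟨D1, Der_le_Vect f 1 h1⟩
  have hX : X = X0 + X1 := Subtype.ext e.symm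
  have hd := fun (R : SuperSpace) (k : Hom R T) =>
    Submodule.disjoint_def.mp (Der_disjoint (f.comp k))
  have m0 : ∀ (R : SuperSpace) (k : Hom R T),
    (vectPull f k X0 : OpAlong (f.comp k)) ∈ Der (f.comp k) 0 := fun R k => vectPull_mem_Der k h0
  have m1 : ∀ (R : SuperSpace) (k : Hom R T),
    (vectPull f k X1 : OpAlong (f.comp k)) ∈ Der (f.comp k) 1 := fun R k => vectPull_mem_Der k h1
  obtain rfl | rfl := parity_cases p
  · have : X1 = 0 := vect_eq_of_locally fun t => by
      obtain ⟨R, k, hk, ht, hm⟩ := h t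
      refine ⟨R, k, hk, ht, ?_⟩
      rw [hX, map_add] at hm
      rw [map_zero]
      exact Subtype.ext (hd R k _ ((Submodule.add_mem_iff_right _ (m0 R k)).mp hm) (m1 R k))
    rw [hX, this, add_zero]
    exact h0
  · have : X0 = 0 := vect_eq_of_locally fun t => by
      obtain ⟨R, k, hk, ht, hm⟩ := h t
      refine ⟨R, k, hk, ht, ?_⟩
      rw [hX, map_add] at hm
      rw [map_zero]
      exact Subtype.ext (hd R k _ (m0 R k) ((Submodule.add_mem_iff_left _ (m1 R k)).mp hm))
    rw [hX, this, zero_add]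
    exact h1

/-- Being a basis of the vector fields along `f` is a local property: if it holds over all open
subspaces of the members of an open cover, the coefficients of a vector field glue. -/
theorem frameExt_bijective_of_locally [FiniteDimensional ℂ V] {f : Hom T M} (φ : V →ₗ[ℂ] Vect f)
    (h : ∀ t, ∃ (R : SuperSpace) (k : Hom R T), k.IsOpenImmersion ∧ t ∈ Set.range k.base ∧
      ∀ (R' : SuperSpace) (k' : Hom R' R), k'.IsOpenImmersion →
        Function.Bijective (frameExt (vectPull f (k.comp k') ∘ₗ φ))) :
    Function.Bijective (frameExt φ) := by
  choose R k hk hr hb using h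
  let b := Module.finBasis ℂ V
  have hb' : ∀ t, Function.Bijective (frameExt (vectPull f (k t) ∘ₗ φ)) := fun t =>
    hb t (R t) (Hom.id _) (Hom.isOpenImmersion_id _)
  have hcov : ∀ t, ∃ s, t ∈ Set.range (k s).base := fun t => ⟨t, hr t⟩
  have hinj : Function.Injective (frameExt φ) := by
    rw [injective_iff_map_eq_zero]
    intro x hx
    refine (Algebra.TensorProduct.basis T.Γ b).ext_elem fun l => ?_
    refine eq_of_onΓ_eq fun t => ⟨R t, k t, hk t, hr t, ?_⟩
    have : baseMap V (k t).onΓ x = 0 := (hb' t).1 <| by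
      rw [← vectPull_frameExt, hx, map_zero, map_zero]
    rw [← repr_baseMap, this]
    simp
  refine ⟨hinj, fun X => ?_⟩
  choose x hx using fun t => (hb' t).2 (vectPull f (k t) X)
  have key : ∀ s t (Q : SuperSpace) (a : Hom Q (R s)) (a' : Hom Q (R t)),
      ((k s).comp a).IsOpenImmersion → (k s).comp a = (k t).comp a' →
      baseMap V a.onΓ (x s) = baseMap V a'.onΓ (x t) := by
    intro s t Q a a' ha e
    have h1 : ∀ s (a : Hom Q (R s)) (c : Hom Q T), (k s).comp a = c →
        frameExt (vectPull f c ∘ₗ φ) (baseMap V a.onΓ (x s)) = vectPull f c X := by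
      rintro s a _ rfl
      refine (vectPull_frameExt (vectPull f (k s) ∘ₗ φ) a (x s)).symm.trans ?_
      rw [hx]
      rfl
    refine (hb s Q a ((hk s).of_comp ha)).1 ?_
    rw [h1 s a _ rfl, h1 t a' _ e.symm]
  choose c hc using fun l => exists_glueΓ R k hk hcov
    (fun t => (Algebra.TensorProduct.basis (R t).Γ b).repr (x t) l)
    (fun s t Q a a' ha e => by rw [← repr_baseMap, ← repr_baseMap, key s t Q a a' ha e])
  refine ⟨∑ l, c l ⊗ₜ b l, vect_eq_of_locally fun t => ⟨R t, k t, hk t, hr t, ?_⟩⟩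
  rw [vectPull_frameExt, ← hx]
  refine congrArg _ ((Algebra.TensorProduct.basis (R t).Γ b).ext_elem fun l => ?_)
  rw [repr_baseMap, ← hc]
  congr 1
  simp [Algebra.TensorProduct.basis_repr_tmul, Finsupp.single_apply]

/-- A frame of `f^*TM` whose pullbacks along all morphisms `h : T' ⟶ T`, and not just along the
open immersions, are frames. The condition `EvalSpace T'` holds for mixed supermanifolds and for
their open subspaces; it is what makes derivations along morphisms from `T'` determined by their
values on coordinates. -/
structure IsStableFrame [SuperModule V] (f : Hom T M) (φ : V →ₗ[ℂ] Vect f) : Prop where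
  even : ∀ (i : ZMod 2), ∀ v ∈ gr V i, (φ v : OpAlong f) ∈ Der f i
  bijective : ∀ (T' : SuperSpace) (h : Hom T' T), EvalSpace T' →
    Function.Bijective (frameExt (vectPull f h ∘ₗ φ))

variable [SuperModule V]

theorem onΓ_even (h : Hom T' T) : ∀ i, ∀ a ∈ gr T.Γ i, h.onΓ a ∈ gr T'.Γ i :=
  fun _ _ ha => h.onΓ_gr ha

namespace IsStableFrame

variable {f : Hom T M} {φ : V →ₗ[ℂ] Vect f}

theorem isFrame (hT : EvalSpace T) (hφ : IsStableFrame f φ) : IsFrame f φ :=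
  ⟨hφ.even, fun R k hk => hφ.bijective R k (EvalSpace.of_isOpenImmersion hk hT)⟩

theorem pull (hφ : IsStableFrame f φ) (h : Hom T' T) :
    IsStableFrame (f.comp h) (vectPull f h ∘ₗ φ) :=
  ⟨fun i v hv => vectPull_mem_Der h (hφ.even i v hv), fun R k hR => hφ.bijective R (h.comp k) hR⟩

theorem act (hφ : IsStableFrame f φ) {g : V →ₗ[ℂ] T.Γ ⊗[ℂ] V} (hg : g ∈ GLFunctor V T.Γ) :
    IsStableFrame f (frameAct φ g) := by
  refine ⟨fun i v hv => frameExt_mem_Der hφ.even (hg.1 i v hv), fun R k hR => ?_⟩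
  rw [vectPull_frameAct, show ⇑(frameExt (frameAct (vectPull f k ∘ₗ φ) (baseMap V k.onΓ ∘ₗ g))) =
    frameExt (vectPull f k ∘ₗ φ) ∘ glExt (baseMap V k.onΓ ∘ₗ g) from
      funext (frameExt_frameAct _ _)]
  exact (hφ.bijective R k hR).comp (GLFunctor_baseMap (onΓ_even k) hg).2

theorem push {i : Hom U M} {h : Hom T U} {φ : V →ₗ[ℂ] Vect h} (hi : i.IsOpenImmersion)
    (hφ : IsStableFrame h φ) : IsStableFrame (i.comp h) (vectPush i h ∘ₗ φ) :=
  ⟨fun p v hv => vectPush_mem_Der (hφ.even p v hv), fun R k hR =>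
    (frameExt_vectPush_bijective (h := h.comp k) hi (vectPull h k ∘ₗ φ)).mpr (hφ.bijective R k hR)⟩

theorem unpush {i : Hom U M} {h : Hom T U} {φ : V →ₗ[ℂ] Vect h} (hi : i.IsOpenImmersion)
    (hφ : IsStableFrame (i.comp h) (vectPush i h ∘ₗ φ)) : IsStableFrame h φ :=
  ⟨fun p v hv => mem_Der_of_vectPush hi (hφ.even p v hv), fun R k hR =>
    (frameExt_vectPush_bijective (h := h.comp k) hi (vectPull h k ∘ₗ φ)).mp (hφ.bijective R k hR)⟩

theorem of_locally [FiniteDimensional ℂ V]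
    (h : ∀ t, ∃ (R : SuperSpace) (k : Hom R T), k.IsOpenImmersion ∧ t ∈ Set.range k.base ∧
      IsStableFrame (f.comp k) (vectPull f k ∘ₗ φ)) : IsStableFrame f φ := by
  refine ⟨fun p v hv => mem_Der_of_locally fun t => ?_, fun T' a hT' => ?_⟩
  · obtain ⟨R, k, hk, ht, hs⟩ := h t
    exact ⟨R, k, hk, ht, hs.even p v hv⟩
  · refine frameExt_bijective_of_locally _ fun t => ?_
    obtain ⟨R, k, hk, ht, hs⟩ := h (a.base t)
    let N : Opens T'.carrier := a.pre (hk.image ⊤)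
    have hN : ∀ x, ∃ u, k.base u = (a.comp (T'.incl N)).base x := by
      rintro ⟨x, u, -, hu⟩
      exact ⟨u, hu⟩
    refine ⟨T'.restrict N, T'.incl N, isOpenImmersion_incl _ _, ?_, fun R' k' hk' => ?_⟩
    · rw [range_incl]
      obtain ⟨u, hu⟩ := ht
      exact ⟨u, trivial, hu⟩
    · have h1 : ∀ l : Hom (T'.restrict N) R,
          Function.Bijective (frameExt (vectPull f ((k.comp l).comp k') ∘ₗ φ)) := fun l =>
        hs.bijective R' (l.comp k') (EvalSpace.of_isOpenImmersion
          ((isOpenImmersion_incl T' N).comp hk') hT')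
      -- `c` is generalized because vector fields along propositionally equal morphisms have
      -- different types
      have h2 : ∀ c : Hom (T'.restrict N) T, k.comp (hk.lift _ hN) = c →
          Function.Bijective (frameExt (vectPull f (c.comp k') ∘ₗ φ)) := by
        rintro _ rfl
        exact h1 _
      have h3 := h2 _ (hk.comp_lift _ hN)
      change Function.Bijective (frameExt (f := f.comp ((a.comp (T'.incl N)).comp k'))
        (vectPull f ((a.comp (T'.incl N)).comp k') ∘ₗ φ))
      exact h3

end IsStableFrame

/-- Two frames differ by an element of `GL(V)`, whose columns are the coefficients of the second
frame in the first. -/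
theorem exists_frameAct_eq {f : Hom T M} {φ ψ : V →ₗ[ℂ] Vect f}
    (hφe : ∀ i, ∀ v ∈ gr V i, (φ v : OpAlong f) ∈ Der f i)
    (hψe : ∀ i, ∀ v ∈ gr V i, (ψ v : OpAlong f) ∈ Der f i)
    (hφ : Function.Bijective (frameExt φ)) (hψ : Function.Bijective (frameExt ψ)) :
    ∃ g ∈ GLFunctor V T.Γ, ψ = frameAct φ g := by
  let e := LinearEquiv.ofBijective (frameExt φ) hφ
  let g : V →ₗ[ℂ] T.Γ ⊗[ℂ] V := e.symm.toLinearMap ∘ₗ ψ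
  have hg : ψ = frameAct φ g := LinearMap.ext fun v => (e.apply_symm_apply (ψ v)).symm
  refine ⟨g, ⟨fun i v hv => mem_tensorGr_of_frameExt hφe hφ.1 ?_, ?_⟩, hg⟩
  · have : frameExt φ (g v) = ψ v := e.apply_symm_apply (ψ v)
    rw [this]
    exact hψe i v hv
  · rw [hg, show ⇑(frameExt (frameAct φ g)) = frameExt φ ∘ glExt g from
      funext (frameExt_frameAct _ _)] at hψ
    exact (Function.Bijective.of_comp_iff' hφ _).mp hψ

variable [FiniteDimensional ℂ V]

variable (V) in
theorem exists_homBasis :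
    ∃ b : Module.Basis (Fin (Module.finrank ℂ (gr V 0)) ⊕ Fin (Module.finrank ℂ (gr V 1))) ℂ V,
      (∀ i, b (Sum.inl i) ∈ gr V 0) ∧ ∀ k, b (Sum.inr k) ∈ gr V 1 := by
  let b0 := Module.finBasis ℂ (gr V 0)
  let b1 := Module.finBasis ℂ (gr V 1)
  refine ⟨(b0.prod b1).map (Submodule.prodEquivOfIsCompl _ _ SuperModule.isCompl),
    fun i => ?_, fun i => ?_⟩
  · simp
  · simp

/-- Products of many odd functions vanish on the open subspaces of a model space. -/
theorem odd_pow_eq_bot {n m q : ℕ} {j : Hom T (modelSpace n m q)} (hj : j.IsOpenImmersion) :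
    (gr T.Γ 1) ^ (q + 1) = ⊥ := by
  rw [eq_bot_iff]
  intro a ha
  let F : T.Γ →ₐ[ℂ] (modelSpace n m q).O (hj.image ⊤) := (hj.equiv ⊤).symm.toAlgHom
  have hF : Function.Injective F := (hj.equiv ⊤).symm.injective
  refine (Submodule.mem_bot ℂ).mpr (hF ((Subtype.ext (funext fun x => ?_)).trans
    (map_zero F).symm))
  let ev : (modelSpace n m q).O (hj.image ⊤) →ₐ[ℂ] OddCoord q :=
    (Pi.evalAlgHom ℂ (fun _ : hj.image ⊤ => OddCoord q) x).comp (modelSections n m q _).val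
  let G : T.Γ →ₐ[ℂ] OddCoord q := ev.comp F
  have h1 : Submodule.map G.toLinearMap (gr T.Γ 1) ≤ LinearMap.ker (oddBody q).toLinearMap := by
    rintro _ ⟨c, hc, rfl⟩
    exact (modelEval n m q x.1).val_odd (U := hj.image ⊤) (a := F c) x.2 (hj.equiv_symm_gr ⊤ hc)
  have h2 : G a ∈ Submodule.map G.toLinearMap ((gr T.Γ 1) ^ (q + 1)) := ⟨a, ha, rfl⟩
  rw [Submodule.map_pow] at h2
  have h3 := pow_le_pow_left' h1 (q + 1) h2
  rw [ker_oddBody_pow] at h3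
  exact h3

/-- Near every point a supermanifold which is modelled on `V` has a frame, given by coordinate
vector fields; the coordinate functions are dual to it. -/
theorem exists_chartFrame {x : M.carrier}
    (h : HasChartAt M x (Module.finrank ℂ (gr V 0)) 0 (Module.finrank ℂ (gr V 1))) :
    ∃ (C : MixedSupermanifold) (c : Hom C.toSuperSpace M) (s : V →ₗ[ℂ] Vect c),
      c.IsOpenImmersion ∧ x ∈ Set.range c.base ∧ IsStableFrame c s ∧
      (∃ (ι : Type) (_ : Fintype ι) (_ : DecidableEq ι) (b : Module.Basis ι ℂ V)
        (W : Opens M.carrier) (y : ι → M.O W), (∀ t, c.base t ∈ W) ∧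
        ∀ k l, (s (b k)).1 W (y l) = if k = l then 1 else 0) ∧
      ∃ K, ∀ (R : SuperSpace) (k : Hom R C.toSuperSpace), k.IsOpenImmersion →
        (gr R.Γ 1) ^ K = ⊥ := by
  obtain ⟨C, c, j, hc, hj, hx⟩ := h
  obtain ⟨b, hb0, hb1⟩ := exists_homBasis V
  -- vector fields along `Hom.id C` are identified with vector fields along the chart `j`, where the
  -- coordinate frame is available
  let jj := j.comp (Hom.id C)
  have hpb := vectPush_bijective (h := Hom.id C) hj
  let e : Vect (Hom.id C) ≃ₗ[ℂ] Vect jj := LinearEquiv.ofBijective (vectPush j (Hom.id C)) hpb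
  let s0 : V →ₗ[ℂ] Vect (Hom.id C) := e.symm.toLinearMap ∘ₗ coordFrame b jj
  have hs0 : vectPush j (Hom.id C) ∘ₗ s0 = coordFrame b jj :=
    LinearMap.ext fun v => e.apply_symm_apply _
  have hst : IsStableFrame (Hom.id C) s0 := by
    refine IsStableFrame.unpush hj ?_
    rw [hs0]
    refine ⟨fun i v hv => ?_, fun T' h hT' => ?_⟩
    · refine even_of_homBasis (F := OpAlong jj) b hb0 hb1 (φ := (Vect jj).subtype ∘ₗ coordFrame b jj)
        (Q := fun i => Der jj i) (fun i => ?_) (fun k => ?_) i v hv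
      · rw [LinearMap.comp_apply, coordFrame_apply]
        exact coordField_mem_Der jj (Sum.inl i)
      · rw [LinearMap.comp_apply, coordFrame_apply]
        exact coordField_mem_Der jj (Sum.inr k)
    · rw [vectPull_coordFrame]
      exact frameExt_coordFrame_bijective b hT' _
  refine ⟨MixedSupermanifold.ofModel hj, c.comp (Hom.id C), vectPush c (Hom.id C) ∘ₗ s0,
    hc, hx, hst.push hc, ⟨_, inferInstance, inferInstance, b, hc.image ⊤,
      fun l => (hc.equiv ⊤).symm (j.onΓ (coordFun ⊤ l)), fun t => ⟨t, trivial, rfl⟩,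
      fun k l => ?_⟩, _, fun R k hk => odd_pow_eq_bot (hj.comp hk)⟩
  change (s0 (b k)).1 (c.pre (hc.image ⊤)) (c.comap _ ((hc.equiv ⊤).symm (j.onΓ _))) = _
  have h1 : (s0 (b k)).1 (j.pre ⊤) (j.comap ⊤ (coordFun ⊤ l)) = if k = l then 1 else 0 := by
    have h2 := coordField_coordFun jj k l
    rw [← coordFrame_apply b, ← hs0] at h2
    exact h2
  have h3 : (s0 (b k)).1 ⊤ (j.onΓ (coordFun ⊤ l)) = if k = l then 1 else 0 := by
    refine (Vect_res (s0 (b k)) (fun _ _ => trivial : ⊤ ≤ j.pre ⊤) _).trans ?_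
    refine (congrArg _ h1).trans ?_
    split_ifs
    · exact map_one _
    · exact map_zero _
  rw [hc.comap_equiv_symm, Vect_res]
  refine (congrArg _ h3).trans ?_
  split_ifs
  · exact map_one _
  · exact map_zero _

theorem HasChartAt.of_isOpenImmersion {X Y : SuperSpace} {i : Hom Y X} (hi : i.IsOpenImmersion)
    {y : Y.carrier} {n m q : ℕ} (h : HasChartAt X (i.base y) n m q) : HasChartAt Y y n m q := by
  obtain ⟨C, c, j, hc, hj, u, hu⟩ := h
  let N : Opens C.carrier := c.pre (hi.image ⊤)
  have hN : ∀ x, ∃ u, i.base u = (c.comp (C.incl N)).base x := by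
    rintro ⟨x, u, -, hu⟩
    exact ⟨u, hu⟩
  have hl := hi.comp_lift _ hN
  have hu' : u ∈ N := ⟨y, trivial, hu.symm⟩
  refine ⟨C.restrict N, hi.lift _ hN, j.comp (C.incl N), ?_, hj.comp (isOpenImmersion_incl _ _),
    ⟨u, hu'⟩, ?_⟩
  · refine hi.of_comp ?_
    rw [hl]
    exact hc.comp (isOpenImmersion_incl _ _)
  · refine hi.isOpenEmbedding.injective ?_
    have := congrArg (fun f : Hom (C.restrict N) X => f.base ⟨u, hu'⟩) hl
    exact this.trans hu

/-- A frame of `TM` over an open subspace pulls back to frames along all morphisms: locally it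
differs from a coordinate frame by an element of `GL(V)`. -/
theorem IsFrame.isStableFrame {M : MixedSupermanifold} (hM : M.IsModelledOn V)
    {i : Hom U M.toSuperSpace} (hi : i.IsOpenImmersion) {s : V →ₗ[ℂ] Vect i} (hs : IsFrame i s) :
    IsStableFrame i s := by
  refine IsStableFrame.of_locally fun u => ?_
  obtain ⟨C, c, s0, hc, hu, hs0, -, -⟩ := exists_chartFrame ((hM (i.base u)).of_isOpenImmersion hi)
  have h1 := hs0.push hi
  have h2 := hs.bijective C.toSuperSpace c hc
  obtain ⟨g, hg, e⟩ := exists_frameAct_eq h1.even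
    (fun p v hv => vectPull_mem_Der c (hs.even p v hv))
    (h1.isFrame C.evalSpace |>.bijective _ (Hom.id _) (Hom.isOpenImmersion_id _)) h2
  refine ⟨C.toSuperSpace, c, hc, hu, ?_⟩
  rw [e]
  exact h1.act hg

end Frames

/-! ### Normal forms of odd metrics -/

section NormalForm

open Polynomial in
/-- The inverse square root of `1 + X` modulo `X ^ K`, by Newton's iteration. -/
theorem exists_invSqrt (K : ℕ) : ∃ p : ℂ[X], X ^ K ∣ p ^ 2 * (1 + X) - 1 := by
  suffices h : ∀ k : ℕ, ∃ p : ℂ[X], X ^ 2 ^ k ∣ p ^ 2 * (1 + X) - 1 by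
    obtain ⟨p, hp⟩ := h K
    exact ⟨p, (pow_dvd_pow X Nat.lt_two_pow_self.le).trans hp⟩
  intro k
  induction k with
  | zero => exact ⟨1, by simp⟩
  | succ k ih =>
    obtain ⟨p, hp⟩ := ih
    obtain ⟨u, hu⟩ : ∃ u, u = p ^ 2 * (1 + X) - 1 := ⟨_, rfl⟩
    rw [← hu] at hp
    have hC : (C (1 / 2 : ℂ)) * 2 = 1 := by
      rw [← C_ofNat, ← C_mul]
      norm_num
    -- the Newton step, with `u` the error of `p`: the new error is divisible by `u ^ 2`
    refine ⟨p * (1 - C (1 / 2) * u), ?_⟩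
    have : (p * (1 - C (1 / 2) * u)) ^ 2 * (1 + X) - 1 =
        u ^ 2 * (C (1 / 2) ^ 2 * (u - 3)) := by
      have h1 : p ^ 2 * (1 + X) = 1 + u := by rw [hu]; ring
      have h2 : (p * (1 - C (1 / 2) * u)) ^ 2 * (1 + X) - 1 =
          (p ^ 2 * (1 + X)) * (1 - C (1 / 2) * u) ^ 2 - 1 := by ring
      rw [h2, h1]
      linear_combination (-(1 + u) * u + u ^ 2 * (2 * C (1 / 2) + 1)) * hC
    rw [this, pow_succ, pow_mul]
    exact (pow_dvd_pow_of_dvd hp 2).mul_right _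

section Change

variable {V : Type} [AddCommGroup V] [Module ℂ V] {A : Type} [Ring A] [Algebra ℂ A]

section

variable {n : ℕ} (b : Module.Basis (Fin n ⊕ Fin n) ℂ V)

/-- The change of basis that applies the matrix `D` to the first half of the basis `b`. -/
def changeHalf (D : Matrix (Fin n) (Fin n) A) : V →ₗ[ℂ] A ⊗[ℂ] V := b.constr ℂ
  (Sum.elim (fun i => ∑ k, D i k ⊗ₜ b (Sum.inl k)) fun j => 1 ⊗ₜ b (Sum.inr j))

theorem changeHalf_inl (D : Matrix (Fin n) (Fin n) A) (i : Fin n) :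
    changeHalf b D (b (Sum.inl i)) = ∑ k, D i k ⊗ₜ b (Sum.inl k) := b.constr_basis ℂ _ _

theorem changeHalf_inr (D : Matrix (Fin n) (Fin n) A) (i : Fin n) :
    changeHalf b D (b (Sum.inr i)) = 1 ⊗ₜ b (Sum.inr i) := b.constr_basis ℂ _ _

theorem changeHalf_changeHalf {C D : Matrix (Fin n) (Fin n) A} (hCD : C * D = 1) (v : V) :
    glExt (changeHalf b D) (changeHalf b C v) = 1 ⊗ₜ v := by
  refine congrArg (fun L : V →ₗ[ℂ] A ⊗[ℂ] V => L v) (b.ext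
    (f₁ := glExt (changeHalf b D) ∘ₗ changeHalf b C) (f₂ := TensorProduct.mk ℂ A V 1) fun k => ?_)
  rw [LinearMap.comp_apply, TensorProduct.mk_apply]
  obtain i | i := k
  · rw [changeHalf_inl, map_sum]
    simp only [glExt_tmul, changeHalf_inl, Finset.smul_sum, TensorProduct.smul_tmul', smul_eq_mul]
    rw [Finset.sum_comm]
    simp only [← TensorProduct.sum_tmul, ← Matrix.mul_apply, hCD]
    rw [Finset.sum_eq_single i, Matrix.one_apply_eq]
    · intro k _ hk
      rw [Matrix.one_apply_ne hk.symm, TensorProduct.zero_tmul]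
    · simp
  · rw [changeHalf_inr, glExt_one_tmul, changeHalf_inr]

/-- The map which exchanges the two halves of the basis `b`, with matrices `-S` and `-R`. The signs
are those that odd coefficients acquire in `oddExt`, see `oddExt_odd_tmul`. -/
def exchangeHalves (S R : Matrix (Fin n) (Fin n) A) : V →ₗ[ℂ] A ⊗[ℂ] V := b.constr ℂ
  (Sum.elim (fun i => -∑ k, S i k ⊗ₜ b (Sum.inr k)) fun i => -∑ k, R i k ⊗ₜ b (Sum.inl k))

theorem exchangeHalves_inl (S R : Matrix (Fin n) (Fin n) A) (i : Fin n) :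
    exchangeHalves b S R (b (Sum.inl i)) = -∑ k, S i k ⊗ₜ b (Sum.inr k) := b.constr_basis ℂ _ _

theorem exchangeHalves_inr (S R : Matrix (Fin n) (Fin n) A) (i : Fin n) :
    exchangeHalves b S R (b (Sum.inr i)) = -∑ k, R i k ⊗ₜ b (Sum.inl k) := b.constr_basis ℂ _ _

end

variable [SuperAlgebra A]

theorem exchangeHalves_mem {n : ℕ} (b : Module.Basis (Fin n ⊕ Fin n) ℂ V)
    {S R : Matrix (Fin n) (Fin n) A} (hS : ∀ i j, S i j ∈ gr A 1)
    (hR : ∀ i j, R i j ∈ gr A 1) (v : V) :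
    exchangeHalves b S R v ∈ Submodule.map₂ (TensorProduct.mk ℂ A V) (gr A 1) ⊤ := by
  have : ⊤ ≤ (Submodule.map₂ (TensorProduct.mk ℂ A V) (gr A 1) ⊤).comap
      (exchangeHalves b S R) := by
    refine b.span_eq.ge.trans (Submodule.span_le.mpr ?_)
    rintro _ ⟨i | i, rfl⟩
    · change exchangeHalves b S R _ ∈ Submodule.map₂ (TensorProduct.mk ℂ A V) (gr A 1) ⊤
      rw [exchangeHalves_inl]
      exact neg_mem (Submodule.sum_mem _ fun k _ =>
        Submodule.apply_mem_map₂ _ (hS i k) Submodule.mem_top)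
    · change exchangeHalves b S R _ ∈ Submodule.map₂ (TensorProduct.mk ℂ A V) (gr A 1) ⊤
      rw [exchangeHalves_inr]
      exact neg_mem (Submodule.sum_mem _ fun k _ =>
        Submodule.apply_mem_map₂ _ (hR i k) Submodule.mem_top)
  exact this Submodule.mem_top

/-- An `A`-linear endomorphism of `A ⊗ V` with odd coefficients is nilpotent if the product of any
`K` odd elements of `A` vanishes. -/
theorem glExt_pow_eq_zero {N : V →ₗ[ℂ] A ⊗[ℂ] V}
    (hN : ∀ v, N v ∈ Submodule.map₂ (TensorProduct.mk ℂ A V) (gr A 1) ⊤) {K : ℕ}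
    (hK : (gr A 1) ^ K = ⊥) : (glExt N : Module.End ℂ (A ⊗[ℂ] V)) ^ K = 0 := by
  let P : ℕ → Submodule ℂ (A ⊗[ℂ] V) := fun k =>
    Submodule.map₂ (TensorProduct.mk ℂ A V) (⊤ * (gr A 1) ^ k) ⊤
  have hstep : ∀ k, P k ≤ (P (k + 1)).comap (glExt N) := by
    intro k
    refine Submodule.map₂_le.mpr fun a ha v _ => ?_
    have h1 : Submodule.map₂ (TensorProduct.mk ℂ A V) (gr A 1) ⊤ ≤
        (P (k + 1)).comap (Algebra.lsmul ℂ ℂ (A ⊗[ℂ] V) a) := by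
      refine Submodule.map₂_le.mpr fun c hc w _ => ?_
      change a • (c ⊗ₜ[ℂ] w) ∈ P (k + 1)
      rw [TensorProduct.smul_tmul', smul_eq_mul]
      refine Submodule.apply_mem_map₂ _ ?_ trivial
      rw [pow_succ, ← mul_assoc]
      exact Submodule.mul_mem_mul ha hc
    exact h1 (hN v)
  have hP : ∀ (k : ℕ) (x : A ⊗[ℂ] V), ((glExt N : Module.End ℂ (A ⊗[ℂ] V)) ^ k) x ∈ P k := by
    intro k
    induction k with
    | zero =>
      intro x
      have : P 0 = ⊤ := by
        simp only [P, pow_zero, mul_one]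
        exact TensorProduct.map₂_mk_top_top_eq_top ℂ A V
      rw [this]
      trivial
    | succ k ih =>
      intro x
      rw [pow_succ']
      exact hstep k (ih x)
  refine LinearMap.ext fun x => ?_
  have := hP K x
  simp only [P, hK, Submodule.mul_bot, Submodule.map₂_bot_left] at this
  exact this

end Change

variable {V : Type} [AddCommGroup V] [Module ℂ V] [SuperModule V]

section Dual

variable [FiniteDimensional ℂ V] {J : V →ₗ[ℂ] V →ₗ[ℂ] ℂ}

/-- A homogeneous basis `e₁, …, eₙ, f₁, …, fₙ` with `J(eᵢ, fⱼ) = δᵢⱼ`. -/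
theorem exists_dualBasis (hJ : IsOddMetricForm J) :
    ∃ (n : ℕ) (b : Module.Basis (Fin n ⊕ Fin n) ℂ V), (∀ i, b (Sum.inl i) ∈ gr V 0) ∧
      (∀ i, b (Sum.inr i) ∈ gr V 1) ∧
      ∀ i j, J (b (Sum.inl i)) (b (Sum.inr j)) = if i = j then 1 else 0 := by
  obtain ⟨b, h0, h1⟩ := exists_homBasis V
  -- `fᵢ` represents the coordinate of `eᵢ`; oddness of `J` makes it odd, and shows that the `fᵢ`
  -- span the odd part
  have hsurj : Function.Surjective J.flip := by
    refine (LinearMap.injective_iff_surjective_of_finrank_eq_finrank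
      (Subspace.dual_finrank_eq (K := ℂ) (V := V)).symm).mp ?_
    rw [injective_iff_map_eq_zero]
    intro w hw
    exact hJ.nondegenerate.2 w fun v => congrArg (fun L : V →ₗ[ℂ] ℂ => L v) hw
  choose f hf using fun i => hsurj (b.coord (Sum.inl i))
  have hf : ∀ i v, J v (f i) = b.coord (Sum.inl i) v := fun i v =>
    congrArg (fun L : V →ₗ[ℂ] ℂ => L v) (hf i)
  have zero_of : ∀ w, (∀ k, J (b k) w = 0) → w = 0 := fun w hw => hJ.nondegenerate.2 w fun v =>
    congrArg (fun L : V →ₗ[ℂ] ℂ => L v) (b.ext (f₁ := J.flip w) (f₂ := 0) hw)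
  have hf1 : ∀ i, f i ∈ gr V 1 := by
    intro i
    refine mem_gr_of_homProj fun j hj => ?_
    obtain rfl : j = 0 := (parity_cases j).resolve_right hj
    refine zero_of _ fun k => ?_
    obtain k | k := k
    · exact hJ.odd 0 _ (h0 k) _ (homProj_mem 0 _)
    · have e : f i = homProj V 0 (f i) + homProj V 1 (f i) :=
        (sum_homProj (f i)).symm.trans (Fin.sum_univ_two _)
      have := hf i (b (Sum.inr k))
      rw [e, map_add, hJ.odd 1 _ (h1 k) _ (homProj_mem 1 _), add_zero] at this
      rw [this]
      simp
  have hdual : ∀ i j, J (b (Sum.inl i)) (f j) = if i = j then 1 else 0 := fun i j => by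
    rw [hf]
    simp [Finsupp.single_apply]
  have hodd : ∀ u ∈ gr V 1, u = ∑ i, J (b (Sum.inl i)) u • f i := by
    intro u hu
    rw [← sub_eq_zero]
    refine zero_of _ fun k => ?_
    obtain k | k := k
    · simp [map_sub, map_sum, hdual]
    · exact hJ.odd 1 _ (h1 k) _ (sub_mem hu (Submodule.sum_mem _ fun i _ =>
        Submodule.smul_mem _ _ (hf1 i)))
  have heven : ∀ u ∈ gr V 0, u = ∑ i, J u (f i) • b (Sum.inl i) := by
    intro u hu
    rw [← sub_eq_zero]
    set w := u - ∑ i, J u (f i) • b (Sum.inl i) with hw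
    have hw0 : w ∈ gr V 0 := sub_mem hu (Submodule.sum_mem _ fun i _ =>
        Submodule.smul_mem _ _ (h0 i))
    have hwf : ∀ j, J w (f j) = 0 := fun j => by
      simp [hw, map_sub, map_sum, LinearMap.sum_apply, hdual]
    refine hJ.nondegenerate.1 w fun v => ?_
    induction v using super_induction with
    | h i v hv =>
      obtain rfl | rfl := parity_cases i
      · exact hJ.odd 0 _ hw0 _ hv
      · rw [hodd v hv, map_sum]
        exact Finset.sum_eq_zero fun i _ => by rw [map_smul, hwf, smul_zero]
    | hadd v v' hv hv' => rw [map_add, hv, hv', add_zero]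
  let c : Fin (Module.finrank ℂ (gr V 0)) ⊕ Fin (Module.finrank ℂ (gr V 0)) → V :=
    Sum.elim (fun i => b (Sum.inl i)) f
  have hli : LinearIndependent ℂ c := by
    rw [Fintype.linearIndependent_iff]
    intro g hg k
    rw [Fintype.sum_sum_type] at hg
    obtain k | k := k
    · have h2 := congrArg (fun v => J v (f k)) hg
      simpa [c, map_sum, LinearMap.sum_apply, hdual, hJ.odd 1 _ (hf1 _) _ (hf1 _)] using h2
    · have h2 := congrArg (fun v => J (b (Sum.inl k)) v) hg
      simpa [c, map_sum, hdual, hJ.odd 0 _ (h0 _) _ (h0 _)] using h2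
  have hspan : ⊤ ≤ Submodule.span ℂ (Set.range c) := by
    rintro v -
    induction v using super_induction with
    | h i v hv =>
      obtain rfl | rfl := parity_cases i
      · rw [heven v hv]
        exact Submodule.sum_mem _ fun i _ => Submodule.smul_mem _ _
          (Submodule.subset_span ⟨Sum.inl i, rfl⟩)
      · rw [hodd v hv]
        exact Submodule.sum_mem _ fun i _ => Submodule.smul_mem _ _
          (Submodule.subset_span ⟨Sum.inr i, rfl⟩)
    | hadd v v' hv hv' => exact add_mem hv hv'
  refine ⟨_, Module.Basis.mk hli hspan, fun i => ?_, fun i => ?_, fun i j => ?_⟩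
  · rw [Module.Basis.mk_apply]; exact h0 i
  · rw [Module.Basis.mk_apply]; exact hf1 i
  · rw [Module.Basis.mk_apply, Module.Basis.mk_apply]; exact hdual i j

end Dual

variable {A : Type} [Ring A] [Algebra ℂ A] [SuperAlgebra A]

/-- An odd supersymmetric `A`-bilinear form on `A ⊗ V`; non-degeneracy is not included. -/
structure IsOddMetricOn (F : A ⊗[ℂ] V →ₗ[ℂ] A ⊗[ℂ] V →ₗ[ℂ] A) : Prop where
  bilinear : IsOddBilinear F
  odd : ∀ (p q : ZMod 2), ∀ x ∈ tensorGr A p, ∀ y ∈ tensorGr A q, F x y ∈ gr A (p + q + 1)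
  supersymm : ∀ (p q : ZMod 2), ∀ x ∈ tensorGr A p, ∀ y ∈ tensorGr A q,
    F x y = sgn (p * q) • F y x

theorem isOddMetricOn_oddExt {J : V →ₗ[ℂ] V →ₗ[ℂ] ℂ} (hJ : IsOddMetricForm J) :
    IsOddMetricOn (oddExt (A := A) J) :=
  ⟨isOddBilinear_oddExt J, fun _ _ _ hx _ hy => oddExt_mem hJ hx hy,
    fun _ _ _ hx _ hy => oddExt_supersymm hJ hx hy⟩

theorem IsOddMetricOn.comp {F : A ⊗[ℂ] V →ₗ[ℂ] A ⊗[ℂ] V →ₗ[ℂ] A} (hF : IsOddMetricOn F)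
    {g : V →ₗ[ℂ] A ⊗[ℂ] V} (hg : ∀ i, ∀ v ∈ gr V i, g v ∈ tensorGr A i) :
    IsOddMetricOn (F.compl₁₂ (glExt g) (glExt g)) :=
  ⟨hF.bilinear.comp hg,
    fun p q _ hx _ hy => hF.odd p q _ (glExt_mem_tensorGr hg hx) _ (glExt_mem_tensorGr hg hy),
    fun p q _ hx _ hy =>
      hF.supersymm p q _ (glExt_mem_tensorGr hg hx) _ (glExt_mem_tensorGr hg hy)⟩

theorem even_smul_left {F : A ⊗[ℂ] V →ₗ[ℂ] A ⊗[ℂ] V →ₗ[ℂ] A} (hF : IsOddBilinear F) {a : A}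
    {k p : ZMod 2} (ha : a ∈ gr A k) {x : A ⊗[ℂ] V} (hx : x ∈ tensorGr A p) (y : A ⊗[ℂ] V) :
    F (a • x) y = sgn k • (a * F x y) := by
  have := hF k 0 p a ha 1 SuperAlgebra.one_mem x hx y
  rwa [one_smul, mul_one, zero_mul, add_zero, add_zero] at this

variable {J : V →ₗ[ℂ] V →ₗ[ℂ] ℂ}

open Polynomial in
/-- If `F(x, y) = J((1 + n) x, y)` for a nilpotent even endomorphism `n` which is self-adjoint for
`J`, then `F` is isometric to `J` by means of `r = (1 + n)^(-1/2)`: this is a polynomial in `n`, so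
that it is self-adjoint as well and `F(r x, r y) = J(r (1 + n) r x, y) = J(x, y)`. -/
theorem exists_isometry_of_nilpotent {F : A ⊗[ℂ] V →ₗ[ℂ] A ⊗[ℂ] V →ₗ[ℂ] A}
    (n : Module.End ℂ (A ⊗[ℂ] V)) (hlin : ∀ (a : A) x, n (a • x) = a • n x)
    (heven : ∀ i, ∀ x ∈ tensorGr (V := V) A i, n x ∈ tensorGr (V := V) A i) {K : ℕ}
    (hK : n ^ K = 0) (hadj : ∀ x y, oddExt J (n x) y = oddExt J x (n y))
    (hn : ∀ x y, F x y = oddExt J (x + n x) y) :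
    ∃ g ∈ GLFunctor V A, ∀ v w, F (g v) (g w) = algebraMap ℂ A (J v w) := by
  obtain ⟨p, c, hc⟩ := exists_invSqrt K
  set r : Module.End ℂ (A ⊗[ℂ] V) := aeval n p with hr
  have hr1 : r * r * (1 + n) = 1 := by
    have h1 := congrArg (aeval n) hc
    simp only [map_sub, map_mul, map_pow, map_add, map_one, aeval_X, hK, zero_mul] at h1
    rw [← pow_two]
    exact sub_eq_zero.mp h1
  have hcomm : Commute r n := by
    have : Commute (aeval n p) (aeval n (X : ℂ[X])) := by
      rw [Commute, SemiconjBy, ← map_mul, ← map_mul, mul_comm]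
    rwa [aeval_X] at this
  have hr2 : r * (1 + n) * r = 1 := by
    rw [mul_assoc, ((Commute.one_right r).add_right hcomm).eq.symm, ← mul_assoc, hr1]
  have hplin : ∀ (q : ℂ[X]) (a : A) x, aeval n q (a • x) = a • aeval n q x := by
    intro q a x
    induction q using Polynomial.induction_on' with
    | add q q' h h' => simp only [map_add, LinearMap.add_apply, h, h', smul_add]
    | monomial k c =>
      have : ∀ k x, (n ^ k) (a • x) = a • (n ^ k) x := fun k => by
        induction k with
        | zero => intro x; simp
        | succ k ih => intro x; rw [pow_succ, Module.End.mul_apply, hlin, ih]; rfl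
      simp only [aeval_monomial, Module.End.mul_apply, this, Module.algebraMap_end_apply,
        smul_comm c a]
  have hpeven : ∀ (q : ℂ[X]) i, ∀ x ∈ tensorGr (V := V) A i, aeval n q x ∈ tensorGr A i := by
    intro q i x hx
    induction q using Polynomial.induction_on' with
    | add q q' h h' =>
      rw [map_add]
      exact add_mem h h'
    | monomial k c =>
      have : ∀ k, ∀ x ∈ tensorGr (V := V) A i, (n ^ k) x ∈ tensorGr (V := V) A i := fun k => by
        induction k with
        | zero => intro x hx; simpa
        | succ k ih => intro x hx; rw [pow_succ]; exact ih _ (heven i x hx)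
      rw [aeval_monomial]
      exact Submodule.smul_mem _ c (this k x hx)
  have hpadj : ∀ (q : ℂ[X]) x y, oddExt J (aeval n q x) y = oddExt J x (aeval n q y) := by
    intro q x y
    induction q using Polynomial.induction_on' with
    | add q q' h h' => simp only [map_add, LinearMap.add_apply, h, h']
    | monomial k c =>
      have : ∀ k x y, oddExt J ((n ^ k) x) y = oddExt J x ((n ^ k) y) := fun k => by
        induction k with
        | zero => intro x y; simp
        | succ k ih =>
          intro x y
          rw [pow_succ, Module.End.mul_apply, ih, hadj, ← Module.End.mul_apply, ← pow_succ',
            pow_succ]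
      simp only [aeval_monomial, Module.End.mul_apply, this, Module.algebraMap_end_apply, map_smul,
        LinearMap.smul_apply]
  let g : V →ₗ[ℂ] A ⊗[ℂ] V := r ∘ₗ TensorProduct.mk ℂ A V 1
  have hg : glExt g = r := by
    refine LinearMap.ext fun x => ?_
    induction x using TensorProduct.induction_on with
    | zero => simp
    | tmul a v =>
      rw [glExt_tmul, LinearMap.comp_apply, ← hplin, TensorProduct.mk_apply,
        TensorProduct.smul_tmul', smul_eq_mul, mul_one]
    | add x y hx hy => rw [map_add, map_add, hx, hy]
  refine ⟨g, ⟨fun i v hv => hpeven p i _ (one_tmul_mem_tensorGr hv), ?_⟩, fun v w => ?_⟩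
  · rw [hg]
    refine Function.bijective_iff_has_inverse.mpr ⟨⇑(r * (1 + n)), fun x => ?_, fun x => ?_⟩
    · exact congrArg (fun L : Module.End ℂ (A ⊗[ℂ] V) => L x) hr2
    · rw [← Module.End.mul_apply, ← mul_assoc, hr1]
      rfl
  · rw [← oddExt_one_tmul, hn]
    have h1 : g v + n (g v) = ((1 + n) * r) (1 ⊗ₜ v) := rfl
    refine (congrArg (fun x => oddExt J x (g w)) h1).trans ((hpadj p _ (1 ⊗ₜ w)).symm.trans ?_)
    rw [← Module.End.mul_apply, ← mul_assoc, ← hr, hr2]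
    rfl

section Change

variable {n : ℕ} (b : Module.Basis (Fin n ⊕ Fin n) ℂ V)

variable {b}

theorem changeHalf_even (h0 : ∀ i, b (Sum.inl i) ∈ gr V 0)
    (h1 : ∀ i, b (Sum.inr i) ∈ gr V 1)
    {D : Matrix (Fin n) (Fin n) A} (hD : ∀ i j, D i j ∈ gr A 0) :
    ∀ i, ∀ v ∈ gr V i, changeHalf b D v ∈ tensorGr A i :=
  even_of_homBasis b h0 h1 (Q := fun i => tensorGr A i) (φ := changeHalf b D)
    (fun i => by
      rw [changeHalf_inl]
      refine Submodule.sum_mem _ fun k _ => ?_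
      have := tmul_mem_tensorGr (hD i k) (h0 k)
      rwa [add_zero] at this)
    (fun i => by
      rw [changeHalf_inr]
      exact one_tmul_mem_tensorGr (h1 i))

theorem exchangeHalves_even (h0 : ∀ i, b (Sum.inl i) ∈ gr V 0)
    (h1 : ∀ i, b (Sum.inr i) ∈ gr V 1)
    {S R : Matrix (Fin n) (Fin n) A} (hS : ∀ i j, S i j ∈ gr A 1)
    (hR : ∀ i j, R i j ∈ gr A 1) :
    ∀ i, ∀ v ∈ gr V i, exchangeHalves b S R v ∈ tensorGr A i :=
  even_of_homBasis b h0 h1 (Q := fun i => tensorGr A i) (φ := exchangeHalves b S R)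
    (fun i => by
      rw [exchangeHalves_inl]
      refine neg_mem (Submodule.sum_mem _ fun k _ => ?_)
      have := tmul_mem_tensorGr (hS i k) (h1 k)
      rwa [CharTwo.add_self_eq_zero] at this)
    (fun i => by
      rw [exchangeHalves_inr]
      refine neg_mem (Submodule.sum_mem _ fun k _ => ?_)
      have := tmul_mem_tensorGr (hR i k) (h0 k)
      rwa [add_zero] at this)

end Change

theorem oddExt_odd_tmul {a : A} (ha : a ∈ gr A 1) (v w : V) :
    oddExt J (a ⊗ₜ v) (1 ⊗ₜ w) = -(J v w • a) := by
  induction v using super_induction with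
  | h i v hv =>
    rw [oddExt_tmul J ha SuperAlgebra.one_mem hv]
    simp [sgn]
  | hadd v v' hv hv' =>
    rw [TensorProduct.tmul_add, map_add, LinearMap.add_apply, hv, hv', map_add,
      LinearMap.add_apply, add_smul, neg_add]

section Isometry

variable {n : ℕ} {b : Module.Basis (Fin n ⊕ Fin n) ℂ V}

/-- An odd metric on `A ⊗ V` which agrees with `J` on pairs of basis vectors of different parities
is isometric to `J`: the remaining values, on pairs of the same parity, are odd and hence define a
nilpotent deviation from `J`. -/
theorem exists_isometry_of_eq (h0 : ∀ i, b (Sum.inl i) ∈ gr V 0)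
    (h1 : ∀ i, b (Sum.inr i) ∈ gr V 1)
    (hb : ∀ i j, J (b (Sum.inl i)) (b (Sum.inr j)) = if i = j then 1 else 0)
    (hJ : IsOddMetricForm J) {G : A ⊗[ℂ] V →ₗ[ℂ] A ⊗[ℂ] V →ₗ[ℂ] A} (hG : IsOddMetricOn G)
    {K : ℕ} (hK : (gr A 1) ^ K = ⊥)
    (hGb : ∀ i j, G (1 ⊗ₜ b (Sum.inl i)) (1 ⊗ₜ b (Sum.inr j)) = if i = j then 1 else 0) :
    ∃ g ∈ GLFunctor V A, ∀ v w, G (g v) (g w) = algebraMap ℂ A (J v w) := by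
  have hb' : ∀ i j, J (b (Sum.inr i)) (b (Sum.inl j)) = if j = i then 1 else 0 := fun i j => by
    rw [hJ.supersymm 1 0 _ (h1 i) _ (h0 j), hb]
    simp [sgn]
  have hGb' : ∀ i j, G (1 ⊗ₜ b (Sum.inr i)) (1 ⊗ₜ b (Sum.inl j)) = if j = i then 1 else 0 := by
    intro i j
    rw [hG.supersymm 1 0 _ (one_tmul_mem_tensorGr (h1 i)) _ (one_tmul_mem_tensorGr (h0 j)), hGb]
    simp [sgn]
  let S : Matrix (Fin n) (Fin n) A := fun i j => G (1 ⊗ₜ b (Sum.inl i)) (1 ⊗ₜ b (Sum.inl j))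
  let R : Matrix (Fin n) (Fin n) A := fun i j => G (1 ⊗ₜ b (Sum.inr i)) (1 ⊗ₜ b (Sum.inr j))
  have hS : ∀ i j, S i j ∈ gr A 1 := fun i j =>
    hG.odd 0 0 _ (one_tmul_mem_tensorGr (h0 i)) _ (one_tmul_mem_tensorGr (h0 j))
  have hR : ∀ i j, R i j ∈ gr A 1 := fun i j =>
    hG.odd 1 1 _ (one_tmul_mem_tensorGr (h1 i)) _ (one_tmul_mem_tensorGr (h1 j))
  have hSG : ∀ i j, G (1 ⊗ₜ b (Sum.inl i)) (1 ⊗ₜ b (Sum.inl j)) = S i j := fun _ _ => rfl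
  have hRG : ∀ i j, G (1 ⊗ₜ b (Sum.inr i)) (1 ⊗ₜ b (Sum.inr j)) = R i j := fun _ _ => rfl
  -- the definitions of `S` and `R` are hidden so that `simp` does not unfold them below
  clear_value S R
  obtain ⟨N, hN⟩ : ∃ N, N = exchangeHalves b S R := ⟨_, rfl⟩
  have Nl := fun i => hN ▸ exchangeHalves_inl b S R i
  have Nr := fun i => hN ▸ exchangeHalves_inr b S R i
  have Ne : ∀ i, ∀ v ∈ gr V i, N v ∈ tensorGr A i := hN ▸ exchangeHalves_even h0 h1 hS hR
  have NK : ∀ v, N v ∈ Submodule.map₂ (TensorProduct.mk ℂ A V) (gr A 1) ⊤ :=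
    hN ▸ exchangeHalves_mem b hS hR
  have hn : ∀ x y, G x y = oddExt J (x + glExt N x) y := by
    have hone : ∀ i, ∀ v ∈ gr V i,
        (TensorProduct.mk ℂ A V 1 + N) v ∈ tensorGr (V := V) A i := fun i v hv =>
      add_mem (one_tmul_mem_tensorGr hv) (Ne i v hv)
    have h2 : G = (oddExt J).compl₁₂ (glExt (TensorProduct.mk ℂ A V 1 + N))
        (glExt (TensorProduct.mk ℂ A V 1)) := by
      refine IsOddBilinear.ext hG.bilinear ((isOddBilinear_oddExt J).comp hone) fun v w => ?_
      suffices h3 : ∀ k l, G (1 ⊗ₜ b k) (1 ⊗ₜ b l) =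
          oddExt J (1 ⊗ₜ b k) (1 ⊗ₜ b l) + oddExt J (N (b k)) (1 ⊗ₜ b l) by
        have h4 := LinearMap.ext_basis b b
          (B := G.compl₁₂ (TensorProduct.mk ℂ A V 1) (TensorProduct.mk ℂ A V 1))
          (B' := (oddExt J).compl₁₂ (TensorProduct.mk ℂ A V 1 + N) (TensorProduct.mk ℂ A V 1))
          (fun k l => (h3 k l).trans (by
            rw [LinearMap.compl₁₂_apply, LinearMap.add_apply, map_add]; rfl))
        rw [LinearMap.compl₁₂_apply, glExt_one_tmul, glExt_one_tmul]
        exact congrArg (fun B : V →ₗ[ℂ] V →ₗ[ℂ] A => B v w) h4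
      have e0 : ∀ i j, J (b (Sum.inl i)) (b (Sum.inl j)) = 0 := fun i j =>
        hJ.odd 0 _ (h0 i) _ (h0 j)
      have e1 : ∀ i j, J (b (Sum.inr i)) (b (Sum.inr j)) = 0 := fun i j =>
        hJ.odd 1 _ (h1 i) _ (h1 j)
      intro k l
      obtain i | i := k
      all_goals obtain j | j := l
      all_goals simp only [oddExt_one_tmul, Nl, Nr, map_neg, map_sum, LinearMap.neg_apply,
        LinearMap.sum_apply, oddExt_odd_tmul (hS _ _), oddExt_odd_tmul (hR _ _), hb, hb', e0, e1,
        hSG, hRG, hGb, hGb']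
      all_goals simp
    intro x y
    rw [h2, LinearMap.compl₁₂_apply, glExt_add, glExt_mk, glExt_mk]
  -- `J(N x, y) = G(x, y) - J(x, y)` is supersymmetric, which is self-adjointness of `N`
  have hadj : ∀ x y, oddExt J (glExt N x) y = oddExt J x (glExt N y) := by
    have hH : ∀ x y, oddExt J (glExt N x) y = G x y - oddExt J x y := fun x y => by
      rw [hn, map_add, LinearMap.add_apply, add_sub_cancel_left]
    have hJJ := isOddMetricOn_oddExt (A := A) hJ
    intro x y
    induction x using tensor_hom_induction with
    | h j k a ha v hv =>
      induction y using tensor_hom_induction with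
      | h l m c hc w hw =>
        have hx := tmul_mem_tensorGr ha hv
        have hy := tmul_mem_tensorGr hc hw
        rw [hJJ.supersymm _ _ _ hx _ (glExt_mem_tensorGr Ne hy), hH, hH,
          hG.supersymm _ _ _ hx _ hy, hJJ.supersymm _ _ _ hx _ hy, smul_sub]
      | hadd y y' h h' => rw [map_add, map_add, map_add, h, h']
    | hadd x x' h h' =>
      rw [map_add, map_add, map_add, LinearMap.add_apply, LinearMap.add_apply, h, h']
  exact exists_isometry_of_nilpotent (glExt N) (glExt_smul N)
    (fun i x hx => glExt_mem_tensorGr Ne hx) (glExt_pow_eq_zero NK hK) hadj hn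

/-- An odd metric on `A ⊗ V` is isometric to `J` if the matrix of its values on pairs of an even
and an odd vector is invertible. -/
theorem exists_isometry (h0 : ∀ i, b (Sum.inl i) ∈ gr V 0) (h1 : ∀ i, b (Sum.inr i) ∈ gr V 1)
    (hb : ∀ i j, J (b (Sum.inl i)) (b (Sum.inr j)) = if i = j then 1 else 0)
    (hJ : IsOddMetricForm J) {F : A ⊗[ℂ] V →ₗ[ℂ] A ⊗[ℂ] V →ₗ[ℂ] A} (hF : IsOddMetricOn F)
    {K : ℕ} (hK : (gr A 1) ^ K = ⊥) {C D : Matrix (Fin n) (Fin n) A}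
    (hC : ∀ i j, C i j = F (1 ⊗ₜ b (Sum.inl i)) (1 ⊗ₜ b (Sum.inr j)))
    (hD : ∀ i j, D i j ∈ gr A 0) (hDC : D * C = 1) (hCD : C * D = 1) :
    ∃ g ∈ GLFunctor V A, ∀ v w, F (g v) (g w) = algebraMap ℂ A (J v w) := by
  -- replacing the even basis vectors `eᵢ` by `∑ D i k eₖ` turns the matrix `C` into the identity
  have hγe := changeHalf_even h0 h1 hD
  have hγ : changeHalf b D ∈ GLFunctor V A := mem_GLFunctor_of_inverse hγe
    (changeHalf_changeHalf b hCD) (changeHalf_changeHalf b hDC)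
  obtain ⟨g, hg, hgJ⟩ := exists_isometry_of_eq h0 h1 hb hJ (hF.comp hγe) hK fun i j => by
    rw [LinearMap.compl₁₂_apply, glExt_one_tmul, glExt_one_tmul, changeHalf_inl, changeHalf_inr,
      map_sum, LinearMap.sum_apply, ← Matrix.one_apply, ← hDC, Matrix.mul_apply]
    refine Finset.sum_congr rfl fun k _ => ?_
    have h2 : D i k ⊗ₜ[ℂ] b (Sum.inl k) = D i k • (1 ⊗ₜ[ℂ] b (Sum.inl k)) := by
      rw [TensorProduct.smul_tmul', smul_eq_mul, mul_one]
    rw [h2, even_smul_left hF.bilinear (hD i k) (one_tmul_mem_tensorGr (h0 k)), ← hC]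
    simp [sgn]
  exact ⟨glExt (changeHalf b D) ∘ₗ g, GLFunctor_mul hγ hg, hgJ⟩

end Isometry

end NormalForm

/-! ### Values of odd metrics at points -/

section Values

variable {V : Type} [AddCommGroup V] [Module ℂ V]

/-- The map `A ⊗ V → V` induced by a character of `A`: for `A = 𝒪(U)` and evaluation at a point, the
value of a section of the trivial bundle. -/
def valMap {A : Type} [Ring A] [Algebra ℂ A] (χ : A →ₐ[ℂ] ℂ) : A ⊗[ℂ] V →ₗ[ℂ] V :=
  (TensorProduct.lid ℂ V).toLinearMap ∘ₗ baseMap V χ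

theorem valMap_tmul {A : Type} [Ring A] [Algebra ℂ A] (χ : A →ₐ[ℂ] ℂ) (a : A) (v : V) :
    valMap χ (a ⊗ₜ v) = χ a • v := TensorProduct.lid_tmul _ _

variable {A : Type} [Ring A] [Algebra ℂ A] [SuperAlgebra A]

theorem sgn_zero : sgn 0 = 1 := if_pos rfl

variable [SuperModule V]

/-- The value of `F(x, y)` at a point depends on the values of `x` and `y` only. The signs of the
bilinearity rule play no role, because odd coefficients have value zero. -/
theorem map_oddBilinear (χ : A →ₐ[ℂ] ℂ) {F : A ⊗[ℂ] V →ₗ[ℂ] A ⊗[ℂ] V →ₗ[ℂ] A}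
    (hF : IsOddBilinear F) (x y : A ⊗[ℂ] V) :
    χ (F x y) = χ (F (1 ⊗ₜ valMap χ x) (1 ⊗ₜ valMap χ y)) := by
  have e : ∀ (a : A) (v : V), a ⊗ₜ[ℂ] v = a • (1 ⊗ₜ v) := fun a v => by
    rw [TensorProduct.smul_tmul', smul_eq_mul, mul_one]
  induction x using tensor_hom_induction with
  | h j k a ha v hv =>
    induction y using tensor_hom_induction with
    | h l m c hc w hw =>
      have h1 := hF j l k a ha c hc _ (one_tmul_mem_tensorGr hv) (1 ⊗ₜ w)
      rw [e a v, e c w, h1, ← e, ← e, valMap_tmul, valMap_tmul, map_smul, map_mul, map_mul,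
        TensorProduct.tmul_smul, TensorProduct.tmul_smul]
      simp only [map_smul, LinearMap.smul_apply]
      obtain rfl | rfl := parity_cases j
      · obtain rfl | rfl := parity_cases l
        · rw [zero_mul, add_zero, add_zero, sgn_zero, one_smul, smul_eq_mul, smul_eq_mul]
          ring
        · rw [map_eq_zero_of_odd χ hc]
          simp
      · rw [map_eq_zero_of_odd χ ha]
        simp
    | hadd y y' h h' => simp only [map_add, TensorProduct.tmul_add, h, h']
  | hadd x x' h h' => simp only [map_add, TensorProduct.tmul_add, LinearMap.add_apply, h, h']

end Values

section EvenMatrix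

variable {A : Type} [Ring A] [Algebra ℂ A] [SuperAlgebra A]

variable (A) in
/-- The commutative algebra of the even elements. -/
def evenSubalgebra : Subalgebra ℂ A where
  carrier := gr A 0
  mul_mem' {a b} ha hb := by
    have : a * b ∈ gr A (0 + 0) := SuperAlgebra.mul_mem ha hb
    rwa [add_zero] at this
  add_mem' ha hb := add_mem ha hb
  algebraMap_mem' c := by
    rw [Algebra.algebraMap_eq_smul_one]
    exact Submodule.smul_mem _ c SuperAlgebra.one_mem

instance evenSubalgebraCommRing : CommRing (evenSubalgebra A) :=
  { (evenSubalgebra A).toRing with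
    mul_comm := fun a b => Subtype.ext <| by
      have := SuperAlgebra.supercomm (show (a : A) ∈ gr A 0 from a.2)
        (show (b : A) ∈ gr A 0 from b.2)
      rwa [mul_zero, sgn_zero, one_smul] at this }

/-- The inverse of an even element is even. -/
theorem isUnit_evenSubalgebra {a : evenSubalgebra A} (ha : IsUnit (a : A)) : IsUnit a := by
  obtain ⟨b, hb⟩ := ha.exists_right_inv
  have ha0 : (a : A) ∈ gr A 0 := a.2
  have h1 : (a : A) * homProj A 0 b = 1 := by
    have h2 : (a : A) * homProj A 0 b + a * homProj A 1 b = 1 := by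
      rw [← mul_add, ← hb]
      exact congrArg _ ((Fin.sum_univ_two _).symm.trans (sum_homProj b))
    have m0 := SuperAlgebra.mul_mem ha0 (homProj_mem 0 b)
    have m1 := SuperAlgebra.mul_mem ha0 (homProj_mem 1 b)
    rw [zero_add] at m0 m1
    have h3 : (a : A) * homProj A 1 b ∈ gr A 0 := by
      rw [← eq_sub_iff_add_eq'] at h2
      rw [h2]
      exact sub_mem SuperAlgebra.one_mem m0
    rwa [Submodule.disjoint_def.mp gr_disjoint _ h3 m1, add_zero] at h2
  exact IsUnit.of_mul_eq_one ⟨homProj A 0 b, homProj_mem 0 b⟩ (Subtype.ext h1)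

/-- The determinant `d` of a matrix `C` with even entries, taken in the commutative algebra of even
elements. It is characterized by its values under characters and by the fact that, after any base
change, `C` has an inverse with even entries if `d` is a unit. -/
theorem exists_evenDet {n : ℕ} (C : Matrix (Fin n) (Fin n) A) (hC : ∀ i j, C i j ∈ gr A 0) :
    ∃ d : A, (∀ χ : A →ₐ[ℂ] ℂ, χ d = (C.map χ).det) ∧
      ∀ (A' : Type) [Ring A'] [Algebra ℂ A'] [SuperAlgebra A'] (ρ : A →ₐ[ℂ] A'),
        (∀ i, ∀ a ∈ gr A i, ρ a ∈ gr A' i) → IsUnit (ρ d) →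
        ∃ D : Matrix (Fin n) (Fin n) A', (∀ i j, D i j ∈ gr A' 0) ∧
          D * C.map ρ = 1 ∧ C.map ρ * D = 1 := by
  let C0 : Matrix (Fin n) (Fin n) (evenSubalgebra A) := fun i j => ⟨C i j, hC i j⟩
  refine ⟨C0.det, fun χ => ?_, ?_⟩
  · let χ0 : evenSubalgebra A →+* ℂ := χ.toRingHom.comp (evenSubalgebra A).val.toRingHom
    exact χ0.map_det C0
  · intro A' _ _ _ ρ hρ hu
    let ρ0 : evenSubalgebra A →+* evenSubalgebra A' :=
      { toFun := fun a => ⟨ρ a, hρ 0 a a.2⟩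
        map_one' := Subtype.ext (map_one ρ)
        map_mul' := fun a b => Subtype.ext (map_mul ρ _ _)
        map_zero' := Subtype.ext (map_zero ρ)
        map_add' := fun a b => Subtype.ext (map_add ρ _ _) }
    let C1 := ρ0.mapMatrix C0
    have hC1 : IsUnit C1.det := by
      rw [← ρ0.map_det]
      exact isUnit_evenSubalgebra hu
    let f : Matrix (Fin n) (Fin n) (evenSubalgebra A') →+* Matrix (Fin n) (Fin n) A' :=
      (evenSubalgebra A').val.toRingHom.mapMatrix
    have hf : f C1 = C.map ρ := rfl
    refine ⟨f C1⁻¹, fun i j => (C1⁻¹ i j).2, ?_, ?_⟩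
    · rw [← hf, ← map_mul, Matrix.nonsing_inv_mul _ hC1, map_one]
    · rw [← hf, ← map_mul, Matrix.mul_nonsing_inv _ hC1, map_one]

end EvenMatrix

/-! ### Orthonormal frames -/

section Orthonormal

variable {V : Type} [AddCommGroup V] [Module ℂ V]
variable {M : MixedSupermanifold} (B : OddMetric M)

/-- The form `B(s x, s y)` on `𝒪(U) ⊗ V`, for a linear map `s` from `V` to vector fields. -/
def OddMetric.gram {U : MixedSupermanifold} {i : Hom U.toSuperSpace M.toSuperSpace}
    (hi : i.IsOpenImmersion) (s : V →ₗ[ℂ] Vect i) :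
    U.Γ ⊗[ℂ] V →ₗ[ℂ] U.Γ ⊗[ℂ] V →ₗ[ℂ] U.Γ :=
  (B.form U i hi).compl₁₂ (frameExt s) (frameExt s)

theorem OddMetric.gram_apply {U : MixedSupermanifold} {i : Hom U.toSuperSpace M.toSuperSpace}
    (hi : i.IsOpenImmersion) (s : V →ₗ[ℂ] Vect i) (x y : U.Γ ⊗[ℂ] V) :
    B.gram hi s x y = B.form U i hi (frameExt s x) (frameExt s y) := rfl

theorem OddMetric.gram_one_tmul {U : MixedSupermanifold} {i : Hom U.toSuperSpace M.toSuperSpace}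
    (hi : i.IsOpenImmersion) (s : V →ₗ[ℂ] Vect i) (v w : V) :
    B.gram hi s (1 ⊗ₜ v) (1 ⊗ₜ w) = B.form U i hi (s v) (s w) := by
  rw [B.gram_apply, frameExt_one_tmul, frameExt_one_tmul]

variable [SuperModule V]

theorem OddMetric.isOddMetricOn_gram {U : MixedSupermanifold}
    {i : Hom U.toSuperSpace M.toSuperSpace} (hi : i.IsOpenImmersion) {s : V →ₗ[ℂ] Vect i}
    (hs : ∀ p, ∀ v ∈ gr V p, (s v : OpAlong i) ∈ Der i p) : IsOddMetricOn (B.gram hi s) where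
  bilinear k l p a ha b hb x hx y := by
    rw [B.gram_apply, frameExt_smul, frameExt_smul]
    exact B.bilinear U i hi k l p a ha b hb _ _ (frameExt_mem_Der hs hx)
  odd p q x hx y hy := B.odd U i hi p q _ _ (frameExt_mem_Der hs hx) (frameExt_mem_Der hs hy)
  supersymm p q x hx y hy :=
    B.supersymm U i hi p q _ _ (frameExt_mem_Der hs hx) (frameExt_mem_Der hs hy)

/-- In a frame with dual coordinate functions the values of `B` at a point are non-degenerate. The
coordinate functions are needed because non-degeneracy of `B` concludes that the values of
`s v` on functions vanish at the point, and not that `v` does. -/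
theorem OddMetric.eq_zero_of_val {U : MixedSupermanifold}
    {i : Hom U.toSuperSpace M.toSuperSpace} (hi : i.IsOpenImmersion) {s : V →ₗ[ℂ] Vect i}
    (hs : IsFrame i s) {ι : Type} [Fintype ι] [DecidableEq ι] (b : Module.Basis ι ℂ V)
    {W : Opens M.carrier} {y : ι → M.O W} (hW : ∀ t, i.base t ∈ W)
    (hy : ∀ k l, (s (b k)).1 W (y l) = if k = l then 1 else 0) {u : U.carrier}
    (e : PtEval U.toSuperSpace u) {v : V}
    (hv : ∀ w, e.val (U := ⊤) trivial (B.form U i hi (s v) (s w)) = 0) : v = 0 := by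
  have hcoord : ∀ l, (s v).1 W (y l) = algebraMap ℂ _ (b.repr v l) := by
    intro l
    let L : V →ₗ[ℂ] U.O (i.pre W) :=
      { toFun := fun v => (s v).1 W (y l)
        map_add' := fun v w => by rw [map_add]; rfl
        map_smul' := fun c v => by rw [map_smul]; rfl }
    have h1 : L = (Algebra.linearMap ℂ (U.O (i.pre W))) ∘ₗ b.coord l := by
      refine b.ext fun k => (hy k l).trans ?_
      rw [LinearMap.comp_apply, b.coord_apply, b.repr_self, Finsupp.single_apply]
      split_ifs <;> simp
    exact congrArg (fun L : V →ₗ[ℂ] U.O (i.pre W) => L v) h1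
  refine b.ext_elem fun l => ?_
  rw [map_zero, Finsupp.zero_apply]
  by_contra hl
  -- `s v` maps `y l` to the constant `b.repr v l`, which would be invertible if it were non-zero
  refine B.nondegenerate U i hi u (s v) ?_ W (y l) (hW u) ?_
  · intro U' j hij u' hu' Y
    have hj := hi.of_comp hij
    obtain ⟨z, rfl⟩ := (hs.bijective U'.toSuperSpace j hj).2 Y
    obtain ⟨e'⟩ := U'.evalSpace.exists_ptEval u'
    have hm := B.isOddMetricOn_gram hij (s := vectPull i j ∘ₗ s)
      fun p v hv => vectPull_mem_Der j (hs.even p v hv)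
    have h2 : B.form U' (i.comp j) hij (vectPull i j (s v)) (frameExt (vectPull i j ∘ₗ s) z) =
        B.gram hij (vectPull i j ∘ₗ s) (1 ⊗ₜ v) z := by
      rw [B.gram_apply, frameExt_one_tmul]
      rfl
    rw [h2, e'.isUnitAt_iff_val (U := ⊤) trivial, not_not, map_oddBilinear _ hm.bilinear,
      valMap_tmul, map_one, one_smul, B.gram_one_tmul]
    set w := valMap (e'.val (U := ⊤) trivial) z
    have h3 := B.restrict U U' i j hi hij (s v) (s w)
    have h4 : ¬ U'.IsUnitAt (j.onΓ (B.form U i hi (s v) (s w))) u' := by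
      rw [j.isUnitAt_onΓ, hu', e.isUnitAt_iff_val (U := ⊤) trivial, not_not]
      exact hv w
    rw [← h3, e'.isUnitAt_iff_val (U := ⊤) trivial, not_not] at h4
    exact h4
  · rw [hcoord]
    refine ⟨i.pre W, le_rfl, hW u, ?_⟩
    rw [AlgHom.commutes]
    exact (IsUnit.mk0 _ hl).map _

variable [FiniteDimensional ℂ V]

/-- An odd metric has orthonormal frames near every point. In a coordinate frame the matrix `Q` of
values of `B` on pairs of an even and an odd basis vector is invertible at the point, hence near
it, and there `exists_isometry` applies. -/
theorem OddMetric.exists_orthonormal {J : V →ₗ[ℂ] V →ₗ[ℂ] ℂ} (hJ : IsOddMetricForm J)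
    (hM : M.IsModelledOn V) (m : M.carrier) :
    ∃ (U : MixedSupermanifold) (i : Hom U.toSuperSpace M.toSuperSpace) (hi : i.IsOpenImmersion)
      (s : V →ₗ[ℂ] Vect i), m ∈ Set.range i.base ∧ IsFrame i s ∧ B.IsOrthonormal J hi s := by
  obtain ⟨C, c, s, hc, ⟨t, rfl⟩, hs, ⟨ι, _, _, b', W, y, hW, hy⟩, K, hK⟩ :=
    exists_chartFrame (hM m)
  obtain ⟨n, b, h0, h1, hb⟩ := exists_dualBasis hJ
  have hsf := hs.isFrame C.evalSpace
  have hF := B.isOddMetricOn_gram hc hs.even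
  let Q : Matrix (Fin n) (Fin n) C.Γ := fun i j =>
    B.gram hc s (1 ⊗ₜ b (Sum.inl i)) (1 ⊗ₜ b (Sum.inr j))
  have hQ : ∀ i j, Q i j ∈ gr C.Γ 0 := fun i j =>
    hF.odd 0 1 _ (one_tmul_mem_tensorGr (h0 i)) _ (one_tmul_mem_tensorGr (h1 j))
  obtain ⟨d, hdχ, hd⟩ := exists_evenDet Q hQ
  obtain ⟨e⟩ := C.evalSpace.exists_ptEval t
  let χ : C.Γ →ₐ[ℂ] ℂ := e.val (U := ⊤) trivial
  -- a vector in the kernel of the matrix `χ(Q)` would be an even vector orthogonal at the point to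
  -- all odd vectors, and to all even ones because odd functions have value zero
  have hdt : χ d ≠ 0 := by
    rw [hdχ]
    intro hdet
    obtain ⟨a, ha, haQ⟩ := Matrix.exists_vecMul_eq_zero_iff.mpr hdet
    have hv : ∑ i, a i • b (Sum.inl i) = 0 := by
      refine B.eq_zero_of_val hc hsf b' hW hy e fun w => ?_
      have h2 : (χ.toLinearMap ∘ₗ B.form C c hc (s (∑ i, a i • b (Sum.inl i)))) ∘ₗ s = 0 := by
        refine b.ext fun k => ?_
        change χ (B.form C c hc (s _) (s (b k))) = 0
        rw [← B.gram_one_tmul, TensorProduct.tmul_sum, map_sum, LinearMap.sum_apply, map_sum]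
        simp only [TensorProduct.tmul_smul, map_smul, LinearMap.smul_apply]
        obtain k | k := k
        · refine Finset.sum_eq_zero fun i _ => ?_
          rw [map_eq_zero_of_odd χ, smul_zero]
          exact hF.odd 0 0 _ (one_tmul_mem_tensorGr (h0 i)) _ (one_tmul_mem_tensorGr (h0 k))
        · exact congrFun haQ k
      exact congrArg (fun L : V →ₗ[ℂ] ℂ => L w) h2
    refine ha (funext fun i => ?_)
    have h3 := congrArg (fun v => b.repr v (Sum.inl i)) hv
    simpa [map_sum, Finsupp.single_apply] using h3
  obtain ⟨N, hN, htN, hu⟩ := (e.isUnitAt_iff_val (U := ⊤) trivial d).mpr hdt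
  let k : Hom (C.restrict N).toSuperSpace C.toSuperSpace := C.incl N
  have hk : k.IsOpenImmersion := isOpenImmersion_incl _ _
  have hck := hc.comp hk
  have hkd : IsUnit (k.onΓ d) := by
    have hle : (img (⊤ : Opens N) : Opens C.carrier) ≤ N := by
      rintro _ ⟨x, -, rfl⟩
      exact x.2
    have h2 : k.onΓ d = C.res hle (C.res hN d) :=
      (C.res_res _ _ _).trans (C.res_res _ _ _).symm
    rw [h2]
    exact hu.map (C.res hle)
  obtain ⟨D, hDe, hDQ, hQD⟩ := hd _ k.onΓ (onΓ_even k) hkd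
  have hs1 := hs.pull k
  obtain ⟨g, hg, hgJ⟩ := exists_isometry h0 h1 hb hJ (B.isOddMetricOn_gram hck hs1.even)
    (hK _ k hk) (C := Q.map k.onΓ) (D := D) (fun i j => by
      rw [B.gram_one_tmul]
      refine Eq.trans ?_ (B.restrict C (C.restrict N) c k hc hck (s (b (Sum.inl i)))
        (s (b (Sum.inr j)))).symm
      rw [← B.gram_one_tmul]
      rfl) hDe hDQ hQD
  exact ⟨C.restrict N, c.comp k, hck, frameAct (vectPull c k ∘ₗ s) g, ⟨⟨t, htN⟩, rfl⟩,
    (hs1.act hg).isFrame (C.restrict N).evalSpace, hgJ⟩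

end Orthonormal

/-! ### Restriction and base change -/

section BaseChange

/-- The source of an open immersion to a mixed supermanifold. -/
def MixedSupermanifold.ofIsOpenImmersion {X : SuperSpace} {M : MixedSupermanifold}
    {j : Hom X M.toSuperSpace} (hj : j.IsOpenImmersion) : MixedSupermanifold where
  toSuperSpace := X
  t2 := by
    have := M.t2
    exact hj.isOpenEmbedding.isEmbedding.t2Space
  secondCountable := by
    have := M.secondCountable
    exact hj.isOpenEmbedding.isEmbedding.secondCountableTopology
  charts x := by
    obtain ⟨n, m, q, h⟩ := M.charts (j.base x)
    exact ⟨n, m, q, h.of_isOpenImmersion hj⟩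

variable {T U X : SuperSpace} {V : Type} [AddCommGroup V] [Module ℂ V]

theorem Hom_comap_congr {f g : Hom T X} (h : f = g) (W : Opens X.carrier)
    (hW : f.pre W ≤ g.pre W) (a : X.O W) : f.comap W a = T.res hW (g.comap W a) := by
  subst h
  exact (T.res_refl _).symm

/-- Open immersions are monomorphisms. -/
theorem SuperSpace.Hom.IsOpenImmersion.cancel {i : Hom U X} (hi : i.IsOpenImmersion)
    {a b : Hom T U} (h : i.comp a = i.comp b) : a = b := by
  refine Hom.ext' (fun t => hi.isOpenEmbedding.injective
    (congrArg (fun f : Hom T X => f.base t) h)) fun V hV x => ?_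
  obtain ⟨y, rfl⟩ := (hi.equiv V).surjective x
  rw [hi.equiv_apply, a.comap_res, b.comap_res, T.res_res]
  have := Hom_comap_congr h (hi.image V) (fun t ht => by rw [← h]; exact ht) y
  exact (congrArg _ this).trans (T.res_res _ _ _)

/-- Every morphism `f : T ⟶ X` factors near `t` through an open immersion whose image contains
`f(t)`. -/
theorem exists_local_lift (T : MixedSupermanifold) {i : Hom U X} (hi : i.IsOpenImmersion)
    (f : Hom T.toSuperSpace X) (t : T.carrier) (ht : f.base t ∈ Set.range i.base) :
    ∃ (R : MixedSupermanifold) (k : Hom R.toSuperSpace T.toSuperSpace)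
      (l : Hom R.toSuperSpace U), k.IsOpenImmersion ∧ t ∈ Set.range k.base ∧
        i.comp l = f.comp k := by
  let N : Opens T.carrier := f.pre (hi.image ⊤)
  have hN : ∀ x, ∃ u, i.base u = (f.comp (T.incl N)).base x := by
    rintro ⟨x, u, -, hu⟩
    exact ⟨u, hu⟩
  refine ⟨T.restrict N, T.incl N, hi.lift _ hN, isOpenImmersion_incl _ _, ?_, hi.comp_lift _ hN⟩
  obtain ⟨u, hu⟩ := ht
  exact ⟨⟨t, u, trivial, hu⟩, rfl⟩

theorem mem_gr_of_locally {a : X.Γ} {p : ZMod 2}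
    (h : ∀ x, ∃ (U : SuperSpace) (j : Hom U X), j.IsOpenImmersion ∧ x ∈ Set.range j.base ∧
      j.onΓ a ∈ gr U.Γ p) : a ∈ gr X.Γ p := by
  refine mem_gr_of_homProj fun q hq => eq_of_onΓ_eq fun x => ?_
  obtain ⟨U, j, hj, hx, hm⟩ := h x
  refine ⟨U, j, hj, hx, ?_⟩
  rw [map_zero]
  exact (map_homProj j.onΓ.toLinearMap (onΓ_even j) q a).trans (homProj_of_ne hq hm)

theorem frameExt_baseMap {f : Hom T X} {φ : V →ₗ[ℂ] Vect f} {R : SuperSpace} (k : Hom R T)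
    {x : T.Γ ⊗[ℂ] V} {Y : Vect f} (h : frameExt φ x = Y) :
    frameExt (vectPull f k ∘ₗ φ) (baseMap V k.onΓ x) = vectPull f k Y := by
  rw [← vectPull_frameExt, h]

/-- Transport of vector fields along an equality of morphisms. -/
def castVect {f g : Hom T X} (e : f = g) : Vect f →ₗ[ℂ] Vect g := e ▸ LinearMap.id

theorem vectPull_castVect {f g : Hom T X} (e : f = g) {R : SuperSpace} (k : Hom R T)
    (φ : V →ₗ[ℂ] Vect f) : vectPull g k ∘ₗ (castVect e ∘ₗ φ) =
      castVect (congrArg (fun f : Hom T X => f.comp k) e) ∘ₗ (vectPull f k ∘ₗ φ) := by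
  subst e
  rfl

/-- If the coefficients of a vector field have value zero at a point, then so do its values on
functions. -/
theorem val_frameExt {T X : SuperSpace} {f : Hom T X} (φ : V →ₗ[ℂ] Vect f) {t : T.carrier}
    (e : PtEval T t) {W : Opens X.carrier} (hW : f.base t ∈ W) (a : X.O W) {x : T.Γ ⊗[ℂ] V}
    (hx : valMap (e.val (U := ⊤) trivial) x = 0) :
    e.val (U := f.pre W) hW ((frameExt φ x).1 W a) = 0 := by
  let L : V →ₗ[ℂ] ℂ :=
    { toFun := fun v => e.val (U := f.pre W) hW ((φ v).1 W a)
      map_add' := fun v w => by rw [map_add]; exact map_add (e.val (U := f.pre W) hW) _ _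
      map_smul' := fun c v => by rw [map_smul]; exact map_smul (e.val (U := f.pre W) hW) _ _ }
  have h : e.val (U := f.pre W) hW ((frameExt φ x).1 W a) =
      L (valMap (e.val (U := ⊤) trivial) x) := by
    clear hx
    induction x using TensorProduct.induction_on with
    | zero => rw [map_zero, map_zero, map_zero]; exact map_zero (e.val (U := f.pre W) hW)
    | tmul c v =>
      rw [valMap_tmul, map_smul, frameExt_tmul]
      change e.val (U := f.pre W) hW (T.res le_top c * (φ v).1 W a) = _
      rw [map_mul, e.val_res]
      rfl
    | add x y hx hy =>
      rw [map_add, map_add, map_add, ← hx, ← hy]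
      exact map_add (e.val (U := f.pre W) hW) _ _
  rw [h, hx, map_zero]

end BaseChange

/-! ### The metric of a reduction -/

section MetricOf

variable {V : Type} [AddCommGroup V] [Module ℂ V] [SuperModule V]
variable {M : MixedSupermanifold}

/-- Near every point of `T` the reduction `P` has a section along `f` which is the pullback of a
section over an open subspace of `M`, and all sections arise from it by the action of `G`. -/
theorem FrameReduction.exists_local_section {G : LinearGroupFunctor V} (P : FrameReduction G M)
    {T : MixedSupermanifold} (f : Hom T.toSuperSpace M.toSuperSpace) (t : T.carrier) :
    ∃ (R : MixedSupermanifold) (k : Hom R.toSuperSpace T.toSuperSpace), k.IsOpenImmersion ∧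
      t ∈ Set.range k.base ∧ ∃ (U : MixedSupermanifold) (i : Hom U.toSuperSpace M.toSuperSpace)
        (s : V →ₗ[ℂ] Vect i) (l : Hom R.toSuperSpace U.toSuperSpace) (e : i.comp l = f.comp k),
        i.IsOpenImmersion ∧ s ∈ P.points U i ∧
        castVect e ∘ₗ (vectPull i l ∘ₗ s) ∈ P.points R (f.comp k) ∧
        ∀ φ ∈ P.points R (f.comp k), ∃ g ∈ G R.Γ,
          φ = frameAct (castVect e ∘ₗ (vectPull i l ∘ₗ s)) g := by
  obtain ⟨U, i, hi, hm, s, hs, htriv⟩ := P.locallyTrivial (f.base t)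
  obtain ⟨R, k, l, hk, ht, e⟩ := exists_local_lift T hi f t hm
  refine ⟨R, k, hk, ht, U, i, s, l, e, hi, hs, ?_⟩
  have : ∀ (c : Hom R.toSuperSpace M.toSuperSpace) (e : i.comp l = c),
      castVect e ∘ₗ (vectPull i l ∘ₗ s) ∈ P.points R c ∧
        ∀ φ ∈ P.points R c, ∃ g ∈ G R.Γ,
          φ = frameAct (castVect e ∘ₗ (vectPull i l ∘ₗ s)) g := by
    rintro _ rfl
    exact ⟨P.pull U R i l s hs, fun φ hφ => (htriv R l φ).mp hφ⟩
  exact this _ e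

variable {J : V →ₗ[ℂ] V →ₗ[ℂ] ℂ} (P : FrameReduction (PGroup J) M)

theorem FrameReduction.exists_local_frame {T : MixedSupermanifold}
    (f : Hom T.toSuperSpace M.toSuperSpace) (t : T.carrier) :
    ∃ (R : MixedSupermanifold) (k : Hom R.toSuperSpace T.toSuperSpace), k.IsOpenImmersion ∧
      t ∈ Set.range k.base ∧ ∃ φ, φ ∈ P.points R (f.comp k) := by
  obtain ⟨R, k, hk, ht, _, _, _, _, _, -, -, hσ, -⟩ := P.exists_local_section f t
  exact ⟨R, k, hk, ht, _, hσ⟩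

theorem FrameReduction.bijective {T : MixedSupermanifold}
    {f : Hom T.toSuperSpace M.toSuperSpace} {φ : V →ₗ[ℂ] Vect f} (hφ : φ ∈ P.points T f) :
    Function.Bijective (frameExt φ) :=
  (P.isFrame T f φ hφ).bijective _ (Hom.id _) (Hom.isOpenImmersion_id _)

/-- The pairing of two vector fields computed in a frame of `P` does not depend on the frame:
locally both frames arise from a third one by elements of `P(V, J)`, which preserve `J`. -/
theorem FrameReduction.oddExt_eq {T : MixedSupermanifold}
    {f : Hom T.toSuperSpace M.toSuperSpace} {φ ψ : V →ₗ[ℂ] Vect f} (hφ : φ ∈ P.points T f)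
    (hψ : ψ ∈ P.points T f) {x y x' y' : T.Γ ⊗[ℂ] V} (hx : frameExt φ x = frameExt ψ x')
    (hy : frameExt φ y = frameExt ψ y') : oddExt J x y = oddExt J x' y' := by
  refine eq_of_onΓ_eq fun t => ?_
  obtain ⟨R, k, hk, ht, U, i, s, l, e, -, -, hσ, htriv⟩ := P.exists_local_section f t
  refine ⟨R.toSuperSpace, k, hk, ht, ?_⟩
  set σ := castVect e ∘ₗ (vectPull i l ∘ₗ s)
  obtain ⟨g, hg, hφg⟩ := htriv _ (P.pull T R f k φ hφ)
  obtain ⟨h, hh, hψh⟩ := htriv _ (P.pull T R f k ψ hψ)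
  have key : ∀ z z', frameExt φ z = frameExt ψ z' →
      glExt g (baseMap V k.onΓ z) = glExt h (baseMap V k.onΓ z') := by
    intro z z' hz
    refine (P.bijective hσ).1 ?_
    rw [← frameExt_frameAct, ← frameExt_frameAct, ← hφg, ← hψh, ← vectPull_frameExt,
      ← vectPull_frameExt, hz]
  rw [map_oddExt _ (onΓ_even k), map_oddExt _ (onΓ_even k)]
  refine (oddExt_glExt hg _ _).symm.trans ?_
  rw [key _ _ hx, key _ _ hy]
  exact oddExt_glExt hh _ _

/-- `b` is the pairing of the vector fields `X` and `Y`, computed locally in frames of `P`. -/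
def FrameReduction.IsPairing {U : MixedSupermanifold} (i : Hom U.toSuperSpace M.toSuperSpace)
    (X Y : Vect i) (b : U.Γ) : Prop :=
  ∀ (R : MixedSupermanifold) (k : Hom R.toSuperSpace U.toSuperSpace), k.IsOpenImmersion →
    ∀ φ ∈ P.points R (i.comp k), ∀ x y, frameExt φ x = vectPull i k X →
      frameExt φ y = vectPull i k Y → k.onΓ b = oddExt J x y

/-- Functions can be compared locally where `P` has frames. -/
theorem FrameReduction.eq_of_frames {U : MixedSupermanifold}
    (i : Hom U.toSuperSpace M.toSuperSpace) {a b : U.Γ}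
    (h : ∀ (R : MixedSupermanifold) (k : Hom R.toSuperSpace U.toSuperSpace), k.IsOpenImmersion →
      ∀ φ ∈ P.points R (i.comp k), k.onΓ a = k.onΓ b) : a = b := by
  refine eq_of_onΓ_eq fun t => ?_
  obtain ⟨R, k, hk, ht, σ, hσ⟩ := P.exists_local_frame i t
  exact ⟨R.toSuperSpace, k, hk, ht, h R k hk _ hσ⟩

theorem FrameReduction.IsPairing.unique {U : MixedSupermanifold}
    {i : Hom U.toSuperSpace M.toSuperSpace} {X Y : Vect i} {a b : U.Γ}
    (ha : P.IsPairing i X Y a) (hb : P.IsPairing i X Y b) : a = b := by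
  refine P.eq_of_frames i fun R k hk φ hφ => ?_
  obtain ⟨x, hx⟩ := (P.bijective hφ).2 (vectPull i k X)
  obtain ⟨y, hy⟩ := (P.bijective hφ).2 (vectPull i k Y)
  rw [ha R k hk φ hφ x y hx hy, hb R k hk φ hφ x y hx hy]

/-- The locally computed pairings glue, by independence of the frame on overlaps. -/
theorem FrameReduction.exists_isPairing {U : MixedSupermanifold}
    (i : Hom U.toSuperSpace M.toSuperSpace) (X Y : Vect i) : ∃ b, P.IsPairing i X Y b := by
  have hloc : ∀ u : U.carrier, ∃ (R : MixedSupermanifold)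
      (k : Hom R.toSuperSpace U.toSuperSpace), k.IsOpenImmersion ∧ u ∈ Set.range k.base ∧
        ∃ φ ∈ P.points R (i.comp k), ∃ x y, frameExt φ x = vectPull i k X ∧
          frameExt φ y = vectPull i k Y := by
    intro u
    obtain ⟨R, k, hk, ht, σ, hσ⟩ := P.exists_local_frame i u
    obtain ⟨x, hx⟩ := (P.bijective hσ).2 (vectPull i k X)
    obtain ⟨y, hy⟩ := (P.bijective hσ).2 (vectPull i k Y)
    exact ⟨R, k, hk, ht, _, hσ, x, y, hx, hy⟩
  choose R k hk hr φ hφ x y hx hy using hloc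
  have hpull : ∀ u (Q : MixedSupermanifold) (a : Hom Q.toSuperSpace (R u).toSuperSpace)
      (c : Hom Q.toSuperSpace U.toSuperSpace), (k u).comp a = c →
      ∃ ψ ∈ P.points Q (i.comp c), ∃ z w, frameExt ψ z = vectPull i c X ∧
        frameExt ψ w = vectPull i c Y ∧ a.onΓ (oddExt J (x u) (y u)) = oddExt J z w := by
    rintro u Q a _ rfl
    refine ⟨_, P.pull (R u) Q (i.comp (k u)) a _ (hφ u), baseMap V a.onΓ (x u),
      baseMap V a.onΓ (y u), ?_, ?_, map_oddExt _ (onΓ_even a) _ _⟩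
    · exact frameExt_baseMap a (hx u)
    · exact frameExt_baseMap a (hy u)
  obtain ⟨b, hb⟩ := exists_glueΓ (X := U.toSuperSpace) (fun u => (R u).toSuperSpace) k hk
    (fun u => ⟨u, hr u⟩) (fun u => oddExt J (x u) (y u)) (by
      intro u u' Q a a' ha e
      -- the test space is open in `U`, hence a mixed supermanifold on which `P` has points
      let Q' := MixedSupermanifold.ofIsOpenImmersion (M := U) ha
      obtain ⟨ψ, hψ, z, w, hz, hw, h1⟩ := hpull u Q' a _ rfl
      obtain ⟨ψ', hψ', z', w', hz', hw', h2⟩ := hpull u' Q' a' _ e.symm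
      refine h1.trans (Eq.trans ?_ h2.symm)
      exact P.oddExt_eq hψ hψ' (hz.trans hz'.symm) (hw.trans hw'.symm))
  refine ⟨b, fun S j hj ψ hψ z w hz hw => eq_of_onΓ_eq fun t => ?_⟩
  obtain ⟨Q, c, l, hc, ht, e⟩ := exists_local_lift S (hk (j.base t)) j t (hr _)
  refine ⟨Q.toSuperSpace, c, hc, ht, ?_⟩
  obtain ⟨ψ', hψ', z', w', hz', hw', h1⟩ := hpull _ Q l _ e
  have h2 : c.onΓ (j.onΓ b) = l.onΓ (oddExt J (x (j.base t)) (y (j.base t))) := by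
    rw [← hb, ← Hom.onΓ_comp, ← Hom.onΓ_comp, e]
  rw [h2, h1, map_oddExt _ (onΓ_even c)]
  exact P.oddExt_eq hψ' (P.pull S Q (i.comp j) c ψ hψ)
    (hz'.trans (frameExt_baseMap c hz).symm) (hw'.trans (frameExt_baseMap c hw).symm)

/-- The pairing of vector fields which is given by `J` in the frames of `P`. -/
def FrameReduction.pairing {U : MixedSupermanifold} (i : Hom U.toSuperSpace M.toSuperSpace) :
    Vect i →ₗ[ℂ] Vect i →ₗ[ℂ] U.Γ :=
  LinearMap.mk₂ ℂ (fun X Y => (P.exists_isPairing i X Y).choose)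
    (fun X X' Y => by
      refine (P.exists_isPairing i _ Y).choose_spec.unique P fun R k hk φ hφ x y hx hy => ?_
      obtain ⟨z, hz⟩ := (P.bijective hφ).2 (vectPull i k X)
      obtain ⟨z', hz'⟩ := (P.bijective hφ).2 (vectPull i k X')
      obtain rfl : x = z + z' := (P.bijective hφ).1 (by rw [hx, map_add, map_add, hz, hz'])
      rw [map_add, (P.exists_isPairing i X Y).choose_spec R k hk φ hφ _ _ hz hy,
        (P.exists_isPairing i X' Y).choose_spec R k hk φ hφ _ _ hz' hy, map_add,
        LinearMap.add_apply])
    (fun c X Y => by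
      refine (P.exists_isPairing i _ Y).choose_spec.unique P fun R k hk φ hφ x y hx hy => ?_
      obtain ⟨z, hz⟩ := (P.bijective hφ).2 (vectPull i k X)
      obtain rfl : x = c • z := (P.bijective hφ).1 (by rw [hx, map_smul, map_smul, hz])
      rw [map_smul, (P.exists_isPairing i X Y).choose_spec R k hk φ hφ _ _ hz hy, map_smul,
        LinearMap.smul_apply])
    (fun X Y Y' => by
      refine (P.exists_isPairing i X _).choose_spec.unique P fun R k hk φ hφ x y hx hy => ?_
      obtain ⟨z, hz⟩ := (P.bijective hφ).2 (vectPull i k Y)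
      obtain ⟨z', hz'⟩ := (P.bijective hφ).2 (vectPull i k Y')
      obtain rfl : y = z + z' := (P.bijective hφ).1 (by rw [hy, map_add, map_add, hz, hz'])
      rw [map_add, (P.exists_isPairing i X Y).choose_spec R k hk φ hφ _ _ hx hz,
        (P.exists_isPairing i X Y').choose_spec R k hk φ hφ _ _ hx hz', map_add])
    (fun c X Y => by
      refine (P.exists_isPairing i X _).choose_spec.unique P fun R k hk φ hφ x y hx hy => ?_
      obtain ⟨z, hz⟩ := (P.bijective hφ).2 (vectPull i k Y)
      obtain rfl : y = c • z := (P.bijective hφ).1 (by rw [hy, map_smul, map_smul, hz])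
      rw [map_smul, (P.exists_isPairing i X Y).choose_spec R k hk φ hφ _ _ hx hz, map_smul])

theorem FrameReduction.isPairing_pairing {U : MixedSupermanifold}
    (i : Hom U.toSuperSpace M.toSuperSpace) (X Y : Vect i) :
    P.IsPairing i X Y (P.pairing i X Y) := (P.exists_isPairing i X Y).choose_spec

theorem FrameReduction.pairing_frameExt {U : MixedSupermanifold}
    {i : Hom U.toSuperSpace M.toSuperSpace} {φ : V →ₗ[ℂ] Vect i} (hφ : φ ∈ P.points U i)
    (x y : U.Γ ⊗[ℂ] V) : P.pairing i (frameExt φ x) (frameExt φ y) = oddExt J x y := by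
  have h := P.isPairing_pairing i (frameExt φ x) (frameExt φ y) U (Hom.id _)
    (Hom.isOpenImmersion_id _) φ hφ x y rfl rfl
  rwa [Hom.onΓ_id] at h

theorem FrameReduction.pairing_apply {U : MixedSupermanifold}
    {i : Hom U.toSuperSpace M.toSuperSpace} {φ : V →ₗ[ℂ] Vect i} (hφ : φ ∈ P.points U i)
    (v w : V) : P.pairing i (φ v) (φ w) = algebraMap ℂ U.Γ (J v w) := by
  rw [← oddExt_one_tmul, ← P.pairing_frameExt hφ, frameExt_one_tmul, frameExt_one_tmul]

theorem FrameReduction.mem_tensorGr {T : MixedSupermanifold}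
    {f : Hom T.toSuperSpace M.toSuperSpace} {φ : V →ₗ[ℂ] Vect f} (hφ : φ ∈ P.points T f)
    {p : ZMod 2} {x : T.Γ ⊗[ℂ] V} (hx : (frameExt φ x : OpAlong f) ∈ Der f p) :
    x ∈ tensorGr T.Γ p :=
  mem_tensorGr_of_frameExt (P.isFrame T f φ hφ).even (P.bijective hφ).1 hx

/-- The odd metric of a `P(V, J)`-structure: the one that makes its frames orthonormal. -/
def FrameReduction.metric (hJ : IsOddMetricForm J) : OddMetric M where
  form _ i _ := P.pairing i
  restrict U U' i j hi hij X Y := by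
    refine P.eq_of_frames (i.comp j) fun R k hk φ hφ => ?_
    obtain ⟨x, hx⟩ := (P.bijective hφ).2 (vectPull (i.comp j) k (vectPull i j X))
    obtain ⟨y, hy⟩ := (P.bijective hφ).2 (vectPull (i.comp j) k (vectPull i j Y))
    rw [P.isPairing_pairing (i.comp j) _ _ R k hk φ hφ x y hx hy, ← Hom.onΓ_comp]
    exact (P.isPairing_pairing i X Y R (j.comp k) ((hi.of_comp hij).comp hk) φ hφ x y hx hy).symm
  odd U i hi p q X Y hX hY := by
    refine mem_gr_of_locally fun t => ?_
    obtain ⟨R, k, hk, ht, σ, hσ⟩ := P.exists_local_frame i t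
    obtain ⟨x, hx⟩ := (P.bijective hσ).2 (vectPull i k X)
    obtain ⟨y, hy⟩ := (P.bijective hσ).2 (vectPull i k Y)
    refine ⟨R.toSuperSpace, k, hk, ht, ?_⟩
    rw [P.isPairing_pairing i X Y R k hk _ hσ x y hx hy]
    exact oddExt_mem hJ (P.mem_tensorGr hσ (hx ▸ vectPull_mem_Der k hX))
      (P.mem_tensorGr hσ (hy ▸ vectPull_mem_Der k hY))
  bilinear U i hi k l p a ha b hb X Y hX := by
    refine P.eq_of_frames i fun R c hc φ hφ => ?_
    obtain ⟨x, hx⟩ := (P.bijective hφ).2 (vectPull i c X)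
    obtain ⟨y, hy⟩ := (P.bijective hφ).2 (vectPull i c Y)
    rw [map_smul, map_mul, map_mul, P.isPairing_pairing i X Y R c hc φ hφ x y hx hy,
      P.isPairing_pairing i _ _ R c hc φ hφ (c.onΓ a • x) (c.onΓ b • y)
        (by rw [frameExt_smul, hx, vectPull_vectSmul])
        (by rw [frameExt_smul, hy, vectPull_vectSmul])]
    exact isOddBilinear_oddExt J k l p _ (c.onΓ_gr ha) _ (c.onΓ_gr hb) _
      (P.mem_tensorGr hφ (hx ▸ vectPull_mem_Der c hX)) _
  supersymm U i hi p q X Y hX hY := by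
    refine P.eq_of_frames i fun R c hc φ hφ => ?_
    obtain ⟨x, hx⟩ := (P.bijective hφ).2 (vectPull i c X)
    obtain ⟨y, hy⟩ := (P.bijective hφ).2 (vectPull i c Y)
    rw [map_smul, P.isPairing_pairing i X Y R c hc φ hφ x y hx hy,
      P.isPairing_pairing i Y X R c hc φ hφ y x hy hx]
    exact oddExt_supersymm hJ (P.mem_tensorGr hφ (hx ▸ vectPull_mem_Der c hX))
      (P.mem_tensorGr hφ (hy ▸ vectPull_mem_Der c hY))
  -- pairing with the members of a frame shows that the coefficients of `X` in it vanish at `u`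
  nondegenerate U i hi u X hX W a hW := by
    obtain ⟨R, k, hk, ⟨t, rfl⟩, σ, hσ⟩ := P.exists_local_frame i u
    obtain ⟨x, hx⟩ := (P.bijective hσ).2 (vectPull i k X)
    obtain ⟨e⟩ := R.evalSpace.exists_ptEval t
    have hv : valMap (e.val (U := ⊤) trivial) x = 0 := by
      refine hJ.nondegenerate.1 _ fun w => ?_
      have h1 := hX R k (hi.comp hk) t rfl (frameExt σ (1 ⊗ₜ w))
      rw [e.isUnitAt_iff_val (U := ⊤) trivial, not_not, ← hx, P.pairing_frameExt hσ,
        map_oddBilinear _ (isOddBilinear_oddExt J), oddExt_one_tmul, AlgHom.commutes, valMap_tmul,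
        map_one, one_smul] at h1
      exact h1
    rw [← k.isUnitAt_comap (V := i.pre W) (X.1 W a) hW, e.isUnitAt_iff_val hW, not_not]
    have h2 := val_frameExt (f := i.comp k) σ e (W := W) hW a hv
    rw [hx] at h2
    exact h2

/-- A frame over an open subspace is a section of `P` if and only if it is orthonormal for the
metric of `P`. -/
theorem FrameReduction.mem_points_iff (hJ : IsOddMetricForm J) {U : MixedSupermanifold}
    {i : Hom U.toSuperSpace M.toSuperSpace} (hi : i.IsOpenImmersion) {s : V →ₗ[ℂ] Vect i}
    (hs : IsFrame i s) : s ∈ P.points U i ↔ (P.metric hJ).IsOrthonormal J hi s := by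
  refine ⟨fun h v w => P.pairing_apply h v w, fun h => P.sheaf U i s fun t => ?_⟩
  obtain ⟨R, k, hk, ht, σ, hσ⟩ := P.exists_local_frame i t
  refine ⟨R, k, hk, ht, ?_⟩
  obtain ⟨g, hg, e⟩ := exists_frameAct_eq (P.isFrame _ _ _ hσ).even
    (fun p v hv => vectPull_mem_Der k (hs.even p v hv)) (P.bijective hσ)
    (hs.bijective R.toSuperSpace k hk)
  rw [e]
  refine P.act _ _ _ hσ g ⟨hg, fun v w => ?_⟩
  rw [← P.pairing_frameExt hσ]
  have h1 := (P.metric hJ).restrict U R i k hi (hi.comp hk) (s v) (s w)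
  rw [h v w, AlgHom.commutes] at h1
  rw [← h1]
  exact congrArg₂ (fun X Y => P.pairing (i.comp k) X Y)
    (congrArg (fun L : V →ₗ[ℂ] Vect (i.comp k) => L v) e).symm
    (congrArg (fun L : V →ₗ[ℂ] Vect (i.comp k) => L w) e).symm

end MetricOf

/-! ### The reduction of a metric -/

section ReductionOf

variable {V : Type} [AddCommGroup V] [Module ℂ V] [SuperModule V]
variable {M : MixedSupermanifold} (B : OddMetric M) (J : V →ₗ[ℂ] V →ₗ[ℂ] ℂ)

/-- In an orthonormal frame `B` is the `A`-bilinear extension of `J`. -/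
theorem OddMetric.gram_eq_oddExt {U : MixedSupermanifold}
    {i : Hom U.toSuperSpace M.toSuperSpace} (hi : i.IsOpenImmersion) {s : V →ₗ[ℂ] Vect i}
    (hs : ∀ p, ∀ v ∈ gr V p, (s v : OpAlong i) ∈ Der i p) (ho : B.IsOrthonormal J hi s) :
    B.gram hi s = oddExt J :=
  (B.isOddMetricOn_gram hi hs).bilinear.ext (isOddBilinear_oddExt J) fun v w => by
    rw [B.gram_one_tmul, ho, oddExt_one_tmul]

theorem OddMetric.form_frameAct {U : MixedSupermanifold}
    {i : Hom U.toSuperSpace M.toSuperSpace} (hi : i.IsOpenImmersion) {s : V →ₗ[ℂ] Vect i}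
    (hs : ∀ p, ∀ v ∈ gr V p, (s v : OpAlong i) ∈ Der i p) (ho : B.IsOrthonormal J hi s)
    (g : V →ₗ[ℂ] U.Γ ⊗[ℂ] V) (v w : V) :
    B.form U i hi (frameAct s g v) (frameAct s g w) = oddExt J (g v) (g w) :=
  congrArg (fun F : U.Γ ⊗[ℂ] V →ₗ[ℂ] U.Γ ⊗[ℂ] V →ₗ[ℂ] U.Γ => F (g v) (g w))
    (B.gram_eq_oddExt J hi hs ho)

/-- Two orthonormal frames over the same open subspace differ by an element of `P(V, J)`. -/
theorem OddMetric.IsOrthonormal.frameAct_mem {U : MixedSupermanifold}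
    {i : Hom U.toSuperSpace M.toSuperSpace} {hi : i.IsOpenImmersion} {s s' : V →ₗ[ℂ] Vect i}
    (hs : IsFrame i s) (hs' : IsFrame i s') (ho : B.IsOrthonormal J hi s)
    (ho' : B.IsOrthonormal J hi s') : ∃ g ∈ PGroup J U.Γ, s' = frameAct s g := by
  obtain ⟨g, hg, rfl⟩ := exists_frameAct_eq hs.even hs'.even
    (hs.bijective _ (Hom.id _) (Hom.isOpenImmersion_id _))
    (hs'.bijective _ (Hom.id _) (Hom.isOpenImmersion_id _))
  refine ⟨g, ⟨hg, fun v w => ?_⟩, rfl⟩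
  rw [← B.form_frameAct J hi hs.even ho, ho']

/-- The `T`-point `φ` over `f` of the frame bundle is the pullback of a `B`-orthonormal frame over
an open subspace of `M`. A metric pairs vector fields over open subspaces only, so that for general
`f` orthonormality has to be expressed in this way. -/
def OddMetric.IsPulledOrthonormal {T : MixedSupermanifold}
    (f : Hom T.toSuperSpace M.toSuperSpace) (φ : V →ₗ[ℂ] Vect f) : Prop :=
  ∃ (U : MixedSupermanifold) (i : Hom U.toSuperSpace M.toSuperSpace) (hi : i.IsOpenImmersion)
    (s : V →ₗ[ℂ] Vect i) (h : Hom T.toSuperSpace U.toSuperSpace) (e : i.comp h = f),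
    IsFrame i s ∧ B.IsOrthonormal J hi s ∧ φ = castVect e ∘ₗ (vectPull i h ∘ₗ s)

variable {J} {T T' : MixedSupermanifold} {f : Hom T.toSuperSpace M.toSuperSpace}

namespace OddMetric.IsPulledOrthonormal

variable {B} {φ ψ : V →ₗ[ℂ] Vect f}

theorem of_isOrthonormal {U : MixedSupermanifold} {i : Hom U.toSuperSpace M.toSuperSpace}
    {hi : i.IsOpenImmersion} {s : V →ₗ[ℂ] Vect i} (hs : IsFrame i s)
    (ho : B.IsOrthonormal J hi s) (h : Hom T.toSuperSpace U.toSuperSpace) :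
    B.IsPulledOrthonormal J (i.comp h) (vectPull i h ∘ₗ s) :=
  ⟨U, i, hi, s, h, rfl, hs, ho, rfl⟩

theorem pull (hφ : B.IsPulledOrthonormal J f φ) (h : Hom T'.toSuperSpace T.toSuperSpace) :
    B.IsPulledOrthonormal J (f.comp h) (vectPull f h ∘ₗ φ) := by
  obtain ⟨U, i, hi, s, k, rfl, hs, ho, rfl⟩ := hφ
  exact of_isOrthonormal hs ho (k.comp h)

theorem isStableFrame [FiniteDimensional ℂ V] (hM : M.IsModelledOn V)
    (hφ : B.IsPulledOrthonormal J f φ) : IsStableFrame f φ := by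
  obtain ⟨U, i, hi, s, k, rfl, hs, ho, rfl⟩ := hφ
  exact (hs.isStableFrame hM hi).pull k

/-- Over an open subspace the pullbacks of orthonormal frames are orthonormal. -/
theorem isOrthonormal (hf : f.IsOpenImmersion) (hφ : B.IsPulledOrthonormal J f φ) :
    B.IsOrthonormal J hf φ := by
  obtain ⟨U, i, hi, s, k, rfl, hs, ho, rfl⟩ := hφ
  intro v w
  refine (B.restrict U T i k hi hf (s v) (s w)).trans ?_
  rw [ho, AlgHom.commutes]

/-- Two pullbacks of orthonormal frames along the same morphism differ by an element of
`P(V, J)`: both come from the intersection of the two open subspaces of `M`. -/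
theorem exists_frameAct (hφ : B.IsPulledOrthonormal J f φ) (hψ : B.IsPulledOrthonormal J f ψ) :
    ∃ g ∈ PGroup J T.Γ, ψ = frameAct φ g := by
  obtain ⟨U, i, hi, s, h, rfl, hs, ho, rfl⟩ := hφ
  obtain ⟨U', i', hi', s', h', e, hs', ho', rfl⟩ := hψ
  -- `R` is the intersection of `U` and `U'`, through which both `h` and `h'` factor by way of `a`
  let N : Opens U.carrier := i.pre (hi'.image ⊤)
  have hN : ∀ x, ∃ u, i'.base u = (i.comp (U.incl N)).base x := by
    rintro ⟨x, u, -, hu⟩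
    exact ⟨u, hu⟩
  let R := U.restrict N
  let k : Hom R.toSuperSpace U.toSuperSpace := U.incl N
  let k' : Hom R.toSuperSpace U'.toSuperSpace := hi'.lift _ hN
  have hk : k.IsOpenImmersion := isOpenImmersion_incl _ _
  have ek : i'.comp k' = i.comp k := hi'.comp_lift _ hN
  have hik := hi.comp hk
  have hk' : k'.IsOpenImmersion := hi'.of_comp (ek ▸ hik)
  have ha : ∀ t, ∃ u, k.base u = h.base t := fun t => by
    have h1 := congrArg (fun f : Hom T.toSuperSpace M.toSuperSpace => f.base t) e
    exact ⟨⟨h.base t, h'.base t, trivial, h1⟩, rfl⟩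
  obtain ⟨a, rfl⟩ : ∃ a, h = k.comp a := ⟨hk.lift h ha, (hk.comp_lift h ha).symm⟩
  obtain rfl : k'.comp a = h' := hi'.cancel
    ((congrArg (fun f : Hom R.toSuperSpace M.toSuperSpace => f.comp a) ek).trans e.symm)
  have f1 : IsFrame (i.comp k) (vectPull i k ∘ₗ s) :=
    ⟨fun p v hv => vectPull_mem_Der k (hs.even p v hv), fun Q c hc => hs.bijective Q (k.comp c)
      (hk.comp hc)⟩
  have f2 : ∀ (c : Hom R.toSuperSpace M.toSuperSpace) (e : i'.comp k' = c) (_ : i.comp k = c),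
      IsFrame c (castVect e ∘ₗ (vectPull i' k' ∘ₗ s')) := by
    rintro _ rfl -
    exact ⟨fun p v hv => vectPull_mem_Der k' (hs'.even p v hv), fun Q c hc =>
      hs'.bijective Q (k'.comp c) (hk'.comp hc)⟩
  obtain ⟨g, hg, e1⟩ := OddMetric.IsOrthonormal.frameAct_mem B J f1 (f2 _ ek rfl)
    ((of_isOrthonormal hs ho k).isOrthonormal hik)
    (isOrthonormal hik ⟨U', i', hi', s', k', ek, hs', ho', rfl⟩)
  refine ⟨baseMap V a.onΓ ∘ₗ g, PGroup_baseMap (onΓ_even a) hg, ?_⟩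
  have e2 := congrArg (fun ξ => vectPull (i.comp k) a ∘ₗ ξ) e1
  rw [vectPull_frameAct, vectPull_castVect] at e2
  exact e2

end OddMetric.IsPulledOrthonormal

variable (J) in
/-- The `T`-points of the bundle of orthonormal frames of `B`: locally on `T` they differ by an
element of `P(V, J)` from a pullback of an orthonormal frame over an open subspace of `M`. -/
def OddMetric.orthonormalPoints (T : MixedSupermanifold)
    (f : Hom T.toSuperSpace M.toSuperSpace) : Set (V →ₗ[ℂ] Vect f) :=
  {φ | ∀ t : T.carrier, ∃ (R : MixedSupermanifold) (k : Hom R.toSuperSpace T.toSuperSpace),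
    k.IsOpenImmersion ∧ t ∈ Set.range k.base ∧ ∃ ψ, B.IsPulledOrthonormal J (f.comp k) ψ ∧
      ∃ g ∈ PGroup J R.Γ, vectPull f k ∘ₗ φ = frameAct ψ g}

theorem OddMetric.IsPulledOrthonormal.mem_points {φ : V →ₗ[ℂ] Vect f}
    (hφ : B.IsPulledOrthonormal J f φ) : φ ∈ B.orthonormalPoints J T f := fun t =>
  ⟨T, Hom.id _, Hom.isOpenImmersion_id _, ⟨t, rfl⟩, _, hφ.pull (Hom.id _), _, mk_mem_PGroup,
    (frameAct_mk _).symm⟩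

theorem OddMetric.orthonormalPoints_pull (h : Hom T'.toSuperSpace T.toSuperSpace)
    {φ : V →ₗ[ℂ] Vect f} (hφ : φ ∈ B.orthonormalPoints J T f) :
    vectPull f h ∘ₗ φ ∈ B.orthonormalPoints J T' (f.comp h) := by
  intro t
  obtain ⟨R, k, hk, ht, ψ, hψ, g, hg, e⟩ := hφ (h.base t)
  obtain ⟨R', k', l, hk', ht', e'⟩ := exists_local_lift T' hk h t ht
  have : ∀ c, k.comp l = c → ∃ ψ, B.IsPulledOrthonormal J (f.comp c) ψ ∧
      ∃ g ∈ PGroup J R'.Γ, vectPull f c ∘ₗ φ = frameAct ψ g := by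
    rintro _ rfl
    refine ⟨_, hψ.pull l, _, PGroup_baseMap (onΓ_even l) hg, ?_⟩
    exact (congrArg (fun ξ => vectPull (f.comp k) l ∘ₗ ξ) e).trans (vectPull_frameAct ψ l g)
  exact ⟨R', k', hk', ht', this _ e'⟩

theorem OddMetric.orthonormalPoints_act {φ : V →ₗ[ℂ] Vect f}
    (hφ : φ ∈ B.orthonormalPoints J T f) {g : V →ₗ[ℂ] T.Γ ⊗[ℂ] V} (hg : g ∈ PGroup J T.Γ) :
    frameAct φ g ∈ B.orthonormalPoints J T f := by
  intro t
  obtain ⟨R, k, hk, ht, ψ, hψ, g', hg', e⟩ := hφ t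
  refine ⟨R, k, hk, ht, ψ, hψ, _, PGroup_mul hg' (PGroup_baseMap (onΓ_even k) hg), ?_⟩
  rw [vectPull_frameAct, e, frameAct_frameAct]

theorem FrameReduction.ext_points {G : LinearGroupFunctor V} {P Q : FrameReduction G M}
    (h : ∀ T f, P.points T f = Q.points T f) : P = Q := by
  obtain ⟨p, _, _, _, _, _⟩ := P
  obtain ⟨q, _, _, _, _, _⟩ := Q
  obtain rfl : p = q := funext fun T => funext fun f => h T f
  rfl

variable [FiniteDimensional ℂ V]

theorem OddMetric.isStableFrame_of_mem (hM : M.IsModelledOn V) {φ : V →ₗ[ℂ] Vect f}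
    (hφ : φ ∈ B.orthonormalPoints J T f) : IsStableFrame f φ := by
  refine IsStableFrame.of_locally fun t => ?_
  obtain ⟨R, k, hk, ht, ψ, hψ, g, hg, e⟩ := hφ t
  refine ⟨R.toSuperSpace, k, hk, ht, ?_⟩
  rw [e]
  exact (hψ.isStableFrame hM).act hg.1

/-- The orthonormal frames of an odd metric form a `P(V, J)`-structure. Local triviality rests on
the existence of local orthonormal frames `s`; a section `h^*s · g` with `g ∈ GL(V)` belongs to the
structure only if `g` preserves `J`, which is a local condition. -/
def OddMetric.reduction (hJ : IsOddMetricForm J) (hM : M.IsModelledOn V) :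
    FrameReduction (PGroup J) M where
  points := B.orthonormalPoints J
  isFrame T _ _ hφ := (B.isStableFrame_of_mem hM hφ).isFrame T.evalSpace
  pull _ _ _ h _ hφ := B.orthonormalPoints_pull h hφ
  sheaf T f φ hφ t := by
    obtain ⟨T', j, hj, ⟨t', rfl⟩, hm⟩ := hφ t
    obtain ⟨R, k, hk, ⟨r, rfl⟩, h⟩ := hm t'
    exact ⟨R, j.comp k, hj.comp hk, ⟨r, rfl⟩, h⟩
  act _ _ _ hφ _ hg := B.orthonormalPoints_act hφ hg
  locallyTrivial m := by
    obtain ⟨U, i, hi, s, hm, hs, ho⟩ := B.exists_orthonormal hJ hM m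
    have hsm : s ∈ B.orthonormalPoints J U i :=
      (OddMetric.IsPulledOrthonormal.of_isOrthonormal hs ho (Hom.id _)).mem_points
    refine ⟨U, i, hi, hm, s, hsm, fun T h φ => ⟨fun hφ => ?_, ?_⟩⟩
    · have hst := (hs.isStableFrame hM hi).pull h
      obtain ⟨g, hg, rfl⟩ := exists_frameAct_eq hst.even (B.isStableFrame_of_mem hM hφ).even
        ((hst.isFrame T.evalSpace).bijective _ (Hom.id _) (Hom.isOpenImmersion_id _))
        (((B.isStableFrame_of_mem hM hφ).isFrame T.evalSpace).bijective _ (Hom.id _)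
          (Hom.isOpenImmersion_id _))
      refine ⟨g, ⟨hg, fun v w => eq_of_onΓ_eq fun t => ?_⟩, rfl⟩
      obtain ⟨R, k, hk, ht, ψ, hψ, g', hg', e⟩ := hφ t
      refine ⟨R.toSuperSpace, k, hk, ht, ?_⟩
      have hσ : B.IsPulledOrthonormal J ((i.comp h).comp k) (vectPull (i.comp h) k ∘ₗ
        (vectPull i h ∘ₗ s)) := (OddMetric.IsPulledOrthonormal.of_isOrthonormal hs ho h).pull k
      -- over `R` the section is both `k^*h^*s · g` and `k^*h^*s · p g'` with `p, g' ∈ P(V, J)`,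
      -- whence `g = p g'` there
      obtain ⟨p, hp, rfl⟩ := hσ.exists_frameAct hψ
      rw [vectPull_frameAct, frameAct_frameAct] at e
      have hinj := (((hσ.isStableFrame hM).isFrame R.evalSpace).bijective _ (Hom.id _)
          (Hom.isOpenImmersion_id _)).1
      have hg1 : ∀ v, baseMap V k.onΓ (g v) = (glExt p ∘ₗ g') v := fun v =>
        hinj (congrArg (fun L : V →ₗ[ℂ] Vect ((i.comp h).comp k) => L v) e)
      rw [map_oddExt _ (onΓ_even k), hg1, hg1, AlgHom.commutes]
      exact (PGroup_mul hp hg').2 v w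
    · rintro ⟨g, hg, rfl⟩
      exact B.orthonormalPoints_act (B.orthonormalPoints_pull h hsm) hg

/-- The frames of the reduction of `B` over open subspaces are orthonormal. -/
theorem OddMetric.isOrthonormal_of_mem (hf : f.IsOpenImmersion) {φ : V →ₗ[ℂ] Vect f}
    (hM : M.IsModelledOn V)
    (hφ : φ ∈ B.orthonormalPoints J T f) : B.IsOrthonormal J hf φ := by
  intro v w
  refine eq_of_onΓ_eq fun t => ?_
  obtain ⟨R, k, hk, ht, ψ, hψ, g, hg, e⟩ := hφ t
  refine ⟨R.toSuperSpace, k, hk, ht, ?_⟩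
  have h1 := B.form_frameAct J (hf.comp hk) (hψ.isStableFrame hM).even
    (hψ.isOrthonormal (hf.comp hk)) g v w
  rw [← e, hg.2] at h1
  rw [AlgHom.commutes, ← h1]
  exact (B.restrict T R f k hf (hf.comp hk) (φ v) (φ w)).symm

theorem OddMetric.ext_form {B B' : OddMetric M}
    (h : ∀ U i hi X Y, B.form U i hi X Y = B'.form U i hi X Y) : B = B' := by
  obtain ⟨b, _, _, _, _, _⟩ := B
  obtain ⟨b', _, _, _, _, _⟩ := B'
  obtain rfl : b = b' := funext fun U => funext fun i => funext fun hi =>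
    LinearMap.ext fun X => LinearMap.ext fun Y => h U i hi X Y
  rfl

/-- The frames orthonormal for the metric of `P` are locally the sections of `P`, up to the action
of `P(V, J)`. -/
theorem FrameReduction.reduction_metric (hJ : IsOddMetricForm J) (hM : M.IsModelledOn V)
    (P : FrameReduction (PGroup J) M) : (P.metric hJ).reduction hJ hM = P := by
  refine FrameReduction.ext_points fun T f => Set.ext fun φ => ⟨fun hφ => ?_, fun hφ t => ?_⟩
  · refine P.sheaf T f φ fun t => ?_
    obtain ⟨R, k, hk, ht, ψ, ⟨U, i, hi, s, h, e', hs, ho, rfl⟩, g, hg, e⟩ := hφ t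
    refine ⟨R, k, hk, ht, ?_⟩
    rw [e]
    refine P.act _ _ _ ?_ g hg
    have : ∀ (c : Hom R.toSuperSpace M.toSuperSpace) (e : i.comp h = c),
        castVect e ∘ₗ (vectPull i h ∘ₗ s) ∈ P.points R c := by
      rintro _ rfl
      exact P.pull U R i h s ((P.mem_points_iff hJ hi hs).mpr ho)
    exact this _ e'
  · obtain ⟨R, k, hk, ht, U, i, s, l, e, hi, hs, -, htriv⟩ := P.exists_local_section f t
    have hsf := P.isFrame U i s hs
    obtain ⟨g, hg, h⟩ := htriv _ (P.pull T R f k φ hφ)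
    exact ⟨R, k, hk, ht, _, ⟨U, i, hi, s, l, e, hsf, (P.mem_points_iff hJ hi hsf).mp hs, rfl⟩,
      g, hg, h⟩

/-- `B` is computed by `J` in its orthonormal frames, which is how the metric of its reduction is
defined. -/
theorem OddMetric.metric_reduction (hJ : IsOddMetricForm J) (hM : M.IsModelledOn V) :
    (B.reduction hJ hM).metric hJ = B := by
  refine OddMetric.ext_form fun U i hi X Y => ?_
  refine FrameReduction.IsPairing.unique (B.reduction hJ hM)
    ((B.reduction hJ hM).isPairing_pairing i X Y) fun R k hk φ hφ x y hx hy => ?_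
  have ho := B.isOrthonormal_of_mem (J := J) (hi.comp hk) hM hφ
  have he := (B.isStableFrame_of_mem (J := J) hM hφ).even
  rw [← B.gram_eq_oddExt J (hi.comp hk) he ho, B.gram_apply, hx, hy]
  exact (B.restrict U R i k hi (hi.comp hk) X Y).symm

/-- The correspondence between `P(V, J)`-structures and odd metrics. -/
def reductionEquivMetric (hJ : IsOddMetricForm J) (hM : M.IsModelledOn V) :
    FrameReduction (PGroup J) M ≃ OddMetric M where
  toFun P := P.metric hJ
  invFun B := B.reduction hJ hM
  left_inv P := P.reduction_metric hJ hM
  right_inv B := B.metric_reduction hJ hM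

end ReductionOf

end

theorem mainTheorem6 {V : Type} [AddCommGroup V] [Module ℂ V] [FiniteDimensional ℂ V]
    [SuperModule V] (J : V →ₗ[ℂ] V →ₗ[ℂ] ℂ) (hJ : IsOddMetricForm J) :
    (∀ M : MixedSupermanifold, M.IsModelledOn V →
      ∃ Φ : FrameReduction (PGroup J) M ≃ OddMetric M,
        ∀ (P : FrameReduction (PGroup J) M) (U : MixedSupermanifold)
          (i : SuperSpace.Hom U.toSuperSpace M.toSuperSpace) (hi : i.IsOpenImmersion)
          (s : V →ₗ[ℂ] Vect i), IsFrame i s →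
          (s ∈ P.points U i ↔ (Φ P).IsOrthonormal J hi s)) ∧
    IsFiniteType (PGroup J) ∧
    prolongation (lieSuperalgebra (PGroup J)) 1 = ⊥ := by
  have h1 := prolongation_one_eq_bot hJ
  exact ⟨fun M hM => ⟨reductionEquivMetric hJ hM, fun P U i hi s hs => P.mem_points_iff hJ hi hs⟩,
    ⟨1, le_rfl, prolongation_eq_bot_of_one h1⟩, h1⟩
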